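/- Let $\omega=(\omega_i)_{i\in\mathbb Z}$, where each $\omega_i$ is a probability vector on $\{-2,-1,1,2\}$, and let $P_\omega^x$ be the law of the Markov chain $(X_n)_{n\ge 0}$ on $\mathbb Z$ with $X_0=x$ and $P_\omega(X_{n+1}=i+l\mid X_n=i)=\omega_i(l)$. Suppose that $\limsup_n X_n=\infty$ $P_\omega^0$-almost surely, and let $T_1=\inf\{n\ge 0:X_n>0\}$. **Excursions.** An excursion at $i$ over the times $k,\dots,r+1$ (with $k<r$) is a piece of path with $X_{k+1},\dots,X_r\le i-1$ and $X_{r+1}\ge i$ whose first step $X_k\to X_{k+1}$ is $i\to i-1$ (type $A$), $i\to i-2$ (type $B$) or $i+1\to i-1$ (type $C$); it has subtype $1,2,3$ if its last step $X_r\to X_{r+1}$ is $i-1\to i$, $i-2\to i$, $i-1\to i+1$ respectively. The nine types are ordered $A_1,A_2,A_3,B_1,B_2,B_3,C_1,C_2,C_3$. For $i\le 0$ let $U_i\in\{0,1,\dots\}^9$ (a row vector) count the excursions at $i$ of each type up to time $T_1$; $U_1$ is defined in the same way, at $i=1$, for the path $(X_{-1},X_0,X_1,\dots,X_{T_1})$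 with an imaginary first position $X_{-1}=1$. The type-$m$ particles born to a type-$l$ particle of generation $i+1$ are the type-$m$ excursions at $i$ contained in a type-$l$ excursion at $i+1$. **Quantities.** For $k\le i<j$ let $f_k(i,j)$ be the $P_\omega^k$-probability that $(X_n)$ first enters $(i,\infty)$ at $j$. Put $$S_i=\sum_{n,m\ge0}\frac{(n+m)!}{n!\,m!}\,[\omega_{i-1}(-1)f_{i-2}(i-2,i-1)]^n[\omega_{i-1}(-2)f_{i-3}(i-2,i-1)]^m ,$$ $\alpha_{i,1}=\omega_i(-1)S_i\omega_{i-1}(1)$, $\alpha_{i,3}=\omega_i(-1)S_i\omega_{i-1}(2)$, $\alpha_{i,2}=\omega_i(-1)-\alpha_{i,1}-\alpha_{i,3}$; $\beta_{i,1}=\omega_i(-2)f_{i-2}(i-2,i-1)S_i\omega_{i-1}(1)$, $\beta_{i,3}=\omega_i(-2)f_{i-2}(i-2,i-1)S_i\omega_{i-1}(2)$, $\beta_{i,2}=\omega_i(-2)-\beta_{i,1}-\beta_{i,3}$; $\gamma_{i,1}=\omega_{i+1}(-2)S_i\omega_{i-1}(1)$, $\gamma_{i,3}=\omega_{i+1}(-2)S_i\omega_{i-1}(2)$,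 $\gamma_{i,2}=\omega_{i+1}(-2)-\gamma_{i,1}-\gamma_{i,3}$. With $d_i=1-\alpha_{i,1}-\alpha_{i,2}-\beta_{i,1}-\beta_{i,2}$ let $$x_i=\frac{\alpha_{i,1}}{d_i},\quad y_i=\frac{\alpha_{i,2}}{d_i},\quad z_i=\frac{\beta_{i,1}}{d_i},\quad w_i=\frac{\beta_{i,2}}{d_i},\quad v_i=1-\frac{\gamma_{i,3}}{\beta_{i+1,2}},\quad s_i=\frac{\alpha_{i,3}}{\alpha_{i,3}+\beta_{i,3}},\quad t_i=\frac{\gamma_{i,1}}{\gamma_{i,1}+\gamma_{i,2}},$$ $$Q_i=\begin{pmatrix} x_i&y_i&0&z_i&w_i&0&0&0&0\\ x_i&y_i&s_i&z_i&w_i&1-s_i&0&0&0\\ x_i&y_i&0&z_i&w_i&0&0&0&0\\ x_i&y_i&0&z_i&w_i&0&t_i&1-t_i&0\\ x_iv_i&y_iv_i&s_iv_i&z_iv_i&w_iv_i&(1-s_i)v_i&t_iv_i&(1-t_i)v_i&1-v_i\\ x_i&y_i&0&z_i&w_i&0&t_i&1-t_i&0\\ x_i&y_i&0&z_i&w_i&0&0&0&0\\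 x_i&y_i&s_i&z_i&w_i&1-s_i&0&0&0\\ x_i&y_i&0&z_i&w_i&0&0&0&0 \end{pmatrix}.$$ (In degenerate environments a quotient with denominator $0$ is read as $0$, and so is $S_i$ if its series diverges; this is immaterial below.) Then: 1. Let $i\le 0$, let $l$ be a type, and let $a$ be the starting site of type-$l$ excursions at $i+1$ ($a=i+1$ for types $A,B$ and $a=i+2$ for type $C$). If $P_\omega^a(\limsup_n X_n=\infty)=1$ and, under $P_\omega^a$, the path begins with a type-$l$ excursion at $i+1$ with positive probability, then for every $m$ the mean number of type-$m$ particles born to this type-$l$ particle, given that the path begins with it, is finite and equal to the entry $Q_i(l,m)$. 2. The $Q_i$ are the mean matrices of $\{U_i\}_{i\le1}$: for $i\le 0$ and $u\in\{0,1,\dots\}^9$ with $P_\omega^0(U_{i+1}=u)>0$, $E_\omega^0(U_i\mid U_{i+1}=u)=u\,Q_i$, with finite entries. 3. Let $u_1=E_\omega^0(U_1)$. If $\omega_1(-1)>0$, then $u_1=\dfrac{(\alpha_{1,1},\alpha_{1,2},\alpha_{1,3},0,0,0,0,0,0)}{\alpha_{1,1}+\alpha_{1,2}+\alpha_{1,3}}$.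 4. For every $i\le0$, $E_\omega^0(U_i)=u_1Q_0Q_{-1}\cdots Q_i$, with finite entries. Consequently, as an equality in $[0,\infty]$, $$E_\omega^0(T_1)=1+\sum_{i\le0}u_1Q_0Q_{-1}\cdots Q_i\,(2,2,1,1,1,0,2,2,1)^T .$$ -/

import Mathlib

open MeasureTheory ProbabilityTheory Filter Matrix
open scoped ENNReal

noncomputable section

/-- Transition probabilities of a (2-2) random walk on `ℤ`: `ω.prob i l` is the probability
`ω_i(l)` of a jump from `i` to `i + l`, for `l ∈ {-2, -1, 1, 2}`. -/
structure Environment where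
  prob : ℤ → ℤ → ℝ
  nonneg : ∀ i l, 0 ≤ prob i l
  eq_zero : ∀ i l, l ∉ ({-2, -1, 1, 2} : Finset ℤ) → prob i l = 0
  sum_eq_one : ∀ i, ∑ l ∈ ({-2, -1, 1, 2} : Finset ℤ), prob i l = 1

namespace Environment

/-- The law of the position after one step from `i`. -/
def stepLaw (ω : Environment) (i : ℤ) : Measure ℤ :=
  ∑ l ∈ ({-2, -1, 1, 2} : Finset ℤ), ENNReal.ofReal (ω.prob i l) • Measure.dirac (i + l)

instance (ω : Environment) (i : ℤ) : IsProbabilityMeasure (ω.stepLaw i) := by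
  constructor
  have h : ω.stepLaw i Set.univ
      = ∑ l ∈ ({-2, -1, 1, 2} : Finset ℤ), ENNReal.ofReal (ω.prob i l) := by
    simp [stepLaw]
  rw [h, ← ENNReal.ofReal_sum_of_nonneg fun l _ => ω.nonneg i l, ω.sum_eq_one,
    ENNReal.ofReal_one]

/-- The transition kernel of the walk. -/
def stepKernel (ω : Environment) : Kernel ℤ ℤ :=
  Kernel.ofFunOfCountable ω.stepLaw

instance (ω : Environment) : IsMarkovKernel ω.stepKernel :=
  ⟨fun i => inferInstanceAs (IsProbabilityMeasure (ω.stepLaw i))⟩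

/-- The transition kernel at time `n`, as a kernel from the past `(X_0, …, X_n)`; it depends on
the last position `X_n` only. -/
def pastKernel (ω : Environment) (n : ℕ) : Kernel (∀ _ : Finset.Iic n, ℤ) ℤ :=
  ω.stepKernel.comap (fun h => h ⟨n, Finset.mem_Iic.2 le_rfl⟩) (measurable_pi_apply _)

instance (ω : Environment) (n : ℕ) : IsMarkovKernel (ω.pastKernel n) := by
  unfold pastKernel; infer_instance

/-- `P_ω^x`: the law, on the space `ℕ → ℤ` of trajectories, of the Markov chain `(X_n)` with
`X_0 = x` and transition probabilities `P (X_{n+1} = i + l | X_n = i) = ω_i(l)`. -/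
def walkLaw (ω : Environment) (x : ℤ) : Measure (ℕ → ℤ) :=
  Kernel.traj (X := fun _ => ℤ) ω.pastKernel 0 (fun _ => x)

instance (ω : Environment) (x : ℤ) : IsProbabilityMeasure (ω.walkLaw x) := by
  unfold walkLaw; infer_instance

/-- `limsup X_n = ∞` almost surely for the walk started at `x`. -/
def LimsupEqTop (ω : Environment) (x : ℤ) : Prop :=
  ∀ᵐ X ∂ω.walkLaw x, limsup (fun n => ((X n : ℝ) : EReal)) atTop = ⊤

end Environment

/-- `T_1 = inf {n ≥ 0 : X_n > 0}`, with value `⊤` if there is no such `n`. -/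
def ladderTime (X : ℕ → ℤ) : ℕ∞ := ⨅ (n : ℕ) (_ : 0 < X n), (n : ℕ∞)

/-! The nine types of particles are indexed by `Fin 9` in the order
`A₁, A₂, A₃, B₁, B₂, B₃, C₁, C₂, C₃`. The next four vectors describe the first step and the last
step of an excursion at `i` of each type, relative to `i`. -/

/-- First position, relative to `i`: `i` for types A and B, `i + 1` for type C. -/
def startShift : Fin 9 → ℤ := ![0, 0, 0, 0, 0, 0, 1, 1, 1]

/-- Position after the first step: `i - 1` for types A and C, `i - 2` for type B. -/
def landShift : Fin 9 → ℤ := ![-1, -1, -1, -2, -2, -2, -1, -1, -1]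

/-- Position before the last step: `i - 1, i - 2, i - 1` for the subtypes `1, 2, 3`. -/
def preShift : Fin 9 → ℤ := ![-1, -2, -1, -1, -2, -1, -1, -2, -1]

/-- Final position: `i, i, i + 1` for the subtypes `1, 2, 3`. -/
def endShift : Fin 9 → ℤ := ![0, 0, 1, 0, 0, 1, 0, 0, 1]

/-- The path `X` makes an excursion of type `l` at `i` during the time interval `[k, r + 1]`: its
first step is the one from time `k` to `k + 1`, it stays in `(-∞, i - 1]` at the times
`k + 1, …, r`, and its last step, from time `r` to `r + 1`, takes it to `[i, ∞)`. -/
def IsExcursion (X : ℕ → ℤ) (i : ℤ) (l : Fin 9) (k r : ℕ) : Prop :=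
  k < r ∧ X k = i + startShift l ∧ X (k + 1) = i + landShift l ∧
    (∀ j, k < j → j ≤ r → X j ≤ i - 1) ∧
    X r = i + preShift l ∧ X (r + 1) = i + endShift l

/-- The number of excursions of type `l` at `i` of the path `X` up to time `N`. -/
def excursionCount (X : ℕ → ℤ) (N : ℕ∞) (i : ℤ) (l : Fin 9) : ℕ∞ :=
  {p : ℕ × ℕ | ((p.2 + 1 : ℕ) : ℕ∞) ≤ N ∧ IsExcursion X i l p.1 p.2}.encard

/-- The path with the imaginary step from `X_{-1} = 1` to `X_0` put in front. -/
def withImaginaryStep (X : ℕ → ℤ) : ℕ → ℤ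
  | 0 => 1
  | n + 1 => X n

/-- `U_i`, the numbers of excursions at `i` of the nine types before time `T_1`. For `i ≤ 0` they
are counted on the path `X` itself, for `i = 1` (the immigration) on the path with the
imaginary step. -/
def population (X : ℕ → ℤ) (i : ℤ) (l : Fin 9) : ℕ∞ :=
  if i ≤ 0 then excursionCount X (ladderTime X) i l
  else excursionCount (withImaginaryStep X) (ladderTime X + 1) i l

/-- The paths that begin with an excursion of type `l` at `i`. -/
def particleEvent (i : ℤ) (l : Fin 9) : Set (ℕ → ℤ) :=
  {X | ∃ r, IsExcursion X i l 0 r}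

/-- The number of excursions of type `m` at `i` that are contained in the excursion of type `l`
at `i + 1` with which the path begins: the type-`m` particles born to a type-`l` particle. -/
def offspringCount (i : ℤ) (l m : Fin 9) (X : ℕ → ℤ) : ℕ∞ :=
  {p : ℕ × ℕ | ∃ r, IsExcursion X (i + 1) l 0 r ∧ p.2 ≤ r ∧ IsExcursion X i m p.1 p.2}.encard

namespace Environment

/-- The law of a type-`l` particle at `i`: the walk from the starting site of the excursion,
conditioned to begin with an excursion of type `l` at `i`. -/
def particleLaw (ω : Environment) (i : ℤ) (l : Fin 9) : Measure (ℕ → ℤ) :=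
  (ω.walkLaw (i + startShift l))[|particleEvent i l]

/-- The mean number of type-`m` particles (excursions at `i`) born to a type-`l` particle of
generation `i + 1` (an excursion at `i + 1`). -/
def meanOffspring (ω : Environment) (i : ℤ) (l m : Fin 9) : ℝ≥0∞ :=
  ∫⁻ X, (offspringCount i l m X : ℝ≥0∞) ∂ω.particleLaw (i + 1) l

/-- `f_k(i, j)`, for `k ≤ i < j`: the probability that the walk from `k` first enters
`(i, ∞)` at `j`. -/
def f (ω : Environment) (k i j : ℤ) : ℝ :=
  (ω.walkLaw k).real {X | ∃ n, X n = j ∧ ∀ m < n, X m ≤ i}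

/-- `∑_{n,m ≥ 0} (n+m)!/(n! m!) [ω_{i-1}(-1) f_{i-2}(i-2,i-1)]^n [ω_{i-1}(-2) f_{i-3}(i-2,i-1)]^m`. -/
def returnSum (ω : Environment) (i : ℤ) : ℝ :=
  ∑' p : ℕ × ℕ, (((p.1 + p.2).factorial : ℝ) / (p.1.factorial * p.2.factorial)) *
    (ω.prob (i - 1) (-1) * ω.f (i - 2) (i - 2) (i - 1)) ^ p.1 *
    (ω.prob (i - 1) (-2) * ω.f (i - 3) (i - 2) (i - 1)) ^ p.2

def α₁ (ω : Environment) (i : ℤ) : ℝ := ω.prob i (-1) * ω.returnSum i * ω.prob (i - 1) 1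
def α₃ (ω : Environment) (i : ℤ) : ℝ := ω.prob i (-1) * ω.returnSum i * ω.prob (i - 1) 2
def α₂ (ω : Environment) (i : ℤ) : ℝ := ω.prob i (-1) - ω.α₁ i - ω.α₃ i

def β₁ (ω : Environment) (i : ℤ) : ℝ :=
  ω.prob i (-2) * ω.f (i - 2) (i - 2) (i - 1) * ω.returnSum i * ω.prob (i - 1) 1
def β₃ (ω : Environment) (i : ℤ) : ℝ :=
  ω.prob i (-2) * ω.f (i - 2) (i - 2) (i - 1) * ω.returnSum i * ω.prob (i - 1) 2
def β₂ (ω : Environment) (i : ℤ) : ℝ := ω.prob i (-2) - ω.β₁ i - ω.β₃ i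

def γ₁ (ω : Environment) (i : ℤ) : ℝ := ω.prob (i + 1) (-2) * ω.returnSum i * ω.prob (i - 1) 1
def γ₃ (ω : Environment) (i : ℤ) : ℝ := ω.prob (i + 1) (-2) * ω.returnSum i * ω.prob (i - 1) 2
def γ₂ (ω : Environment) (i : ℤ) : ℝ := ω.prob (i + 1) (-2) - ω.γ₁ i - ω.γ₃ i

def x (ω : Environment) (i : ℤ) : ℝ := ω.α₁ i / (1 - ω.α₁ i - ω.α₂ i - ω.β₁ i - ω.β₂ i)
def y (ω : Environment) (i : ℤ) : ℝ := ω.α₂ i / (1 - ω.α₁ i - ω.α₂ i - ω.β₁ i - ω.β₂ i)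
def z (ω : Environment) (i : ℤ) : ℝ := ω.β₁ i / (1 - ω.α₁ i - ω.α₂ i - ω.β₁ i - ω.β₂ i)
def w (ω : Environment) (i : ℤ) : ℝ := ω.β₂ i / (1 - ω.α₁ i - ω.α₂ i - ω.β₁ i - ω.β₂ i)
def v (ω : Environment) (i : ℤ) : ℝ := 1 - ω.γ₃ i / ω.β₂ (i + 1)
def s (ω : Environment) (i : ℤ) : ℝ := ω.α₃ i / (ω.α₃ i + ω.β₃ i)
def t (ω : Environment) (i : ℤ) : ℝ := ω.γ₁ i / (ω.γ₁ i + ω.γ₂ i)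

/-- The explicit matrix `Q_i`. Row `l` is meaningful when type-`l` particles can occur in
generation `i + 1`; then no denominator that matters in this row vanishes. -/
def Q (ω : Environment) (i : ℤ) : Matrix (Fin 9) (Fin 9) ℝ :=
  let x := ω.x i
  let y := ω.y i
  let z := ω.z i
  let w := ω.w i
  let v := ω.v i
  let s := ω.s i
  let t := ω.t i
  !![x, y, 0, z, w, 0, 0, 0, 0;
     x, y, s, z, w, 1 - s, 0, 0, 0;
     x, y, 0, z, w, 0, 0, 0, 0;
     x, y, 0, z, w, 0, t, 1 - t, 0;
     x * v, y * v, s * v, z * v, w * v, (1 - s) * v, t * v, (1 - t) * v, 1 - v;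
     x, y, 0, z, w, 0, t, 1 - t, 0;
     x, y, 0, z, w, 0, 0, 0, 0;
     x, y, s, z, w, 1 - s, 0, 0, 0;
     x, y, 0, z, w, 0, 0, 0, 0]

/-- The product `Q_0 Q_{-1} ⋯ Q_{-n}`. -/
def prodQ (ω : Environment) : ℕ → Matrix (Fin 9) (Fin 9) ℝ
  | 0 => ω.Q 0
  | n + 1 => prodQ ω n * ω.Q (-((n : ℤ) + 1))

/-- `u_1 = E_ω^0(U_1)`, the mean of the immigration. -/
def u₁ (ω : Environment) (l : Fin 9) : ℝ :=
  (∫⁻ X, (population X 1 l : ℝ≥0∞) ∂ω.walkLaw 0).toReal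

end Environment

end

/-! Everything is read off from how the walk leaves a half-line `(-∞, L]`. It does so almost surely
by one of the steps `L → L + 1`, `L - 1 → L + 1`, `L → L + 2`, and the probability of an exit step
is the mean number `green` of visits to its starting site times the step probability
(`exitProb_eq_green`). For the walk started at `L`, the middle exit is the end of the only A₃ or B₃
excursion at `L`, so its probability is also a multiple of the mean number of visits to `L`. As the
three probabilities add up to one, that mean is the inverse of `1 - returnProb L`
(`LimsupEqTop.green_mul`). The binomial series `S_i` is this number at level `i - 1`, and `1 / d_i`
is the same number at level `i`; hence α, β, γ are products of a step probability and an exit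
probability.

An excursion at `i + 1` is a first step followed by an exit from `(-∞, i]` by the step that its
subtype prescribes. Its children are the excursions at `i` before that exit and, for a parent of
type B, the excursion of type C that shares its first step `i + 1 → i - 1`. Means on a given exit
are computed by summing over the visits to `i`: a child that returns to `i` has no influence on the
exit, and a child that ends at `i + 1` is the exit (`exitOffspring_return`, `exitOffspring_jump`).
Parents of type B land at `i - 1`, and whether the path visits `i` before its exit accounts for
`t_i` and `v_i`. Division by the exit probability gives the rows of `Q_i` (`meanOffspring_eq`).

The mean given a whole generation `U_{i+1} = u` is a sum over the starting times of the parents. The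
type of an excursion fixes the sites where it starts and ends, so by the Markov property at both
ends its interior is independent of the earlier and later excursions of its generation
(`lintegral_offspring_countEvent`). Generation `1` is a single particle of type A, determined by the
exit from `(-∞, 0]`. Averaging over `u` multiplies the means by `Q_i`.

Finally, `T_1 - 1` counts the steps that end in `(-∞, 0]` before `T_1`. A down step is the first
step of exactly one excursion of type A or C, at the level just above its landing site; an up step
is the last step of exactly one excursion of subtype 1 or 2, at its landing site. This explains the
weights `(2,2,1,1,1,0,2,2,1)`.

The hypothesis is given at the site `0` only. It passes to every site that is reached with positive
probability (`LimsupEqTop.of_reach`), and terms at other sites have a vanishing factor. -/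

noncomputable section

/-! ### Cylinders and the Markov property -/

namespace WalkPath

/-- The path from time `k` on. -/
def shift (k : ℕ) (X : ℕ → ℤ) : ℕ → ℤ := fun n => X (n + k)

@[simp] lemma shift_apply (k n : ℕ) (X : ℕ → ℤ) : shift k X n = X (n + k) := rfl

lemma shift_shift (j k : ℕ) (X : ℕ → ℤ) : shift j (shift k X) = shift (j + k) X := by
  funext n; simp [add_assoc]

@[simp] lemma shift_zero (X : ℕ → ℤ) : shift 0 X = X := rfl

lemma measurable_shift (k : ℕ) : Measurable (shift k) :=
  measurable_pi_lambda _ fun _ => measurable_pi_apply _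

/-- `F X` depends on `X_0, …, X_k` only. -/
def DeterminedBy {β : Type*} (k : ℕ) (F : (ℕ → ℤ) → β) : Prop :=
  ∀ X Y : ℕ → ℤ, (∀ j ≤ k, X j = Y j) → F X = F Y

/-- `F` factors through the first `k + 1` positions, which form a countable discrete space, so
measurability is automatic for every target. -/
lemma DeterminedBy.measurable {β : Type*} [MeasurableSpace β] {k : ℕ} {F : (ℕ → ℤ) → β}
    (hF : DeterminedBy k F) : Measurable F := by
  classical
  have h : F = (fun h : (∀ _ : Finset.Iic k, ℤ) =>
      F (fun n => if hn : n ≤ k then h ⟨n, Finset.mem_Iic.2 hn⟩ else 0)) ∘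
        Preorder.frestrictLe (π := fun _ => ℤ) k := by
    funext X
    refine hF _ _ fun j hj => ?_
    simp [hj, Preorder.frestrictLe]
  rw [h]
  exact (measurable_of_countable _).comp (Preorder.measurable_frestrictLe k)

lemma measurableSet_of_determinedBy {k : ℕ} {A : Set (ℕ → ℤ)}
    (hA : DeterminedBy k (fun X => X ∈ A)) : MeasurableSet A :=
  measurableSet_setOfPred.2 hA.measurable

/-- The paths that agree with `p` up to time `n`. -/
def cyl (n : ℕ) (p : ℕ → ℤ) : Set (ℕ → ℤ) := {X | ∀ j ≤ n, X j = p j}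

lemma determinedBy_cyl (n : ℕ) (p : ℕ → ℤ) : DeterminedBy n (fun X => X ∈ cyl n p) := by
  intro X Y h
  refine propext (forall₂_congr fun j hj => ?_)
  rw [h j hj]

lemma measurableSet_cyl (n : ℕ) (p : ℕ → ℤ) : MeasurableSet (cyl n p) :=
  measurableSet_of_determinedBy (determinedBy_cyl n p)

lemma cyl_eq_preimage (n : ℕ) (p : ℕ → ℤ) :
    cyl n p = Preorder.frestrictLe (π := fun _ => ℤ) n ⁻¹'
      {(fun j => p j : ∀ _ : Finset.Iic n, ℤ)} := by
  ext X
  simp only [cyl, Set.mem_ofPred_eq, Set.mem_preimage, Set.mem_singleton_iff, funext_iff,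
    Subtype.forall, Finset.mem_Iic]
  rfl

/-- The law of `(X_0, …, X_n)` lives on a countable space and is fixed by its values at points, that
is, on cylinders. A measure on trajectories is the projective limit of these laws. -/
lemma measure_ext_cyl {μ ν : Measure (ℕ → ℤ)} [IsFiniteMeasure μ] [IsFiniteMeasure ν]
    (h : ∀ n p, μ (cyl n p) = ν (cyl n p)) : μ = ν := by
  have hP : IsProjectiveMeasureFamily (α := fun _ : ℕ => ℤ)
      (fun I : Finset ℕ => ν.map (I.restrict (π := fun _ : ℕ => ℤ))) := by
    intro I J hJI
    rw [Measure.map_map (Finset.measurable_restrict₂ _) (Finset.measurable_restrict _)]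
    rfl
  refine IsProjectiveLimit.unique (α := fun _ : ℕ => ℤ)
    (P := fun I : Finset ℕ => ν.map (I.restrict (π := fun _ : ℕ => ℤ)))
    ?_ fun I => rfl
  rw [isProjectiveLimit_nat_iff hP]
  intro n
  refine Measure.ext_of_singleton fun g => ?_
  classical
  have hg : g = fun j : Finset.Iic n =>
      (fun m => if hm : m ≤ n then g ⟨m, Finset.mem_Iic.2 hm⟩ else 0 : ℕ → ℤ) j := by
    funext j
    have := Finset.mem_Iic.1 j.2
    simp [this]
  rw [hg, Measure.map_apply (Preorder.measurable_frestrictLe n) (measurableSet_singleton _),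
    Measure.map_apply (Finset.measurable_restrict _) (measurableSet_singleton _)]
  have := h n (fun m => if hm : m ≤ n then g ⟨m, Finset.mem_Iic.2 hm⟩ else 0)
  rw [cyl_eq_preimage] at this
  exact this

end WalkPath

open WalkPath

namespace Environment

variable (ω : Environment)

lemma walkLaw_start (x : ℤ) : ω.walkLaw x {X | X 0 = x} = 1 := by
  have hm : MeasurableSet {g : ∀ _ : Finset.Iic 0, ℤ | g = fun _ => x} :=
    measurableSet_singleton _
  have h : {X : ℕ → ℤ | X 0 = x} = Preorder.frestrictLe (π := fun _ => ℤ) 0 ⁻¹'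
      {g : ∀ _ : Finset.Iic 0, ℤ | g = fun _ => x} := by
    ext X
    simp [funext_iff, Preorder.frestrictLe]
  rw [h, ← Measure.map_apply (Preorder.measurable_frestrictLe _) hm, walkLaw,
    Kernel.traj_map_frestrictLe_apply, Kernel.partialTraj_self, Kernel.id_apply,
    Measure.dirac_apply' _ hm]
  simp

lemma ae_start (x : ℤ) : ∀ᵐ X ∂ω.walkLaw x, X 0 = x := by
  have hm : MeasurableSet {X : ℕ → ℤ | X 0 = x} :=
    measurable_pi_apply (X := fun _ : ℕ => ℤ) 0 (measurableSet_singleton x)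
  exact (prob_compl_eq_zero_iff hm).2 (ω.walkLaw_start x)

lemma walkLaw_cyl_zero (x : ℤ) (p : ℕ → ℤ) :
    ω.walkLaw x (cyl 0 p) = if x = p 0 then 1 else 0 := by
  split_ifs with h
  · rw [← ω.walkLaw_start x]
    congr 1
    ext X
    simp [cyl, h]
  · refine measure_mono_null (fun X hX => ?_) (ae_iff.1 (ω.ae_start x))
    have : X 0 = p 0 := hX 0 le_rfl
    simp only [Set.mem_ofPred_eq, this]
    exact fun h' => h h'.symm

lemma walkLaw_cyl_succ (x : ℤ) (n : ℕ) (p : ℕ → ℤ) :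
    ω.walkLaw x (cyl (n + 1) p) = ω.walkLaw x (cyl n p) * ω.stepLaw (p n) {p (n + 1)} := by
  have key := Kernel.partialTraj_compProd_eq_map_traj (X := fun _ => ℤ) (κ := ω.pastKernel)
    (Nat.zero_le n) (x₀ := fun _ => x)
  have hs : cyl (n + 1) p = (fun X : ℕ → ℤ => (Preorder.frestrictLe (π := fun _ => ℤ) n X,
      X (n + 1))) ⁻¹' ({(fun j => p j : ∀ _ : Finset.Iic n, ℤ)} ×ˢ {p (n + 1)}) := by
    ext X
    rw [Set.mk_preimage_prod, ← cyl_eq_preimage]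
    simp only [cyl, Set.mem_ofPred_eq, Set.mem_inter_iff, Set.mem_preimage, Set.mem_singleton_iff]
    constructor
    · exact fun h => ⟨fun j hj => h j (by omega), h _ le_rfl⟩
    · rintro ⟨h1, h2⟩ j hj
      rcases Nat.lt_or_ge n j with h | h
      · obtain rfl : j = n + 1 := by omega
        exact h2
      · exact h1 j h
  have hm : Measurable (fun X : ℕ → ℤ => (Preorder.frestrictLe (π := fun _ => ℤ) n X,
      X (n + 1))) := (Preorder.measurable_frestrictLe n).prodMk (measurable_pi_apply _)
  have hms : MeasurableSet (({fun j : Finset.Iic n => p j} : Set (∀ _ : Finset.Iic n, ℤ)) ×ˢ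
      ({p (n + 1)} : Set ℤ)) := (measurableSet_singleton _).prod (measurableSet_singleton _)
  rw [hs, ← Measure.map_apply hm hms, walkLaw, ← key,
    Measure.compProd_apply_prod (measurableSet_singleton _) (measurableSet_singleton _),
    lintegral_singleton, mul_comm]
  congr 1
  rw [← Kernel.traj_map_frestrictLe_apply, Measure.map_apply (Preorder.measurable_frestrictLe n)
    (measurableSet_singleton _), cyl_eq_preimage]

lemma walkLaw_cyl_add (x : ℤ) (k n : ℕ) (p : ℕ → ℤ) :
    ω.walkLaw x (cyl (n + k) p)
      = ω.walkLaw x (cyl k p) * ω.walkLaw (p k) (cyl n (shift k p)) := by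
  induction n with
  | zero => simp [walkLaw_cyl_zero]
  | succ n ih =>
    rw [show n + 1 + k = n + k + 1 by omega, walkLaw_cyl_succ, walkLaw_cyl_succ, ih, mul_assoc]
    congr 3
    simp only [shift_apply]
    congr 2
    omega

/-- The Markov property, for a fixed history. -/
lemma map_shift_restrict_cyl (x : ℤ) (k : ℕ) (p : ℕ → ℤ) :
    ((ω.walkLaw x).restrict (cyl k p)).map (shift k)
      = ω.walkLaw x (cyl k p) • ω.walkLaw (p k) := by
  have : IsFiniteMeasure (ω.walkLaw x (cyl k p) • ω.walkLaw (p k)) :=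
    Measure.smul_finite _ (measure_ne_top _ _)
  refine measure_ext_cyl fun n q => ?_
  rw [Measure.map_apply (measurable_shift k) (measurableSet_cyl n q), Measure.smul_apply,
    Measure.restrict_apply (measurable_shift k (measurableSet_cyl n q)), smul_eq_mul]
  -- If `q` starts where `p` stands at time `k`, the two cylinders glue to one cylinder of length `n
  -- + k`; otherwise both sides are `0`.
  by_cases hq : q 0 = p k
  · have h := ω.walkLaw_cyl_add x k n (fun j => if j ≤ k then p j else q (j - k))
    have h1 : cyl k (fun j => if j ≤ k then p j else q (j - k)) = cyl k p := by
      ext X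
      refine forall₂_congr fun j hj => ?_
      simp [hj]
    have h2 : shift k (fun j => if j ≤ k then p j else q (j - k)) = q := by
      funext j
      rcases Nat.eq_zero_or_pos j with rfl | hj
      · simp [hq]
      · simp [show ¬ j + k ≤ k by omega]
    have h3 : cyl (n + k) (fun j => if j ≤ k then p j else q (j - k))
        = shift k ⁻¹' cyl n q ∩ cyl k p := by
      ext X
      rw [← h1]
      nth_rw 2 [← h2]
      simp only [cyl, Set.mem_ofPred_eq, Set.mem_inter_iff, Set.mem_preimage, shift_apply]
      constructor
      · exact fun h => ⟨fun j hj => h (j + k) (by omega), fun j hj => h j (by omega)⟩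
      · rintro ⟨ha, hb⟩ j hj
        rcases Nat.lt_or_ge j k with h | h
        · exact hb j h.le
        · have := ha (j - k) (by omega)
          rwa [Nat.sub_add_cancel h] at this
    rw [h1, h2, h3] at h
    simpa using h
  · have h1 : shift k ⁻¹' cyl n q ∩ cyl k p = ∅ := by
      ext X
      simp only [Set.mem_inter_iff, Set.mem_preimage, Set.mem_empty_iff_false, iff_false, not_and]
      intro ha hb
      have := ha 0 (Nat.zero_le _)
      have h' := hb k le_rfl
      simp only [shift_apply, Nat.zero_add] at this
      exact hq (by rw [← this, h'])
    have h2 : ω.walkLaw (p k) (cyl n q) = 0 := by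
      refine measure_mono_null (fun X hX => ?_) (ae_iff.1 (ω.ae_start (p k)))
      have : X 0 = q 0 := hX 0 (Nat.zero_le _)
      simp only [Set.mem_ofPred_eq, this]
      exact hq
    rw [h1, h2]
    simp

/-- The Markov property at the time `k`, for a factor `F` that depends on the past and fixes the
position at time `k`. -/
theorem lintegral_mul_shift (x a : ℤ) (k : ℕ) {F G : (ℕ → ℤ) → ℝ≥0∞} (hF : DeterminedBy k F)
    (hFa : ∀ X, F X ≠ 0 → X k = a) (hG : Measurable G) :
    ∫⁻ X, F X * G (shift k X) ∂ω.walkLaw x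
      = (∫⁻ X, F X ∂ω.walkLaw x) * ∫⁻ X, G X ∂ω.walkLaw a := by
  classical
  -- The countably many histories up to time `k` partition the space, and `F` is constant on each
  -- piece. The value `0` after time `k` plays no role.
  let e : (∀ _ : Finset.Iic k, ℤ) → ℕ → ℤ :=
    fun h n => if hn : n ≤ k then h ⟨n, Finset.mem_Iic.2 hn⟩ else 0
  have hcover : ⋃ h, cyl k (e h) = Set.univ := by
    refine Set.eq_univ_of_forall fun X => Set.mem_iUnion.2 ⟨fun j => X j, fun j hj => ?_⟩
    simp [e, hj]
  have hdisj : Pairwise (Function.onFun Disjoint fun h => cyl k (e h)) := by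
    intro h h' hne
    refine Set.disjoint_left.2 fun X hX hX' => hne ?_
    funext j
    have hj := Finset.mem_Iic.1 j.2
    have h1 := hX j hj
    have h2 := hX' j hj
    simp only [e, hj, dif_pos] at h1 h2
    exact h1.symm.trans h2
  have hm : ∀ h, MeasurableSet (cyl k (e h)) := fun h => measurableSet_cyl _ _
  have hsplit : ∀ H : (ℕ → ℤ) → ℝ≥0∞, ∫⁻ X, H X ∂ω.walkLaw x
      = ∑' h, ∫⁻ X in cyl k (e h), H X ∂ω.walkLaw x := by
    intro H
    rw [← setLIntegral_univ, ← hcover, lintegral_iUnion hm hdisj]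
  rw [hsplit, hsplit, ← ENNReal.tsum_mul_right]
  refine tsum_congr fun h => ?_
  have hFc : ∀ X ∈ cyl k (e h), F X = F (e h) := fun X hX => hF _ _ hX
  rw [setLIntegral_congr_fun (hm h) (g := fun X => F (e h) * G (shift k X))
      (fun X hX => by simp only [hFc X hX]),
    setLIntegral_congr_fun (hm h) (g := fun _ => F (e h)) hFc,
    lintegral_const_mul (F (e h)) (f := fun X => G (shift k X)) (hG.comp (measurable_shift k)),
    setLIntegral_const]
  by_cases h0 : F (e h) = 0
  · simp [h0]
  · have ha := hFa _ h0
    rw [← lintegral_map (f := G) hG (measurable_shift k), map_shift_restrict_cyl,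
      lintegral_smul_measure, ha, smul_eq_mul, mul_assoc]

lemma stepLaw_singleton (i l : ℤ) : ω.stepLaw i {i + l} = ENNReal.ofReal (ω.prob i l) := by
  have h : ω.stepLaw i {i + l} = ∑ l' ∈ ({-2, -1, 1, 2} : Finset ℤ),
      if l' = l then ENNReal.ofReal (ω.prob i l') else 0 := by
    rw [stepLaw, Measure.finsetSum_apply]
    refine Finset.sum_congr rfl fun l' _ => ?_
    rw [Measure.smul_apply, Measure.dirac_apply' _ (measurableSet_singleton _), smul_eq_mul]
    by_cases hl : l' = l <;> simp [hl]
  rw [h, Finset.sum_ite_eq']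
  split_ifs with hl
  · rfl
  · rw [ω.eq_zero i l hl, ENNReal.ofReal_zero]

lemma walkLaw_step (a b : ℤ) :
    ω.walkLaw a {X | X 1 = b} = ENNReal.ofReal (ω.prob a (b - a)) := by
  have h := ω.walkLaw_cyl_succ a 0 (fun n => if n = 0 then a else b)
  rw [walkLaw_cyl_zero] at h
  simp only [if_true, one_mul] at h
  have hb := ω.stepLaw_singleton a (b - a)
  rw [add_sub_cancel] at hb
  simp only [Nat.zero_add, one_ne_zero, if_false] at h
  rw [← hb, ← h]
  refine measure_congr ?_
  filter_upwards [ω.ae_start a] with X hX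
  refine propext ⟨fun (h1 : X 1 = b) j hj => ?_, fun h1 => ?_⟩
  · interval_cases j
    · simpa using hX
    · simpa using h1
  · have := h1 1 le_rfl
    simp only [one_ne_zero, if_false] at this
    exact this

end Environment

/-! ### Indicators of propositions -/

namespace WalkPath

open Classical in
/-- The indicator of a proposition. -/
def ind (p : Prop) : ℝ≥0∞ := if p then 1 else 0

lemma ind_of {p : Prop} (h : p) : ind p = 1 := if_pos h

lemma ind_of_not {p : Prop} (h : ¬ p) : ind p = 0 := if_neg h

lemma ind_ne_zero {p : Prop} : ind p ≠ 0 ↔ p := by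
  by_cases h : p <;> simp [ind, h]

lemma ind_congr {p q : Prop} (h : p ↔ q) : ind p = ind q := by rw [propext h]

lemma ind_and (p q : Prop) : ind (p ∧ q) = ind p * ind q := by
  by_cases hp : p <;> by_cases hq : q <;> simp [ind, hp, hq]

lemma ind_or {p q : Prop} (h : ¬ (p ∧ q)) : ind (p ∨ q) = ind p + ind q := by
  by_cases hp : p <;> by_cases hq : q <;> simp [ind, hp, hq]
  exact absurd ⟨hp, hq⟩ h

lemma ind_le_one (p : Prop) : ind p ≤ 1 := by
  by_cases hp : p <;> simp [ind, hp]

/-- The basic counting device: an event that can occur at most at one index is split over that index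
without overcounting. -/
lemma tsum_ind {ι : Type*} {p : ι → Prop} (h : ∀ i j, p i → p j → i = j) :
    ∑' i, ind (p i) = ind (∃ i, p i) := by
  by_cases hp : ∃ i, p i
  · obtain ⟨i, hi⟩ := hp
    rw [ind_of ⟨i, hi⟩, tsum_eq_single i fun j hj => ind_of_not fun h' => hj (h j i h' hi),
      ind_of hi]
  · rw [ind_of_not hp, ENNReal.tsum_eq_zero]
    exact fun i => ind_of_not fun h' => hp ⟨i, h'⟩

lemma tsum_ind_add (p : ℕ → Prop) (n : ℕ) :
    ∑' j, ind (p (j + n)) = ∑' k, ind (n ≤ k ∧ p k) := by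
  have h := (add_left_injective n).tsum_eq (f := fun k => ind (n ≤ k ∧ p k)) (by
    intro k hk
    have hk' : n ≤ k ∧ p k := ind_ne_zero.1 hk
    exact ⟨k - n, by simp [Nat.sub_add_cancel hk'.1]⟩)
  rw [← h]
  exact tsum_congr fun j => ind_congr (by simp)

lemma encard_eq_tsum_ind {α : Type*} (S : Set α) : (S.encard : ℝ≥0∞) = ∑' a, ind (a ∈ S) := by
  classical
  rw [← ENNReal.tsum_set_one, tsum_subtype S (fun _ => (1 : ℝ≥0∞))]
  exact tsum_congr fun a => by simp [Set.indicator_apply, ind]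

lemma measurable_ind {A : Set (ℕ → ℤ)} (hA : MeasurableSet A) :
    Measurable fun X => ind (X ∈ A) := by
  classical
  exact Measurable.ite hA measurable_const measurable_const

lemma lintegral_ind {μ : Measure (ℕ → ℤ)} {A : Set (ℕ → ℤ)} (hA : MeasurableSet A) :
    ∫⁻ X, ind (X ∈ A) ∂μ = μ A := by
  rw [← lintegral_indicator_one hA]
  classical
  exact lintegral_congr fun X => by rw [Set.indicator_apply]; simp [ind]

lemma DeterminedBy.ind {k : ℕ} {A : Set (ℕ → ℤ)} (hA : DeterminedBy k fun X => X ∈ A) :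
    DeterminedBy k fun X => ind (X ∈ A) := by
  intro X Y h
  have := hA X Y h
  simp only at this ⊢
  rw [this]

/-! ### Nice paths -/

/-- The steps are in `{-2, -1, 1, 2}`. -/
def ValidSteps (X : ℕ → ℤ) : Prop :=
  ∀ n, X (n + 1) = X n - 2 ∨ X (n + 1) = X n - 1 ∨ X (n + 1) = X n + 1 ∨ X (n + 1) = X n + 2

/-- The path is unbounded above. -/
def UnboundedAbove (X : ℕ → ℤ) : Prop := ∀ N : ℤ, ∃ n, N < X n

lemma UnboundedAbove.exists_ge {X : ℕ → ℤ} (h : UnboundedAbove X) (k : ℕ) (N : ℤ) :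
    ∃ n, k ≤ n ∧ N < X n := by
  obtain ⟨M, hM⟩ : ∃ M : ℤ, ∀ j < k, X j ≤ M := by
    obtain ⟨M, hM⟩ := ((Finset.range k).image X).bddAbove
    exact ⟨M, fun j hj => hM (by simpa using ⟨j, hj, rfl⟩)⟩
  obtain ⟨n, hn⟩ := h (max M N)
  refine ⟨n, ?_, (le_max_right _ _).trans_lt hn⟩
  by_contra hk
  exact absurd (hM n (by omega)) (not_le.2 ((le_max_left _ _).trans_lt hn))

lemma unboundedAbove_shift_iff {X : ℕ → ℤ} (k : ℕ) :
    UnboundedAbove (shift k X) ↔ UnboundedAbove X := by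
  constructor
  · intro h N
    obtain ⟨n, hn⟩ := h N
    exact ⟨n + k, hn⟩
  · intro h N
    obtain ⟨n, hkn, hn⟩ := h.exists_ge k N
    exact ⟨n - k, by simpa [Nat.sub_add_cancel hkn] using hn⟩

/-- A finite initial segment is bounded, so an unbounded path exceeds every level after every time.
The right-hand side is visibly invariant under shifts. -/
lemma limsup_eq_top_iff (X : ℕ → ℤ) :
    limsup (fun n => ((X n : ℝ) : EReal)) atTop = ⊤ ↔ UnboundedAbove X := by
  constructor
  · intro h N
    by_contra! hN
    have : limsup (fun n => ((X n : ℝ) : EReal)) atTop ≤ ((N : ℝ) : EReal) :=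
      limsup_le_of_le (by isBoundedDefault) (Eventually.of_forall fun n => by exact_mod_cast hN n)
    rw [h] at this
    exact EReal.coe_ne_top _ (top_le_iff.1 this)
  · intro h
    refine EReal.eq_top_iff_forall_lt _ |>.2 fun y => ?_
    have hy : (y : EReal) < ((⌈y⌉ + 1 : ℤ) : ℝ) := by
      have := Int.le_ceil y
      have h2 : y < ((⌈y⌉ + 1 : ℤ) : ℝ) := by push_cast; linarith
      exact_mod_cast h2
    refine hy.trans_le (le_limsup_of_frequently_le ?_ (by isBoundedDefault))
    refine frequently_atTop.2 fun k => ?_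
    obtain ⟨n, hkn, hn⟩ := h.exists_ge k (⌈y⌉ + 1)
    exact ⟨n, hkn, by exact_mod_cast hn.le⟩

lemma measurableSet_coord (n : ℕ) (S : Set ℤ) : MeasurableSet {X : ℕ → ℤ | X n ∈ S} :=
  measurable_pi_apply (X := fun _ : ℕ => ℤ) n (MeasurableSet.of_discrete (s := S))

lemma measurableSet_coord_eq (n : ℕ) (b : ℤ) : MeasurableSet {X : ℕ → ℤ | X n = b} :=
  measurableSet_coord n {b}

lemma measurableSet_unboundedAbove : MeasurableSet {X | UnboundedAbove X} := by
  have : {X : ℕ → ℤ | UnboundedAbove X} = ⋂ N : ℤ, ⋃ n, {X | X n ∈ Set.Ioi N} := by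
    ext X; simp [UnboundedAbove]
  rw [this]
  exact MeasurableSet.iInter fun N => MeasurableSet.iUnion fun n => measurableSet_coord n _

end WalkPath

/-! ### The Markov property for events, and the sites that inherit the hypothesis -/

namespace Environment

variable (ω : Environment)

theorem measure_inter_shift (x a : ℤ) (k : ℕ) {A B : Set (ℕ → ℤ)}
    (hA : DeterminedBy k fun X => X ∈ A) (hAa : ∀ X ∈ A, X k = a) (hB : MeasurableSet B) :
    ω.walkLaw x {X | X ∈ A ∧ shift k X ∈ B} = ω.walkLaw x A * ω.walkLaw a B := by
  have hAm := measurableSet_of_determinedBy hA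
  have h := ω.lintegral_mul_shift x a k hA.ind (fun X hX => hAa X (ind_ne_zero.1 hX))
    (measurable_ind hB)
  rw [lintegral_ind hAm, lintegral_ind hB] at h
  have hm : MeasurableSet {X | X ∈ A ∧ shift k X ∈ B} := hAm.inter (measurable_shift k hB)
  rw [← h, ← lintegral_ind hm]
  exact lintegral_congr fun X => ind_and _ _

lemma measure_first_step (a b : ℤ) {B : Set (ℕ → ℤ)} (hB : MeasurableSet B) :
    ω.walkLaw a {X | X 1 = b ∧ shift 1 X ∈ B}
      = ENNReal.ofReal (ω.prob a (b - a)) * ω.walkLaw b B := by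
  rw [← walkLaw_step]
  refine ω.measure_inter_shift a b 1 (A := {X | X 1 = b}) (fun X Y h => ?_) (fun X hX => hX) hB
  simp [h 1 le_rfl]

lemma ae_validSteps (x : ℤ) : ∀ᵐ X ∂ω.walkLaw x, ValidSteps X := by
  have h : ∀ n : ℕ, ∀ a b : ℤ, ∀ᵐ X ∂ω.walkLaw x, X n = a → X (n + 1) = b →
      b - a ∈ ({-2, -1, 1, 2} : Finset ℤ) := by
    intro n a b
    by_cases hab : b - a ∈ ({-2, -1, 1, 2} : Finset ℤ)
    · exact Eventually.of_forall fun X _ _ => hab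
    · have hz : ω.walkLaw x {X | X ∈ {X : ℕ → ℤ | X n = a} ∧ shift n X ∈ {X | X 1 = b}} = 0 := by
        rw [ω.measure_inter_shift x a n (A := {X | X n = a}) (fun X Y h => by simp [h n le_rfl])
          (fun X hX => hX) (measurableSet_coord_eq 1 b), walkLaw_step, ω.eq_zero _ _ hab]
        simp
      filter_upwards [measure_eq_zero_iff_ae_notMem.1 hz] with X hX h1 h2
      exact absurd ⟨h1, by simpa [add_comm] using h2⟩ hX
  simp only [← ae_all_iff] at h
  filter_upwards [h] with X hX n
  have := hX n _ _ rfl rfl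
  simp only [Finset.mem_insert, Finset.mem_singleton] at this
  omega

lemma limsupEqTop_iff (x : ℤ) : ω.LimsupEqTop x ↔ ∀ᵐ X ∂ω.walkLaw x, UnboundedAbove X := by
  simp only [LimsupEqTop, limsup_eq_top_iff]

variable {ω}

/-- Unboundedness is shift invariant, so by the Markov property a failure from `b` would be a
failure from `x`. Irreducibility is not assumed, and this is how the hypothesis reaches sites other
than the starting point. -/
lemma LimsupEqTop.of_reach {x b : ℤ} (h : ω.LimsupEqTop x) {k : ℕ}
    (hk : ω.walkLaw x {X | X k = b} ≠ 0) : ω.LimsupEqTop b := by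
  rw [limsupEqTop_iff] at h ⊢
  have h1 := ω.measure_inter_shift x b k (A := {X | X k = b}) (fun X Y h => by simp [h k le_rfl])
    (fun X hX => hX) measurableSet_unboundedAbove.compl
  have h2 : ω.walkLaw x {X | X ∈ {X : ℕ → ℤ | X k = b} ∧
      shift k X ∈ {X | UnboundedAbove X}ᶜ} = 0 := by
    refine measure_eq_zero_iff_ae_notMem.2 ?_
    filter_upwards [h] with X hX hX'
    exact hX'.2 ((unboundedAbove_shift_iff k).2 hX)
  rw [h2] at h1
  rcases mul_eq_zero.1 h1.symm with h3 | h3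
  · exact absurd h3 hk
  · exact h3

lemma LimsupEqTop.of_step {x b : ℤ} (h : ω.LimsupEqTop x) (hb : ω.prob x (b - x) ≠ 0) :
    ω.LimsupEqTop b := by
  refine h.of_reach (k := 1) ?_
  rw [walkLaw_step]
  simpa using lt_of_le_of_ne (ω.nonneg _ _) hb.symm

end Environment

/-! ### Exits from half-lines -/

namespace WalkPath

/-- The path stays in `(-∞, L]` up to time `k`. -/
def Below (L : ℤ) (k : ℕ) (X : ℕ → ℤ) : Prop := ∀ j ≤ k, X j ≤ L

/-- The first exit from `(-∞, L]` is by a step from `p` to `q`. -/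
def exitVia (L p q : ℤ) : Set (ℕ → ℤ) := {X | ∃ r, Below L r X ∧ X r = p ∧ X (r + 1) = q}

lemma Below.mono {L : ℤ} {j k : ℕ} {X : ℕ → ℤ} (h : Below L k X) (hj : j ≤ k) : Below L j X :=
  fun i hi => h i (hi.trans hj)

lemma Below.congr {L : ℤ} {k : ℕ} {X Y : ℕ → ℤ} (h : ∀ j ≤ k, X j = Y j) :
    Below L k X ↔ Below L k Y :=
  forall₂_congr fun j hj => by rw [h j hj]

lemma Below.exit_unique {L : ℤ} {r s : ℕ} {X : ℕ → ℤ} (hr : Below L r X) (hs : Below L s X)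
    (hr' : L < X (r + 1)) (hs' : L < X (s + 1)) : r = s := by
  rcases lt_trichotomy r s with h | h | h
  · exact absurd (hs (r + 1) h) (not_le.2 hr')
  · exact h
  · exact absurd (hr (s + 1) h) (not_le.2 hs')

lemma exitVia_unique {L p q p' q' : ℤ} (hq : L < q) (hq' : L < q') {X : ℕ → ℤ}
    (h : X ∈ exitVia L p q) (h' : X ∈ exitVia L p' q') : p = p' ∧ q = q' := by
  obtain ⟨r, h1, h2, h3⟩ := h
  obtain ⟨s, h4, h5, h6⟩ := h'
  obtain rfl := h1.exit_unique h4 (h3 ▸ hq) (h6 ▸ hq')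
  exact ⟨h2.symm.trans h5, h3.symm.trans h6⟩

lemma below_shift {L : ℤ} {j k : ℕ} {X : ℕ → ℤ} (h : Below L k X) :
    Below L j (shift k X) ↔ Below L (j + k) X := by
  constructor
  · intro h' i hi
    rcases Nat.lt_or_ge i k with hik | hik
    · exact h i hik.le
    · have := h' (i - k) (by omega)
      rwa [shift_apply, Nat.sub_add_cancel hik] at this
  · intro h' i hi
    exact h' (i + k) (by omega)

/-- Dropping an initial piece inside `(-∞, L]` does not change the exit step. This makes the
indicator of an exit an admissible weight in `lintegral_excursionsBelow_mul`. -/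
lemma exitVia_shift_iff {L p q : ℤ} (hq : L < q) {k : ℕ} {X : ℕ → ℤ} (h : Below L k X) :
    shift k X ∈ exitVia L p q ↔ X ∈ exitVia L p q := by
  constructor
  · rintro ⟨r, h1, h2, h3⟩
    refine ⟨r + k, (below_shift h).1 h1, h2, ?_⟩
    rw [← h3, shift_apply]
    congr 1
    omega
  · rintro ⟨r, h1, h2, h3⟩
    have hk : k ≤ r := by
      by_contra hk
      exact absurd (h (r + 1) (by omega)) (not_le.2 (h3 ▸ hq))
    refine ⟨r - k, (below_shift h).2 (by rwa [Nat.sub_add_cancel hk]), ?_, ?_⟩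
    · rwa [shift_apply, Nat.sub_add_cancel hk]
    · rwa [shift_apply, show r - k + 1 + k = r + 1 by omega]

lemma measurableSet_below (L : ℤ) (k : ℕ) : MeasurableSet {X | Below L k X} :=
  measurableSet_of_determinedBy (k := k) fun _ _ h => propext (Below.congr h)

lemma measurableSet_exitVia (L p q : ℤ) : MeasurableSet (exitVia L p q) := by
  have : exitVia L p q = ⋃ r, {X | Below L r X ∧ X r = p ∧ X (r + 1) = q} := by
    ext X; simp [exitVia]
  rw [this]
  exact MeasurableSet.iUnion fun r => (measurableSet_below L r).inter
    ((measurableSet_coord_eq r p).inter (measurableSet_coord_eq (r + 1) q))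

lemma startShift_nonneg (m : Fin 9) : 0 ≤ startShift m := by revert m; decide

lemma landShift_le (m : Fin 9) : landShift m ≤ -1 := by revert m; decide

lemma endShift_nonneg (m : Fin 9) : 0 ≤ endShift m := by revert m; decide

/-- Separates the first step of the excursion from the exit out of `(-∞, i - 1]` that completes it;
probabilities of excursions thereby become exit probabilities. -/
lemma mem_particleEvent {i : ℤ} {m : Fin 9} {X : ℕ → ℤ} :
    X ∈ particleEvent i m ↔ X 0 = i + startShift m ∧ X 1 = i + landShift m ∧
      shift 1 X ∈ exitVia (i - 1) (i + preShift m) (i + endShift m) := by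
  constructor
  · rintro ⟨r, h0, h1, h2, h3, h4, h5⟩
    refine ⟨h1, h2, r - 1, fun j hj => h3 (j + 1) (by omega) (by omega), ?_, ?_⟩
    · rwa [shift_apply, Nat.sub_add_cancel h0]
    · rwa [shift_apply, show r - 1 + 1 + 1 = r + 1 by omega]
  · rintro ⟨h1, h2, r, h3, h4, h5⟩
    refine ⟨r + 1, by omega, h1, h2, fun j hj hjr => ?_, h4, h5⟩
    have := h3 (j - 1) (by omega)
    rwa [shift_apply, Nat.sub_add_cancel (by omega)] at this

lemma measurableSet_particleEvent (i : ℤ) (m : Fin 9) : MeasurableSet (particleEvent i m) := by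
  have : particleEvent i m = {X | X 0 = i + startShift m} ∩ ({X | X 1 = i + landShift m} ∩
      shift 1 ⁻¹' exitVia (i - 1) (i + preShift m) (i + endShift m)) := by
    ext X; exact mem_particleEvent
  rw [this]
  exact (measurableSet_coord_eq _ _).inter ((measurableSet_coord_eq _ _).inter
    (measurable_shift 1 (measurableSet_exitVia _ _ _)))

/-- The number of type-`m` excursions at `i` that start before the exit from `(-∞, L]`. -/
def excursionsBelow (L i : ℤ) (m : Fin 9) (X : ℕ → ℤ) : ℝ≥0∞ :=
  ∑' k, ind (Below L k X ∧ shift k X ∈ particleEvent i m)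

lemma measurable_excursionsBelow (L i : ℤ) (m : Fin 9) : Measurable (excursionsBelow L i m) :=
  Measurable.tsum fun k => measurable_ind (A := {X | Below L k X ∧
    shift k X ∈ particleEvent i m}) ((measurableSet_below L k).inter
      (measurable_shift k (measurableSet_particleEvent i m)))

/-- A path that starts in `[i, ∞)` and is in `(-∞, i)` at time `r` has a last visit to `[i, ∞)`
before `r`. -/
lemma exists_last_ge {X : ℕ → ℤ} {i : ℤ} {r : ℕ} (h0 : i ≤ X 0) (hr : X r ≤ i - 1) :
    ∃ k < r, i ≤ X k ∧ ∀ j, k < j → j ≤ r → X j ≤ i - 1 := by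
  induction r with
  | zero => omega
  | succ r ih =>
    rcases le_or_gt i (X r) with h | h
    · refine ⟨r, by omega, h, fun j hj hjr => ?_⟩
      obtain rfl : j = r + 1 := by omega
      exact hr
    · obtain ⟨k, hk, h1, h2⟩ := ih (by omega)
      refine ⟨k, by omega, h1, fun j hj hjr => ?_⟩
      rcases Nat.lt_or_ge r j with h3 | h3
      · obtain rfl : j = r + 1 := by omega
        exact hr
      · exact h2 j hj h3

/-- An unbounded path in `(-∞, L]` at time `0` exits from `(-∞, L]`. -/
lemma exists_exit {X : ℕ → ℤ} (hX : UnboundedAbove X) {L : ℤ} (h0 : X 0 ≤ L) :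
    ∃ r, Below L r X ∧ L < X (r + 1) := by
  classical
  have h := hX L
  have hs := Nat.find_spec h
  have hpos : Nat.find h ≠ 0 := by
    intro h'
    rw [h'] at hs
    omega
  refine ⟨Nat.find h - 1, fun j hj => ?_, ?_⟩
  · exact not_lt.1 (Nat.find_min h (by omega))
  · rwa [Nat.sub_add_cancel (by omega)]

lemma mem_exitVia_cases {X : ℕ → ℤ} (hv : ValidSteps X) (hu : UnboundedAbove X) {L : ℤ}
    (h0 : X 0 ≤ L) :
    X ∈ exitVia L L (L + 1) ∨ X ∈ exitVia L (L - 1) (L + 1) ∨ X ∈ exitVia L L (L + 2) := by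
  obtain ⟨r, h1, h2⟩ := exists_exit hu h0
  have h3 := h1 r le_rfl
  have h4 := hv r
  have h5 : (X r = L ∧ X (r + 1) = L + 1) ∨ (X r = L - 1 ∧ X (r + 1) = L + 1) ∨
      (X r = L ∧ X (r + 1) = L + 2) := by omega
  rcases h5 with h5 | h5 | h5
  · exact Or.inl ⟨r, h1, h5⟩
  · exact Or.inr (Or.inl ⟨r, h1, h5⟩)
  · exact Or.inr (Or.inr ⟨r, h1, h5⟩)

/-- The first entrance into `[L, ∞)` is at `L`. -/
def hitting (L : ℤ) : Set (ℕ → ℤ) := {X | ∃ n, X n = L ∧ ∀ m < n, X m ≤ L - 1}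

lemma mem_hitting_iff {X : ℕ → ℤ} (hv : ValidSteps X) {L : ℤ} (h0 : X 0 ≤ L - 1) :
    X ∈ hitting L ↔ X ∈ exitVia (L - 1) (L - 1) L ∨ X ∈ exitVia (L - 1) (L - 2) L := by
  constructor
  · rintro ⟨n, hn, hm⟩
    obtain ⟨r, rfl⟩ : ∃ r, n = r + 1 := Nat.exists_eq_succ_of_ne_zero (by rintro rfl; omega)
    have h1 : Below (L - 1) r X := fun j hj => hm j (by omega)
    have h2 := hv r
    have h3 := h1 r le_rfl
    have h4 : X r = L - 1 ∨ X r = L - 2 := by omega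
    rcases h4 with h4 | h4
    · exact Or.inl ⟨r, h1, h4, hn⟩
    · exact Or.inr ⟨r, h1, h4, hn⟩
  · rintro (⟨r, h1, h2, h3⟩ | ⟨r, h1, h2, h3⟩) <;>
      exact ⟨r + 1, h3, fun j hj => h1 j (by omega)⟩

lemma measurableSet_hitting (L : ℤ) : MeasurableSet (hitting L) := by
  have : hitting L = ⋃ n, {X | X n = L ∧ ∀ m < n, X m ≤ L - 1} := by
    ext X; simp [hitting]
  rw [this]
  refine MeasurableSet.iUnion fun n => measurableSet_of_determinedBy (k := n) fun X Y h => ?_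
  refine propext (and_congr (by rw [h n le_rfl]) (forall₂_congr fun j hj => ?_))
  rw [h j hj.le]

end WalkPath

/-! ### Exit probabilities and mean numbers of visits -/

namespace Environment

variable (ω : Environment)

/-- The probability, from `y`, that the first exit from `(-∞, L]` is from `p` to `q`. -/
def exitProb (L y p q : ℤ) : ℝ≥0∞ := ω.walkLaw y (exitVia L p q)

/-- The mean number of visits to `p` before the exit from `(-∞, L]`. -/
def green (L y p : ℤ) : ℝ≥0∞ := ∑' k, ω.walkLaw y {X | Below L k X ∧ X k = p}

/-- The probability, from `y`, to enter `[L, ∞)` at `L`. -/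
def hitProb (L y : ℤ) : ℝ≥0∞ := ω.walkLaw y (hitting L)

lemma determinedBy_below_and (L p : ℤ) (k : ℕ) :
    DeterminedBy k fun X => X ∈ {X : ℕ → ℤ | Below L k X ∧ X k = p} := fun X Y h =>
  propext (and_congr (Below.congr h) (by rw [h k le_rfl]))

lemma determinedBy_exit (L p q : ℤ) (r : ℕ) :
    DeterminedBy (r + 1) fun X => X ∈ {X : ℕ → ℤ | Below L r X ∧ X r = p ∧ X (r + 1) = q} :=
  fun X Y h => propext (and_congr (Below.congr fun j hj => h j (by omega))
    (by rw [h r (by omega), h (r + 1) le_rfl]))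

lemma measurableSet_below_and (L p : ℤ) (k : ℕ) :
    MeasurableSet {X : ℕ → ℤ | Below L k X ∧ X k = p} :=
  measurableSet_of_determinedBy (determinedBy_below_and L p k)

lemma measurableSet_exit (L p q : ℤ) (r : ℕ) :
    MeasurableSet {X : ℕ → ℤ | Below L r X ∧ X r = p ∧ X (r + 1) = q} :=
  measurableSet_of_determinedBy (determinedBy_exit L p q r)

lemma ind_mem_exitVia {L p q : ℤ} (hq : L < q) (X : ℕ → ℤ) :
    ind (X ∈ exitVia L p q) = ∑' r, ind (Below L r X ∧ X r = p ∧ X (r + 1) = q) :=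
  (tsum_ind fun _ _ h h' => h.1.exit_unique h'.1 (h.2.2 ▸ hq) (h'.2.2 ▸ hq)).symm

lemma lintegral_tsum_ind {ι : Type*} [Countable ι] {μ : Measure (ℕ → ℤ)}
    {p : ι → (ℕ → ℤ) → Prop} (hp : ∀ k, MeasurableSet {X | p k X}) :
    ∫⁻ X, ∑' k, ind (p k X) ∂μ = ∑' k, μ {X | p k X} := by
  have h := lintegral_tsum (μ := μ) (f := fun k X => ind (p k X))
    fun k => (measurable_ind (hp k)).aemeasurable
  rw [h]
  exact tsum_congr fun k => lintegral_ind (hp k)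

/-- The Markov property summed over the deterministic times `τ k`. The events need not be disjoint,
so this covers mean numbers of visits as well as stopping times. -/
lemma lintegral_tsum_ind_mul_shift {ι : Type*} [Countable ι] {p : ι → (ℕ → ℤ) → Prop} {τ : ι → ℕ}
    (x a : ℤ) (hp : ∀ k, DeterminedBy (τ k) fun X => X ∈ {X | p k X})
    (ha : ∀ k X, p k X → X (τ k) = a) {G : (ℕ → ℤ) → ℝ≥0∞} (hG : Measurable G) :
    ∫⁻ X, ∑' k, ind (p k X) * G (shift (τ k) X) ∂ω.walkLaw x
      = (∑' k, ω.walkLaw x {X | p k X}) * ∫⁻ X, G X ∂ω.walkLaw a := by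
  have h := lintegral_tsum (μ := ω.walkLaw x) (f := fun k X => ind (p k X) * G (shift (τ k) X))
    fun k => ((measurable_ind (measurableSet_of_determinedBy (hp k))).mul
      (hG.comp (measurable_shift (τ k)))).aemeasurable
  rw [h, ← ENNReal.tsum_mul_right]
  refine tsum_congr fun k => ?_
  have h := ω.lintegral_mul_shift x a (τ k) (hp k).ind (fun X hX => ha k X (ind_ne_zero.1 hX)) hG
  rw [lintegral_ind (measurableSet_of_determinedBy (hp k))] at h
  exact h

lemma exitProb_eq_tsum {L p q : ℤ} (hq : L < q) (y : ℤ) : ω.exitProb L y p q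
    = ∑' r, ω.walkLaw y {X | Below L r X ∧ X r = p ∧ X (r + 1) = q} := by
  rw [exitProb, ← lintegral_ind (measurableSet_exitVia L p q)]
  simp_rw [ind_mem_exitVia hq]
  exact lintegral_tsum_ind fun r => measurableSet_exit L p q r

/-- Split by the time of the visit to `p` that the exit step follows. Since `q` lies above `L`, at
most one visit is followed by this step. -/
lemma exitProb_eq_green {L p q : ℤ} (hq : L < q) (y : ℤ) :
    ω.exitProb L y p q = ω.green L y p * ENNReal.ofReal (ω.prob p (q - p)) := by
  rw [exitProb_eq_tsum ω hq, green, ← ENNReal.tsum_mul_right]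
  refine tsum_congr fun r => ?_
  rw [← walkLaw_step, ← ω.measure_inter_shift y p r (determinedBy_below_and L p r)
    (fun X hX => hX.2) (measurableSet_coord_eq 1 q)]
  congr 1
  ext X
  simp [and_assoc, add_comm]

/-- The Markov property at the exit from `(-∞, L]`. -/
lemma lintegral_exit_mul_shift {L p q : ℤ} (hq : L < q) (y : ℤ) {G : (ℕ → ℤ) → ℝ≥0∞}
    (hG : Measurable G) :
    ∫⁻ X, ∑' r, ind (Below L r X ∧ X r = p ∧ X (r + 1) = q) * G (shift (r + 1) X) ∂ω.walkLaw y
      = ω.exitProb L y p q * ∫⁻ X, G X ∂ω.walkLaw q := by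
  rw [exitProb_eq_tsum ω hq]
  exact ω.lintegral_tsum_ind_mul_shift (τ := fun r => r + 1)
    (p := fun r X => Below L r X ∧ X r = p ∧ X (r + 1) = q) y q (determinedBy_exit L p q)
    (fun r X h => h.2.2) hG

/-- The mean of the number of excursions, weighted by a functional that does not change when a
piece of the path inside `(-∞, L]` is removed. -/
lemma lintegral_excursionsBelow_mul (L i y : ℤ) (m : Fin 9) {H : (ℕ → ℤ) → ℝ≥0∞}
    (hH : Measurable H) (hinv : ∀ k X, Below L k X → H (shift k X) = H X) :
    ∫⁻ X, excursionsBelow L i m X * H X ∂ω.walkLaw y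
      = ω.green L y (i + startShift m) *
        ∫⁻ X, ind (X ∈ particleEvent i m) * H X ∂ω.walkLaw (i + startShift m) := by
  have hG : Measurable fun X => ind (X ∈ particleEvent i m) * H X :=
    (measurable_ind (measurableSet_particleEvent i m)).mul hH
  have h1 : ∀ X, excursionsBelow L i m X * H X = ∑' k,
      ind (Below L k X ∧ X k = i + startShift m) *
        (ind (shift k X ∈ particleEvent i m) * H (shift k X)) := by
    intro X
    rw [excursionsBelow, ← ENNReal.tsum_mul_right]
    refine tsum_congr fun k => ?_
    by_cases hb : Below L k X
    · rw [hinv k X hb, ← mul_assoc, ← ind_and]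
      congr 1
      refine ind_congr ⟨fun h => ⟨⟨hb, ?_⟩, h.2⟩, fun h => ⟨hb, h.2⟩⟩
      have := (mem_particleEvent.1 h.2).1
      simpa using this
    · rw [ind_of_not fun h => hb h.1, ind_of_not fun h => hb h.1, zero_mul, zero_mul]
  simp_rw [h1]
  exact ω.lintegral_tsum_ind_mul_shift (τ := fun k => k)
    (p := fun k X => Below L k X ∧ X k = i + startShift m) y _
    (determinedBy_below_and L (i + startShift m)) (fun k X h => h.2) hG

lemma lintegral_excursionsBelow (L i y : ℤ) (m : Fin 9) :
    ∫⁻ X, excursionsBelow L i m X ∂ω.walkLaw y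
      = ω.green L y (i + startShift m) * ω.walkLaw (i + startShift m) (particleEvent i m) := by
  have h := ω.lintegral_excursionsBelow_mul L i y m (H := fun _ => 1) measurable_const
    fun _ _ _ => rfl
  simp only [mul_one] at h
  rw [h, lintegral_ind (measurableSet_particleEvent i m)]

lemma measure_particleEvent_inter (i : ℤ) (m : Fin 9) {B : Set (ℕ → ℤ)} (hB : MeasurableSet B) :
    ω.walkLaw (i + startShift m) {X | X ∈ particleEvent i m ∧ shift 1 X ∈ B}
      = ENNReal.ofReal (ω.prob (i + startShift m) (landShift m - startShift m)) *
        ω.walkLaw (i + landShift m)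
          {X | X ∈ exitVia (i - 1) (i + preShift m) (i + endShift m) ∧ X ∈ B} := by
  have hm : MeasurableSet {X | X ∈ exitVia (i - 1) (i + preShift m) (i + endShift m) ∧ X ∈ B} :=
    (measurableSet_exitVia _ _ _).inter hB
  rw [show landShift m - startShift m = i + landShift m - (i + startShift m) by ring,
    ← ω.measure_first_step _ _ hm]
  refine measure_congr ?_
  filter_upwards [ω.ae_start (i + startShift m)] with X hX
  refine propext ⟨fun h => ?_, fun h => ?_⟩
  · have h' := mem_particleEvent.1 h.1
    exact ⟨h'.2.1, h'.2.2, h.2⟩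
  · exact ⟨mem_particleEvent.2 ⟨hX, h.1, h.2.1⟩, h.2.2⟩

lemma measure_particleEvent (i : ℤ) (m : Fin 9) :
    ω.walkLaw (i + startShift m) (particleEvent i m)
      = ENNReal.ofReal (ω.prob (i + startShift m) (landShift m - startShift m)) *
        ω.exitProb (i - 1) (i + landShift m) (i + preShift m) (i + endShift m) := by
  have h := ω.measure_particleEvent_inter i m MeasurableSet.univ
  simpa [exitProb] using h

variable {ω}

lemma LimsupEqTop.ae_unbounded {x : ℤ} (h : ω.LimsupEqTop x) :
    ∀ᵐ X ∂ω.walkLaw x, UnboundedAbove X := (ω.limsupEqTop_iff x).1 h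

/-- The exit from `(-∞, L]` is almost surely by one of the three possible steps. -/
lemma LimsupEqTop.exitProb_add {L y : ℤ} (h : ω.LimsupEqTop y) (hy : y ≤ L) :
    ω.exitProb L y L (L + 1) + ω.exitProb L y (L - 1) (L + 1) + ω.exitProb L y L (L + 2) = 1 := by
  have hm := measurableSet_exitVia
  simp only [exitProb]
  rw [← lintegral_ind (hm _ _ _), ← lintegral_ind (hm _ _ _), ← lintegral_ind (hm _ _ _),
    ← lintegral_add_left (measurable_ind (hm _ _ _)), ← lintegral_add_left
    (f := fun X => ind (X ∈ exitVia L L (L + 1)) + ind (X ∈ exitVia L (L - 1) (L + 1)))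
    ((measurable_ind (hm _ _ _)).add (measurable_ind (hm _ _ _))),
    lintegral_congr_ae (g := fun _ => 1), lintegral_one, measure_univ]
  filter_upwards [h.ae_unbounded, ω.ae_validSteps y, ω.ae_start y] with X hu hv h0
  have h1 := mem_exitVia_cases hv hu (L := L) (by omega)
  rw [← ind_or fun h' => ?_, ← ind_or fun h' => ?_, ind_of (by tauto)]
  · rcases h' with ⟨h2 | h2, h3⟩
    · have := exitVia_unique (by omega) (by omega) h2 h3; omega
    · have := exitVia_unique (by omega) (by omega) h2 h3; omega
  · have := exitVia_unique (by omega) (by omega) h'.1 h'.2; omega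

variable (ω)

lemma hitProb_eq {L y : ℤ} (hy : y ≤ L - 1) :
    ω.hitProb L y = ω.exitProb (L - 1) y (L - 1) L + ω.exitProb (L - 1) y (L - 2) L := by
  have hm := measurableSet_exitVia
  simp only [exitProb, hitProb]
  rw [← lintegral_ind (hm _ _ _), ← lintegral_ind (hm _ _ _),
    ← lintegral_ind (measurableSet_hitting L), ← lintegral_add_left (measurable_ind (hm _ _ _))]
  refine lintegral_congr_ae ?_
  filter_upwards [ω.ae_validSteps y, ω.ae_start y] with X hv h0
  rw [ind_congr (mem_hitting_iff hv (by omega)), ind_or fun h => ?_]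
  have := exitVia_unique (by omega) (by omega) h.1 h.2
  omega

lemma f_eq_hitProb {i j y : ℤ} (hj : j = i + 1) : ω.f y i j = (ω.hitProb j y).toReal := by
  subst hj
  simp only [f, hitProb, hitting, Measure.real, add_sub_cancel_right]

/-- A path that is at `L` without having left `(-∞, L]` must have entered `[L, ∞)` at `L`; the
Markov property applies at this entrance. Both sides may be infinite. -/
lemma green_eq_hitProb_mul (L y : ℤ) :
    ω.green L y L = ω.hitProb L y * ω.green L L L := by
  let V : (ℕ → ℤ) → ℝ≥0∞ := fun X => ∑' k, ind (Below L k X ∧ X k = L)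
  have hV : ∀ x, ω.green L x L = ∫⁻ X, V X ∂ω.walkLaw x := by
    intro x
    exact (lintegral_tsum_ind fun k => measurableSet_below_and L L k).symm
  have hVm : Measurable V := Measurable.tsum fun k =>
    measurable_ind (measurableSet_below_and L L k)
  have hV2 : ∀ X : ℕ → ℤ, V X = ∑' n, ind (X n = L ∧ ∀ m < n, X m ≤ L - 1) * V (shift n X) := by
    intro X
    simp_rw [V, ← ENNReal.tsum_mul_left, ← ind_and]
    have h1 : ∀ n, ∑' j, ind ((X n = L ∧ ∀ m < n, X m ≤ L - 1) ∧
        Below L j (shift n X) ∧ shift n X j = L)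
        = ∑' k, ind (n ≤ k ∧ (X n = L ∧ ∀ m < n, X m ≤ L - 1) ∧ Below L k X ∧ X k = L) := by
      intro n
      rw [← tsum_ind_add (fun k => (X n = L ∧ ∀ m < n, X m ≤ L - 1) ∧ Below L k X ∧ X k = L)]
      refine tsum_congr fun j => ind_congr (and_congr_right fun h => ?_)
      have hb : Below L n X := fun i hi => by
        rcases Nat.lt_or_ge i n with h' | h'
        · have := h.2 i h'; omega
        · obtain rfl : i = n := by omega
          exact h.1.le
      rw [below_shift hb, shift_apply]
    simp_rw [h1]
    rw [ENNReal.tsum_comm]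
    refine tsum_congr fun k => ?_
    rw [tsum_ind]
    · refine ind_congr ⟨fun h => ?_, fun ⟨n, h⟩ => h.2.2⟩
      classical
      -- The first visit to `L` is the entrance: earlier positions are at most `L` and different
      -- from `L`.
      have hex : ∃ n, X n = L := ⟨k, h.2⟩
      refine ⟨Nat.find hex, Nat.find_min' hex h.2, ⟨Nat.find_spec hex, fun m hm => ?_⟩, h⟩
      have h2 := h.1 m (hm.le.trans (Nat.find_min' hex h.2))
      have h3 := Nat.find_min hex hm
      omega
    · intro n n' h h'
      rcases lt_trichotomy n n' with h4 | h4 | h4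
      · have := h'.2.1.2 n h4; have := h.2.1.1; omega
      · exact h4
      · have := h.2.1.2 n' h4; have := h'.2.1.1; omega
  have hdet : ∀ n, DeterminedBy n fun X : ℕ → ℤ =>
      X ∈ {X : ℕ → ℤ | X n = L ∧ ∀ m < n, X m ≤ L - 1} := fun n X Y h =>
    propext (and_congr (by rw [h n le_rfl]) (forall₂_congr fun j hj => by rw [h j hj.le]))
  have hms := fun n => measurableSet_of_determinedBy (hdet n)
  have hhit : ω.hitProb L y
      = ∑' n, ω.walkLaw y {X : ℕ → ℤ | X n = L ∧ ∀ m < n, X m ≤ L - 1} := by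
    rw [hitProb, ← lintegral_ind (measurableSet_hitting L)]
    have : ∀ X : ℕ → ℤ, ind (X ∈ hitting L)
        = ∑' n, ind (X n = L ∧ ∀ m < n, X m ≤ L - 1) := by
      intro X
      rw [tsum_ind]
      · rfl
      · intro n n' h h'
        rcases lt_trichotomy n n' with h4 | h4 | h4
        · have := h'.2 n h4; have := h.1; omega
        · exact h4
        · have := h.2 n' h4; have := h'.1; omega
    simp_rw [this]
    exact lintegral_tsum_ind hms
  rw [hV y, lintegral_congr hV2, hhit, hV L]
  exact ω.lintegral_tsum_ind_mul_shift (τ := fun n => n)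
    (p := fun n X => X n = L ∧ ∀ m < n, X m ≤ L - 1) y L hdet (fun n X h => h.1) hVm

end Environment

/-! ### The parameters of the walk as exit probabilities -/

namespace WalkPath

/-- From the starting point `L`, the exit from `(-∞, L]` by a step from `L - 1` to `L + 1` happens
in the only excursion at `L` of type `A₃` or `B₃`. -/
lemma ind_exitVia_two {X : ℕ → ℤ} (hv : ValidSteps X) {L : ℤ} (h0 : X 0 = L) :
    ind (X ∈ exitVia L (L - 1) (L + 1)) = excursionsBelow L L 2 X + excursionsBelow L L 5 X := by
  simp only [excursionsBelow]
  rw [← ENNReal.tsum_add]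
  have h1 : ∀ k, ind (Below L k X ∧ shift k X ∈ particleEvent L 2)
      + ind (Below L k X ∧ shift k X ∈ particleEvent L 5)
      = ind (Below L k X ∧ (shift k X ∈ particleEvent L 2 ∨ shift k X ∈ particleEvent L 5)) := by
    intro k
    rw [← ind_or]
    · exact ind_congr (by tauto)
    · rintro ⟨h, h'⟩
      have h1 := (mem_particleEvent.1 h.2).2.1
      have h2 := (mem_particleEvent.1 h'.2).2.1
      rw [h1] at h2
      simp [landShift] at h2
  have h3 : ∀ k, (Below L k X ∧ (shift k X ∈ particleEvent L 2 ∨ shift k X ∈ particleEvent L 5)) →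
      X k = L ∧ ∃ r, k < r ∧ (∀ j, k < j → j ≤ r → X j ≤ L - 1) ∧ Below L r X ∧
        X r = L - 1 ∧ X (r + 1) = L + 1 := by
    rintro k ⟨hb, h⟩
    have h' : ∃ r, IsExcursion (shift k X) L 2 0 r ∨ IsExcursion (shift k X) L 5 0 r := by
      rcases h with ⟨r, h⟩ | ⟨r, h⟩
      exacts [⟨r, Or.inl h⟩, ⟨r, Or.inr h⟩]
    obtain ⟨r, h⟩ := h'
    have h4 : 0 < r ∧ X k = L ∧ (∀ j, 0 < j → j ≤ r → X (j + k) ≤ L - 1) ∧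
        X (r + k) = L - 1 ∧ X (r + 1 + k) = L + 1 := by
      rcases h with ⟨h1, h2, -, h4, h5, h6⟩ | ⟨h1, h2, -, h4, h5, h6⟩ <;>
      · simp only [shift_apply, Nat.zero_add] at h2 h4 h5 h6
        simp [startShift, preShift, endShift] at h2 h5 h6
        exact ⟨h1, h2, h4, h5, h6⟩
    obtain ⟨h5, h6, h7, h8, h9⟩ := h4
    have h10 : ∀ j, k < j → j ≤ r + k → X j ≤ L - 1 := fun j hj hjr => by
      have := h7 (j - k) (by omega) (by omega)
      rwa [Nat.sub_add_cancel hj.le] at this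
    refine ⟨h6, r + k, by omega, h10, fun j hj => ?_, h8, by rw [← h9]; congr 1; omega⟩
    rcases Nat.lt_or_ge k j with hkj | hkj
    · have := h10 j hkj hj; omega
    · exact hb j hkj
  simp_rw [h1]
  rw [tsum_ind]
  · refine ind_congr ⟨?_, ?_⟩
    · rintro ⟨r, hb, hr, hr'⟩
      -- The last position in `[L, ∞)` before the exit can only be `L`, and the excursion that
      -- starts there ends with the exit step.
      obtain ⟨k, hk, hk1, hk2⟩ := exists_last_ge h0.ge hr.le
      have hkL : X k = L := le_antisymm (hb k hk.le) hk1
      have h4 := hk2 (k + 1) (by omega) hk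
      have h5 := hv k
      have h6 : X (k + 1) = L - 1 ∨ X (k + 1) = L - 2 := by omega
      have h7 : ∀ j, 0 < j → j ≤ r - k → shift k X j ≤ L - 1 := fun j hj hjr =>
        hk2 (j + k) (by omega) (by omega)
      have h8 : shift k X (r - k) = L + -1 := by rw [shift_apply, Nat.sub_add_cancel hk.le, hr]; rfl
      have h9 : shift k X (r - k + 1) = L + 1 := by
        rw [shift_apply, show r - k + 1 + k = r + 1 by omega, hr']
      refine ⟨k, hb.mono hk.le, ?_⟩
      rcases h6 with h6 | h6
      · refine Or.inl ⟨r - k, by omega, ?_, ?_, h7, h8, h9⟩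
        · simpa [startShift] using hkL
        · simpa [landShift, add_comm, ← sub_eq_add_neg] using h6
      · refine Or.inr ⟨r - k, by omega, ?_, ?_, h7, h8, h9⟩
        · simpa [startShift] using hkL
        · simpa [landShift, add_comm, ← sub_eq_add_neg] using h6
    · rintro ⟨k, h⟩
      obtain ⟨-, r, -, -, h4, h5⟩ := h3 k h
      exact ⟨r, h4, h5⟩
  · intro k k' h h'
    obtain ⟨h4, r, h5, h6, h7, h8, h9⟩ := h3 k h
    obtain ⟨h4', r', h5', h6', h7', h8', h9'⟩ := h3 k' h'
    -- Both excursions end with the exit, hence at the same time. If one started later, its start at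
    -- `L` would lie inside the other, which stays below `L`.
    obtain rfl := h7.exit_unique h7' (by omega) (by omega)
    rcases lt_trichotomy k k' with hk | hk | hk
    · have := h6 k' hk h5'.le; omega
    · exact hk
    · have := h6' k hk h5.le; omega

end WalkPath

/-! ### The Green function in closed form -/

namespace Environment

variable (ω : Environment)

/-- The probability, from `y`, to exit from `(-∞, L]` by the step `L → L + 1`. -/
def e₁ (L y : ℤ) : ℝ := (ω.exitProb L y L (L + 1)).toReal
/-- The probability, from `y`, to exit from `(-∞, L]` by the step `L - 1 → L + 1`. -/
def e₂ (L y : ℤ) : ℝ := (ω.exitProb L y (L - 1) (L + 1)).toReal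
/-- The probability, from `y`, to exit from `(-∞, L]` by the step `L → L + 2`. -/
def e₃ (L y : ℤ) : ℝ := (ω.exitProb L y L (L + 2)).toReal

lemma exitProb_ne_top (L y p q : ℤ) : ω.exitProb L y p q ≠ ∞ := measure_ne_top _ _

lemma hitProb_ne_top (L y : ℤ) : ω.hitProb L y ≠ ∞ := measure_ne_top _ _

lemma e₁_nonneg (L y : ℤ) : 0 ≤ ω.e₁ L y := ENNReal.toReal_nonneg
lemma e₂_nonneg (L y : ℤ) : 0 ≤ ω.e₂ L y := ENNReal.toReal_nonneg
lemma e₃_nonneg (L y : ℤ) : 0 ≤ ω.e₃ L y := ENNReal.toReal_nonneg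

lemma exitProb_e₁ (L y : ℤ) : ω.exitProb L y L (L + 1) = ENNReal.ofReal (ω.e₁ L y) :=
  (ENNReal.ofReal_toReal (ω.exitProb_ne_top _ _ _ _)).symm
lemma exitProb_e₂ (L y : ℤ) : ω.exitProb L y (L - 1) (L + 1) = ENNReal.ofReal (ω.e₂ L y) :=
  (ENNReal.ofReal_toReal (ω.exitProb_ne_top _ _ _ _)).symm
lemma exitProb_e₃ (L y : ℤ) : ω.exitProb L y L (L + 2) = ENNReal.ofReal (ω.e₃ L y) :=
  (ENNReal.ofReal_toReal (ω.exitProb_ne_top _ _ _ _)).symm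

lemma f_eq_e {i j y : ℤ} (hj : j = i + 1) (hy : y ≤ i) : ω.f y i j = ω.e₁ i y + ω.e₂ i y := by
  rw [f_eq_hitProb ω hj, hitProb_eq ω (by omega), hj, add_sub_cancel_right,
    show i + 1 - 2 = i - 1 by ring, ENNReal.toReal_add (ω.exitProb_ne_top _ _ _ _)
      (ω.exitProb_ne_top _ _ _ _)]
  rfl

lemma hitProb_eq_e {i y : ℤ} (hy : y ≤ i) :
    ω.hitProb (i + 1) y = ENNReal.ofReal (ω.e₁ i y + ω.e₂ i y) := by
  rw [← f_eq_e ω (j := i + 1) rfl hy, f_eq_hitProb ω rfl,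
    ENNReal.ofReal_toReal (ω.hitProb_ne_top _ _)]

variable {ω}

lemma LimsupEqTop.e_add {L y : ℤ} (h : ω.LimsupEqTop y) (hy : y ≤ L) :
    ω.e₁ L y + ω.e₂ L y + ω.e₃ L y = 1 := by
  have := congrArg ENNReal.toReal (h.exitProb_add hy)
  rw [ENNReal.toReal_add (ENNReal.add_ne_top.2 ⟨ω.exitProb_ne_top _ _ _ _,
    ω.exitProb_ne_top _ _ _ _⟩) (ω.exitProb_ne_top _ _ _ _),
    ENNReal.toReal_add (ω.exitProb_ne_top _ _ _ _) (ω.exitProb_ne_top _ _ _ _)] at this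
  simpa [e₁, e₂, e₃] using this

variable (ω)

lemma measure_particleEvent_A (i : ℤ) :
    ω.walkLaw i (particleEvent i 0) = ENNReal.ofReal (ω.prob i (-1) * ω.e₁ (i - 1) (i - 1)) ∧
    ω.walkLaw i (particleEvent i 1) = ENNReal.ofReal (ω.prob i (-1) * ω.e₂ (i - 1) (i - 1)) ∧
    ω.walkLaw i (particleEvent i 2) = ENNReal.ofReal (ω.prob i (-1) * ω.e₃ (i - 1) (i - 1)) := by
  have h := ω.measure_particleEvent i
  have h0 := h 0
  have h1 := h 1
  have h2 := h 2
  simp [startShift, landShift, preShift, endShift, ← sub_eq_add_neg] at h0 h1 h2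
  rw [ENNReal.ofReal_mul (ω.nonneg _ _), ENNReal.ofReal_mul (ω.nonneg _ _),
    ENNReal.ofReal_mul (ω.nonneg _ _), ← exitProb_e₁, ← exitProb_e₂, ← exitProb_e₃,
    sub_add_cancel, show i - 1 - 1 = i - 2 by ring, show i - 1 + 2 = i + 1 by ring]
  exact ⟨h0, h1, h2⟩

lemma measure_particleEvent_B (i : ℤ) :
    ω.walkLaw i (particleEvent i 3) = ENNReal.ofReal (ω.prob i (-2) * ω.e₁ (i - 1) (i - 2)) ∧
    ω.walkLaw i (particleEvent i 4) = ENNReal.ofReal (ω.prob i (-2) * ω.e₂ (i - 1) (i - 2)) ∧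
    ω.walkLaw i (particleEvent i 5) = ENNReal.ofReal (ω.prob i (-2) * ω.e₃ (i - 1) (i - 2)) := by
  have h := ω.measure_particleEvent i
  have h0 := h 3
  have h1 := h 4
  have h2 := h 5
  simp [startShift, landShift, preShift, endShift, ← sub_eq_add_neg] at h0 h1 h2
  rw [ENNReal.ofReal_mul (ω.nonneg _ _), ENNReal.ofReal_mul (ω.nonneg _ _),
    ENNReal.ofReal_mul (ω.nonneg _ _), ← exitProb_e₁, ← exitProb_e₂, ← exitProb_e₃,
    sub_add_cancel, show i - 1 - 1 = i - 2 by ring, show i - 1 + 2 = i + 1 by ring]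
  exact ⟨h0, h1, h2⟩

/-- The expectation of `ind_exitVia_two`: an excursion can start at each visit to `L`, so its mean
number is the mean number of visits times its probability. -/
lemma exitProb_two_eq (L : ℤ) : ω.exitProb L L (L - 1) (L + 1)
    = ω.green L L L * (ω.walkLaw L (particleEvent L 2) + ω.walkLaw L (particleEvent L 5)) := by
  have h2 := ω.lintegral_excursionsBelow L L L 2
  have h5 := ω.lintegral_excursionsBelow L L L 5
  simp [startShift] at h2 h5
  rw [mul_add, ← h2, ← h5, ← lintegral_add_left (measurable_excursionsBelow L L 2), exitProb,
    ← lintegral_ind (measurableSet_exitVia _ _ _)]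
  refine lintegral_congr_ae ?_
  filter_upwards [ω.ae_validSteps L, ω.ae_start L] with X hv h0
  exact ind_exitVia_two hv h0

/-- The probability, from `L`, to return to `L` before the exit from `(-∞, L]`. -/
def returnProb (L : ℤ) : ℝ :=
  ω.prob L (-1) * ω.f (L - 1) (L - 1) L + ω.prob L (-2) * ω.f (L - 2) (L - 1) L

variable {ω}

lemma LimsupEqTop.down₁ {L : ℤ} (h : ω.LimsupEqTop L) (hp : ω.prob L (-1) ≠ 0) :
    ω.LimsupEqTop (L - 1) := h.of_step (by simpa using hp)

lemma LimsupEqTop.down₂ {L : ℤ} (h : ω.LimsupEqTop L) (hp : ω.prob L (-2) ≠ 0) :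
    ω.LimsupEqTop (L - 2) := h.of_step (by simpa using hp)

/-- The walk fails to return to `L` if it steps up, or if it steps down and then enters `[L, ∞)` at
`L + 1`. -/
lemma LimsupEqTop.one_sub_returnProb {L : ℤ} (h : ω.LimsupEqTop L) :
    1 - ω.returnProb L = ω.prob L 1 + ω.prob L 2 + (ω.prob L (-1) * ω.e₃ (L - 1) (L - 1)
      + ω.prob L (-2) * ω.e₃ (L - 1) (L - 2)) := by
  have hs := ω.sum_eq_one L
  simp at hs
  have h1 : ω.prob L (-1) * (1 - ω.f (L - 1) (L - 1) L)
      = ω.prob L (-1) * ω.e₃ (L - 1) (L - 1) := by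
    -- If the step is impossible, nothing is known about the walk from `L - 1`, but the factor in
    -- front vanishes.
    by_cases hp : ω.prob L (-1) = 0
    · simp [hp]
    · rw [f_eq_e ω (by ring) le_rfl, ← (h.down₁ hp).e_add le_rfl]
      ring
  have h2 : ω.prob L (-2) * (1 - ω.f (L - 2) (L - 1) L)
      = ω.prob L (-2) * ω.e₃ (L - 1) (L - 2) := by
    by_cases hp : ω.prob L (-2) = 0
    · simp [hp]
    · rw [f_eq_e ω (by ring) (by omega), ← (h.down₂ hp).e_add (L := L - 1) (by omega)]
      ring
  rw [returnProb, ← h1, ← h2]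
  linear_combination -hs

/-- Each of the three exit probabilities from `L` has the factor `green L L L`; the remaining
factors add up to `1 - returnProb L`, and the total is one. Both finiteness of the mean number of
visits and `returnProb L < 1` follow from this identity. -/
lemma LimsupEqTop.green_mul {L : ℤ} (h : ω.LimsupEqTop L) :
    ω.green L L L * ENNReal.ofReal (1 - ω.returnProb L) = 1 := by
  have h1 := h.exitProb_add le_rfl
  rw [exitProb_two_eq, exitProb_eq_green ω (by omega), exitProb_eq_green ω (by omega),
    ← mul_add, ← mul_add, (ω.measure_particleEvent_A L).2.2,
    (ω.measure_particleEvent_B L).2.2] at h1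
  have hn := ω.nonneg L
  have he := ω.e₃_nonneg (L - 1)
  rw [h.one_sub_returnProb, ← h1]
  congr 1
  rw [ENNReal.ofReal_add (add_nonneg (hn _) (hn _))
    (add_nonneg (mul_nonneg (hn _) (he _)) (mul_nonneg (hn _) (he _))),
    ENNReal.ofReal_add (hn _) (hn _),
    ENNReal.ofReal_add (mul_nonneg (hn _) (he _)) (mul_nonneg (hn _) (he _)),
    show L + 1 - L = 1 by ring, show L + 2 - L = 2 by ring]
  ring

lemma LimsupEqTop.returnProb_lt_one {L : ℤ} (h : ω.LimsupEqTop L) : ω.returnProb L < 1 := by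
  by_contra hn
  have := h.green_mul
  rw [ENNReal.ofReal_of_nonpos (by linarith)] at this
  simp at this

lemma LimsupEqTop.green_eq {L : ℤ} (h : ω.LimsupEqTop L) :
    ω.green L L L = ENNReal.ofReal (1 - ω.returnProb L)⁻¹ := by
  have hp : 0 < 1 - ω.returnProb L := by linarith [h.returnProb_lt_one]
  rw [ENNReal.ofReal_inv_of_pos hp]
  exact ENNReal.eq_inv_of_mul_eq_one_left h.green_mul

/-- Summation along `p.1 + p.2 = n` gives `(a + b) ^ n` by the binomial theorem, and then a
geometric series. Nonnegativity justifies the rearrangement. -/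
lemma tsum_binomial {a b : ℝ} (ha : 0 ≤ a) (hb : 0 ≤ b) (hab : a + b < 1) :
    ∑' p : ℕ × ℕ, (((p.1 + p.2).factorial : ℝ) / (p.1.factorial * p.2.factorial)) *
      a ^ p.1 * b ^ p.2 = (1 - (a + b))⁻¹ := by
  have key : ∀ n : ℕ, ∑ p ∈ Finset.HasAntidiagonal.antidiagonal n,
      (((p.1 + p.2).factorial : ℝ) / (p.1.factorial * p.2.factorial)) * a ^ p.1 * b ^ p.2
        = (a + b) ^ n := by
    intro n
    rw [(Commute.all a b).add_pow']
    refine Finset.sum_congr rfl fun p hp => ?_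
    have hp' := Finset.HasAntidiagonal.mem_antidiagonal.1 hp
    rw [← hp', nsmul_eq_mul, Nat.choose_symm_add, Nat.add_choose, 
      Nat.cast_div (Nat.factorial_mul_factorial_dvd_factorial_add _ _) (by positivity)]
    push_cast
    ring
  have hf : ∀ p : ℕ × ℕ, 0 ≤ (((p.1 + p.2).factorial : ℝ) / (p.1.factorial * p.2.factorial)) *
      a ^ p.1 * b ^ p.2 := fun p => by positivity
  set f : ℕ × ℕ → ℝ := fun p => (((p.1 + p.2).factorial : ℝ) / (p.1.factorial * p.2.factorial)) *
      a ^ p.1 * b ^ p.2 with hfdef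
  have hgeo := hasSum_geometric_of_lt_one (add_nonneg ha hb) hab
  have hk : ∀ n : ℕ, ∑' c : (Finset.HasAntidiagonal.antidiagonal n : Finset (ℕ × ℕ)), f c = (a + b) ^ n := by
    intro n
    rw [Finset.tsum_subtype (Finset.HasAntidiagonal.antidiagonal n) f]
    exact key n
  have hsum : Summable (f ∘ Finset.HasAntidiagonal.sigmaAntidiagonalEquivProd) := by
    refine (summable_sigma_of_nonneg fun c => hf _).2 ⟨fun n => ?_, ?_⟩
    · exact (hasSum_fintype _).summable
    · refine hgeo.summable.congr fun n => ?_
      exact (hk n).symm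
  rw [← Finset.HasAntidiagonal.sigmaAntidiagonalEquivProd.tsum_eq f, ← hgeo.tsum_eq]
  exact (hsum.tsum_sigma' fun n => (hasSum_fintype _).summable).trans (tsum_congr hk)

lemma f_nonneg (k i j : ℤ) : 0 ≤ ω.f k i j := measureReal_nonneg

/-- The series runs over the numbers of returns to `i - 1` through `i - 2` and through `i - 3`, and
the coefficient counts the orders in which they occur. -/
lemma LimsupEqTop.returnSum_eq {i : ℤ} (h : ω.LimsupEqTop (i - 1)) :
    ω.returnSum i = (1 - ω.returnProb (i - 1))⁻¹ := by
  have hR := h.returnProb_lt_one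
  rw [returnProb, show i - 1 - 1 = i - 2 by ring, show i - 1 - 2 = i - 3 by ring] at *
  exact tsum_binomial (mul_nonneg (ω.nonneg _ _) (f_nonneg _ _ _))
    (mul_nonneg (ω.nonneg _ _) (f_nonneg _ _ _)) hR

lemma LimsupEqTop.green_toReal {i : ℤ} (h : ω.LimsupEqTop (i - 1)) :
    ω.green (i - 1) (i - 1) (i - 1) = ENNReal.ofReal (ω.returnSum i) := by
  rw [h.green_eq, h.returnSum_eq]

lemma LimsupEqTop.returnSum_nonneg {i : ℤ} (h : ω.LimsupEqTop (i - 1)) : 0 ≤ ω.returnSum i := by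
  rw [h.returnSum_eq, inv_nonneg]
  linarith [h.returnProb_lt_one]

lemma LimsupEqTop.returnSum_mul {i : ℤ} (h : ω.LimsupEqTop (i - 1)) :
    ω.returnSum i * ω.prob (i - 1) 1 = ω.e₁ (i - 1) (i - 1) ∧
      ω.returnSum i * ω.prob (i - 1) 2 = ω.e₃ (i - 1) (i - 1) := by
  have hS := h.returnSum_nonneg
  constructor
  · rw [e₁, exitProb_eq_green ω (by omega), h.green_toReal,
      ← ENNReal.ofReal_mul hS, ENNReal.toReal_ofReal (mul_nonneg hS (ω.nonneg _ _)),
      show i - 1 + 1 - (i - 1) = 1 by ring]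
  · rw [e₃, exitProb_eq_green ω (by omega), h.green_toReal,
      ← ENNReal.ofReal_mul hS, ENNReal.toReal_ofReal (mul_nonneg hS (ω.nonneg _ _)),
      show i - 1 + 2 - (i - 1) = 2 by ring]

variable (ω) in
-- An exit whose last position is `L` needs a visit to `L`, hence an entrance into `[L, ∞)` at `L`.
lemma e_eq_f_mul (L y : ℤ) :
    ω.e₁ L y = ω.f y (L - 1) L * ω.e₁ L L ∧ ω.e₃ L y = ω.f y (L - 1) L * ω.e₃ L L := by
  rw [f_eq_hitProb ω (by ring)]
  simp only [e₁, e₃]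
  rw [← ENNReal.toReal_mul, ← ENNReal.toReal_mul, exitProb_eq_green ω (by omega),
    exitProb_eq_green ω (by omega), exitProb_eq_green ω (by omega),
    exitProb_eq_green ω (by omega), green_eq_hitProb_mul, mul_assoc, mul_assoc]
  exact ⟨rfl, rfl⟩

lemma LimsupEqTop.of_hit {L y : ℤ} (h : ω.LimsupEqTop y) (hf : ω.f y (L - 1) L ≠ 0) :
    ω.LimsupEqTop L := by
  by_contra hL
  apply hf
  rw [f_eq_hitProb ω (by ring)]
  have : ω.hitProb L y = 0 := by
    have hsub : hitting L ⊆ ⋃ n, {X | X n = L} := fun X ⟨n, hn, _⟩ => Set.mem_iUnion.2 ⟨n, hn⟩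
    refine measure_mono_null hsub (measure_iUnion_null fun n => ?_)
    by_contra hn
    exact hL (h.of_reach hn)
  rw [this, ENNReal.toReal_zero]

/-- `S_i` times an up-step probability is an exit probability from `i - 1`, and `α₂` is what remains
of the total mass one. The hypothesis is about `i - 1` only, so the lemma applies at `i = 1` to the
walk known to be unbounded from `0`. -/
lemma α_eq {i : ℤ} (h : ω.prob i (-1) ≠ 0 → ω.LimsupEqTop (i - 1)) :
    ω.α₁ i = ω.prob i (-1) * ω.e₁ (i - 1) (i - 1) ∧
    ω.α₂ i = ω.prob i (-1) * ω.e₂ (i - 1) (i - 1) ∧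
    ω.α₃ i = ω.prob i (-1) * ω.e₃ (i - 1) (i - 1) := by
  by_cases hp : ω.prob i (-1) = 0
  · simp [α₁, α₂, α₃, hp]
  · have h' := h hp
    have h1 : ω.α₁ i = ω.prob i (-1) * ω.e₁ (i - 1) (i - 1) := by
      rw [α₁, mul_assoc, h'.returnSum_mul.1]
    have h3 : ω.α₃ i = ω.prob i (-1) * ω.e₃ (i - 1) (i - 1) := by
      rw [α₃, mul_assoc, h'.returnSum_mul.2]
    refine ⟨h1, ?_, h3⟩
    rw [α₂, h1, h3]
    linear_combination (-ω.prob i (-1)) * (h'.e_add le_rfl)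

lemma γ_eq {i : ℤ} (h' : ω.LimsupEqTop (i - 1)) :
    ω.γ₁ i = ω.prob (i + 1) (-2) * ω.e₁ (i - 1) (i - 1) ∧
    ω.γ₂ i = ω.prob (i + 1) (-2) * ω.e₂ (i - 1) (i - 1) ∧
    ω.γ₃ i = ω.prob (i + 1) (-2) * ω.e₃ (i - 1) (i - 1) := by
  have h1 : ω.γ₁ i = ω.prob (i + 1) (-2) * ω.e₁ (i - 1) (i - 1) := by
    rw [γ₁, mul_assoc, h'.returnSum_mul.1]
  have h3 : ω.γ₃ i = ω.prob (i + 1) (-2) * ω.e₃ (i - 1) (i - 1) := by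
    rw [γ₃, mul_assoc, h'.returnSum_mul.2]
  refine ⟨h1, ?_, h3⟩
  rw [γ₂, h1, h3]
  linear_combination (-ω.prob (i + 1) (-2)) * (h'.e_add le_rfl)

lemma β_eq {i : ℤ} (h : ω.prob i (-2) ≠ 0 → ω.LimsupEqTop (i - 2)) :
    ω.β₁ i = ω.prob i (-2) * ω.e₁ (i - 1) (i - 2) ∧
    ω.β₂ i = ω.prob i (-2) * ω.e₂ (i - 1) (i - 2) ∧
    ω.β₃ i = ω.prob i (-2) * ω.e₃ (i - 1) (i - 2) := by
  by_cases hp : ω.prob i (-2) = 0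
  · simp [β₁, β₂, β₃, hp]
  · have h' := h hp
    have he := ω.e_eq_f_mul (i - 1) (i - 2)
    rw [show i - 1 - 1 = i - 2 by ring] at he
    have h13 : ω.β₁ i = ω.prob i (-2) * ω.e₁ (i - 1) (i - 2) ∧
        ω.β₃ i = ω.prob i (-2) * ω.e₃ (i - 1) (i - 2) := by
      rw [he.1, he.2, β₁, β₃]
      -- Either `i - 1` cannot be entered and all terms vanish, or it is reached from `i - 2` and
      -- inherits the hypothesis, so that `S_i` has its meaning.
      by_cases hf : ω.f (i - 2) (i - 2) (i - 1) = 0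
      · simp [hf]
      · have hL : ω.LimsupEqTop (i - 1) := h'.of_hit (by rwa [show i - 1 - 1 = i - 2 by ring])
        rw [← hL.returnSum_mul.1, ← hL.returnSum_mul.2]
        constructor <;> ring
    refine ⟨h13.1, ?_, h13.2⟩
    rw [β₂, h13.1, h13.2]
    linear_combination (-ω.prob i (-2)) * (h'.e_add (L := i - 1) (by omega))

end Environment

/-! ### The offspring of an excursion -/

namespace WalkPath

lemma shift_mem_particleEvent {X : ℕ → ℤ} {i : ℤ} {m : Fin 9} {k : ℕ} :
    shift k X ∈ particleEvent i m ↔ ∃ r, IsExcursion X i m k r := by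
  constructor
  · rintro ⟨r, h1, h2, h3, h4, h5, h6⟩
    refine ⟨r + k, by omega, ?_, ?_, fun j hj hjr => ?_, h5, ?_⟩
    · simpa using h2
    · simpa [add_comm] using h3
    · have := h4 (j - k) (by omega) (by omega)
      rwa [shift_apply, Nat.sub_add_cancel hj.le] at this
    · rw [← h6, shift_apply]
      congr 1
      omega
  · rintro ⟨r, h1, h2, h3, h4, h5, h6⟩
    refine ⟨r - k, by omega, ?_, ?_, fun j hj hjr => h4 (j + k) (by omega) (by omega), ?_, ?_⟩
    · simpa using h2
    · simpa [add_comm] using h3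
    · rwa [shift_apply, Nat.sub_add_cancel h1.le]
    · rwa [shift_apply, show r - k + 1 + k = r + 1 by omega]

lemma IsExcursion.lt_end {X : ℕ → ℤ} {i : ℤ} {m : Fin 9} {k r : ℕ} (h : IsExcursion X i m k r) :
    i ≤ X (r + 1) := by
  have := h.2.2.2.2.2
  have := endShift_nonneg m
  omega

lemma IsExcursion.end_le {X : ℕ → ℤ} {i : ℤ} {m : Fin 9} {k r r' : ℕ}
    (h : IsExcursion X i m k r) (hr' : i ≤ X (r' + 1)) (hk : k ≤ r') : r ≤ r' := by
  by_contra hn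
  have := h.2.2.2.1 (r' + 1) (by omega) (by omega)
  omega

lemma IsExcursion.end_unique {X : ℕ → ℤ} {i : ℤ} {m m' : Fin 9} {k r r' : ℕ}
    (h : IsExcursion X i m k r) (h' : IsExcursion X i m' k r') : r = r' :=
  le_antisymm (h.end_le h'.lt_end h'.1.le) (h'.end_le h.lt_end h.1.le)

/-- An excursion at `i` is determined by its starting time. One that starts by time `r` is over by
then, since the parent takes the path above `i` at time `r + 1`. -/
lemma offspringCount_eq_tsum {X : ℕ → ℤ} {i : ℤ} {l : Fin 9} {r : ℕ}
    (hr : IsExcursion X (i + 1) l 0 r) (m : Fin 9) : (offspringCount i l m X : ℝ≥0∞)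
      = ∑' k, ind (k ≤ r ∧ shift k X ∈ particleEvent i m) := by
  have hpart : ∀ k, (∃ r', (k, r') ∈ {p : ℕ × ℕ | ∃ r, IsExcursion X (i + 1) l 0 r ∧ p.2 ≤ r ∧
      IsExcursion X i m p.1 p.2}) ↔ k ≤ r ∧ shift k X ∈ particleEvent i m := by
    intro k
    rw [shift_mem_particleEvent]
    constructor
    · rintro ⟨r', s, hs, hrs, h⟩
      obtain rfl := hr.end_unique hs
      exact ⟨h.1.le.trans hrs, r', h⟩
    · rintro ⟨hk, r', h⟩
      refine ⟨r', r, hr, h.end_le ?_ hk, h⟩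
      have := hr.lt_end
      omega
  rw [offspringCount, encard_eq_tsum_ind, ENNReal.tsum_prod']
  refine tsum_congr fun k => ?_
  rw [tsum_ind, ind_congr (hpart k)]
  rintro r₁ r₂ ⟨-, -, -, h⟩ ⟨-, -, -, h'⟩
  exact h.end_unique h'

/-- The offspring of an excursion at `i + 1` are the excursion at `i` that may start at the same
time, and the excursions at `i` before the exit from `(-∞, i]`. -/
lemma offspringCount_eq {X : ℕ → ℤ} {i : ℤ} {l : Fin 9} (hX : X ∈ particleEvent (i + 1) l)
    (m : Fin 9) : (offspringCount i l m X : ℝ≥0∞)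
      = ind (X ∈ particleEvent i m) + excursionsBelow i i m (shift 1 X) := by
  obtain ⟨r, hr⟩ := hX
  have hbelow : ∀ k, k + 1 ≤ r ↔ Below i k (shift 1 X) := by
    intro k
    constructor
    · intro hk j hj
      have := hr.2.2.2.1 (j + 1) (by omega) (by omega)
      rw [shift_apply]
      omega
    · intro h
      by_contra hk
      have h1 := h r (by omega)
      have := hr.lt_end
      rw [shift_apply] at h1
      omega
  rw [offspringCount_eq_tsum hr, tsum_eq_zero_add' ENNReal.summable, excursionsBelow]
  congr 1
  · exact ind_congr (by simp)
  · refine tsum_congr fun k => ind_congr ?_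
    rw [hbelow k, shift_shift]

lemma forall_fin9 {P : Fin 9 → Prop} (h0 : P 0) (h1 : P 1) (h2 : P 2) (h3 : P 3) (h4 : P 4)
    (h5 : P 5) (h6 : P 6) (h7 : P 7) (h8 : P 8) : ∀ m, P m := by
  intro m
  fin_cases m <;> assumption

end WalkPath

/-! ### Mean offspring on a given exit -/

namespace Environment

variable (ω : Environment)

/-- The mean number of excursions at `i` of type `m` before the exit from `(-∞, i]`, on the event
that this exit is from `p` to `q`. -/
def exitOffspring (i y p q : ℤ) (m : Fin 9) : ℝ≥0∞ :=
  ∫⁻ X, excursionsBelow i i m X * ind (X ∈ exitVia i p q) ∂ω.walkLaw y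

/-- The probability, from the landing point of an excursion at `i + 1` of type `l`, that this
excursion is of type `l` and starts together with a type-`m` excursion at `i`. -/
def simultaneous (i : ℤ) (l m : Fin 9) : ℝ≥0∞ :=
  ω.walkLaw (i + 1 + landShift l) {X | X ∈ exitVia i (i + 1 + preShift l) (i + 1 + endShift l) ∧
    (1 + startShift l = startShift m ∧ 1 + landShift l = landShift m) ∧
    X ∈ exitVia (i - 1) (i + preShift m) (i + endShift m)}

/-- Clears the conditioning, so that all computations are with unconditioned means; if the particle
has probability `0`, both sides vanish. -/
lemma meanOffspring_mul (i : ℤ) (l m : Fin 9) :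
    ω.meanOffspring i l m * ω.walkLaw (i + 1 + startShift l) (particleEvent (i + 1) l)
      = ∫⁻ X, ind (X ∈ particleEvent (i + 1) l) * (ind (X ∈ particleEvent i m)
          + excursionsBelow i i m (shift 1 X)) ∂ω.walkLaw (i + 1 + startShift l) := by
  have hm := measurableSet_particleEvent (i + 1) l
  set μ := ω.walkLaw (i + 1 + startShift l)
  have h1 : ∫⁻ X, ind (X ∈ particleEvent (i + 1) l) * (ind (X ∈ particleEvent i m)
          + excursionsBelow i i m (shift 1 X)) ∂μ
      = ∫⁻ X in particleEvent (i + 1) l, (offspringCount i l m X : ℝ≥0∞) ∂μ := by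
    rw [setLIntegral_congr_fun hm fun X hX => offspringCount_eq hX m, ← lintegral_indicator hm]
    refine lintegral_congr fun X => ?_
    by_cases hX : X ∈ particleEvent (i + 1) l
    · rw [Set.indicator_of_mem hX, ind_of hX, one_mul]
    · rw [Set.indicator_of_notMem hX, ind_of_not hX, zero_mul]
  rw [h1, meanOffspring, particleLaw, ProbabilityTheory.cond, lintegral_smul_measure, smul_eq_mul]
  by_cases h0 : μ (particleEvent (i + 1) l) = 0
  · rw [Measure.restrict_eq_zero.2 h0, h0]
    simp
  · rw [mul_comm, ← mul_assoc, ENNReal.mul_inv_cancel h0 (measure_ne_top _ _), one_mul]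

/-- The first step of the parent factors out by the Markov property at time `1`. What remains
concerns the path from the landing site: the excursions before its exit, and the child that shares
the parent's first step. -/
lemma meanOffspring_mul_eq (i : ℤ) (l m : Fin 9) :
    ω.meanOffspring i l m * ω.walkLaw (i + 1 + startShift l) (particleEvent (i + 1) l)
      = ENNReal.ofReal (ω.prob (i + 1 + startShift l) (landShift l - startShift l)) *
        (ω.exitOffspring i (i + 1 + landShift l) (i + 1 + preShift l) (i + 1 + endShift l) m
          + ω.simultaneous i l m) := by
  have hG : Measurable fun X => excursionsBelow i i m X *
      ind (X ∈ exitVia i (i + 1 + preShift l) (i + 1 + endShift l)) :=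
    (measurable_excursionsBelow _ _ _).mul (measurable_ind (measurableSet_exitVia _ _ _))
  have hm1 := measurableSet_particleEvent (i + 1) l
  have hm2 := measurableSet_particleEvent i m
  have h1 : ∫⁻ X, ind (X ∈ particleEvent (i + 1) l) * excursionsBelow i i m (shift 1 X)
        ∂ω.walkLaw (i + 1 + startShift l)
      = ENNReal.ofReal (ω.prob (i + 1 + startShift l) (landShift l - startShift l)) *
        ω.exitOffspring i (i + 1 + landShift l) (i + 1 + preShift l) (i + 1 + endShift l) m := by
    rw [show landShift l - startShift l = i + 1 + landShift l - (i + 1 + startShift l) by ring,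
      ← walkLaw_step, exitOffspring, ← lintegral_ind (measurableSet_coord_eq _ _)]
    refine Eq.trans (lintegral_congr_ae ?_) (ω.lintegral_mul_shift _ _ 1
      (DeterminedBy.ind fun X Y h => by simp [h 1 le_rfl])
      (fun X hX => ind_ne_zero.1 hX) hG)
    filter_upwards [ω.ae_start (i + 1 + startShift l)] with X hX
    rw [mul_comm (excursionsBelow _ _ _ _), ← mul_assoc, ← ind_and]
    congr 1
    refine ind_congr (mem_particleEvent.trans ?_)
    simp [hX]
  have h2 : ∫⁻ X, ind (X ∈ particleEvent (i + 1) l) * ind (X ∈ particleEvent i m)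
        ∂ω.walkLaw (i + 1 + startShift l)
      = ENNReal.ofReal (ω.prob (i + 1 + startShift l) (landShift l - startShift l)) *
        ω.simultaneous i l m := by
    have hms : MeasurableSet {X : ℕ → ℤ |
        X ∈ exitVia i (i + 1 + preShift l) (i + 1 + endShift l) ∧
        (1 + startShift l = startShift m ∧ 1 + landShift l = landShift m) ∧
        X ∈ exitVia (i - 1) (i + preShift m) (i + endShift m)} :=
      (measurableSet_exitVia _ _ _).inter ((MeasurableSet.const _).inter
        (measurableSet_exitVia _ _ _))
    have hmi : MeasurableSet {X : ℕ → ℤ | X ∈ particleEvent (i + 1) l ∧ X ∈ particleEvent i m} :=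
      hm1.inter hm2
    simp_rw [← ind_and]
    rw [show landShift l - startShift l = i + 1 + landShift l - (i + 1 + startShift l) by ring,
      simultaneous, ← ω.measure_first_step _ _ hms]
    refine (lintegral_ind hmi).trans (measure_congr ?_)
    filter_upwards [ω.ae_start (i + 1 + startShift l)] with X hX
    refine propext ⟨fun h => ?_, fun h => ?_⟩
    · have h1 := mem_particleEvent.1 h.1
      have h2 := mem_particleEvent.1 h.2
      rw [add_sub_cancel_right] at h1
      exact ⟨h1.2.1, h1.2.2, ⟨by have := h2.1; omega, by have := h2.2.1; have := h1.2.1; omega⟩,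
        h2.2.2⟩
    · refine ⟨mem_particleEvent.2 ⟨hX, h.1, ?_⟩, mem_particleEvent.2 ⟨?_, ?_, h.2.2.2⟩⟩
      · rw [add_sub_cancel_right]
        exact h.2.1
      · have := h.2.2.1.1
        omega
      · have h3 := h.2.2.1.2
        have h4 : X 1 = i + 1 + landShift l := h.1
        omega
  rw [meanOffspring_mul, mul_add, ← h1, ← h2,
    ← lintegral_add_left (f := fun X => ind (X ∈ particleEvent (i + 1) l) *
      excursionsBelow i i m (shift 1 X)) ((measurable_ind hm1).mul
        ((measurable_excursionsBelow i i m).comp (measurable_shift 1)))]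
  refine lintegral_congr fun X => ?_
  ring

/-- The Markov property at the entrance into `L`: the step by which `L` is entered has no influence
on the later exit from `(-∞, L]`. -/
lemma measure_exitVia_inter_hit {L p p' q : ℤ} (hq : L < q) (y : ℤ) :
    ω.walkLaw y {X | X ∈ exitVia L p q ∧ X ∈ exitVia (L - 1) p' L}
      = ω.exitProb (L - 1) y p' L * ω.exitProb L L p q := by
  have hm : MeasurableSet {X | X ∈ exitVia L p q ∧ X ∈ exitVia (L - 1) p' L} :=
    (measurableSet_exitVia _ _ _).inter (measurableSet_exitVia _ _ _)
  rw [← lintegral_ind hm]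
  have h := ω.lintegral_exit_mul_shift (L := L - 1) (p := p') (q := L) (by omega) y
    (measurable_ind (measurableSet_exitVia L p q))
  rw [lintegral_ind (measurableSet_exitVia L p q)] at h
  rw [exitProb, exitProb, ← exitProb, ← h]
  refine lintegral_congr fun X => ?_
  have h1 : ∀ r, ind (Below (L - 1) r X ∧ X r = p' ∧ X (r + 1) = L) *
      ind (shift (r + 1) X ∈ exitVia L p q)
      = ind (Below (L - 1) r X ∧ X r = p' ∧ X (r + 1) = L) * ind (X ∈ exitVia L p q) := by
    intro r
    by_cases hr : Below (L - 1) r X ∧ X r = p' ∧ X (r + 1) = L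
    · have hb : Below L (r + 1) X := fun j hj => by
        rcases Nat.lt_or_ge r j with h | h
        · obtain rfl : j = r + 1 := by omega
          exact hr.2.2.le
        · have := hr.1 j h
          omega
      rw [ind_congr (exitVia_shift_iff hq hb)]
    · rw [ind_of_not hr, zero_mul, zero_mul]
  simp_rw [h1]
  rw [ENNReal.tsum_mul_right, ← ind_mem_exitVia (by omega), ← ind_and]
  exact ind_congr and_comm

lemma exitVia_two_subset (L : ℤ) : exitVia (L - 1) (L - 1) (L + 1) ⊆ exitVia L (L - 1) (L + 1) :=
  fun _ ⟨r, h1, h2⟩ => ⟨r, fun j hj => (h1 j hj).trans (by omega), h2⟩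

/-- A jump over `L` from `L - 1` to `L + 1` is the exit from `(-∞, L]` itself, so it excludes every
other exit step. -/
lemma measure_exitVia_inter_jump {L p q : ℤ} (hq : L < q) (y : ℤ) :
    ω.walkLaw y {X | X ∈ exitVia L p q ∧ X ∈ exitVia (L - 1) (L - 1) (L + 1)}
      = if p = L - 1 ∧ q = L + 1 then ω.exitProb (L - 1) y (L - 1) (L + 1) else 0 := by
  split_ifs with h
  · obtain ⟨rfl, rfl⟩ := h
    refine congrArg _ (Set.ext fun X => ⟨fun h => h.2, fun h => ⟨exitVia_two_subset _ h, h⟩⟩)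
  · refine measure_mono_null (fun X hX => ?_) measure_empty
    have := exitVia_unique hq (by omega) hX.1 (exitVia_two_subset _ hX.2)
    exact h this

/-- Sum over the visits to `i`: the exit is unaffected by the path before the visit, so each visit
contributes the probability that it starts a type-`m` excursion followed by the prescribed exit. -/
lemma exitOffspring_eq {i p q : ℤ} (hq : i < q) (y : ℤ) {m : Fin 9} (hm : startShift m = 0) :
    ω.exitOffspring i y p q m = ω.green i y i * (ENNReal.ofReal (ω.prob i (landShift m)) *
      ω.walkLaw (i + landShift m)
        {X | X ∈ exitVia i p q ∧ X ∈ exitVia (i - 1) (i + preShift m) (i + endShift m)}) := by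
  have hE := measurableSet_exitVia i p q
  have hpe := measurableSet_particleEvent i m
  have h := ω.lintegral_excursionsBelow_mul i i y m (measurable_ind hE)
    fun k X hb => ind_congr (exitVia_shift_iff hq hb)
  have h2 := ω.measure_particleEvent_inter i m hE
  simp only [hm, add_zero, sub_zero] at h h2
  have hset : {X | X ∈ exitVia i p q ∧ X ∈ exitVia (i - 1) (i + preShift m) (i + endShift m)}
    = {X | X ∈ exitVia (i - 1) (i + preShift m) (i + endShift m) ∧ X ∈ exitVia i p q} :=
    Set.ext fun X => and_comm
  rw [exitOffspring, h, hset, ← h2]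
  congr 1
  have hms : MeasurableSet {X | X ∈ particleEvent i m ∧ X ∈ exitVia i p q} := hpe.inter hE
  simp_rw [← ind_and]
  refine (lintegral_ind hms).trans (measure_congr ?_)
  filter_upwards [ω.ae_start i] with X hX
  refine propext (and_congr_right fun h => ?_)
  have h1 := (mem_particleEvent.1 h).2.1
  have h3 := landShift_le m
  refine (exitVia_shift_iff hq fun j hj => ?_).symm
  interval_cases j <;> omega

/-- Excursions that return to `i`. -/
lemma exitOffspring_return {i p q : ℤ} (hq : i < q) (y : ℤ) {m : Fin 9} (hm : startShift m = 0)
    (hm' : endShift m = 0) : ω.exitOffspring i y p q m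
      = ω.green i y i * ω.walkLaw i (particleEvent i m) * ω.exitProb i i p q := by
  have h := ω.measure_particleEvent i m
  simp only [hm, hm', add_zero, sub_zero] at h
  rw [exitOffspring_eq ω hq y hm, hm', add_zero, measure_exitVia_inter_hit ω hq, h]
  ring

/-- Excursions that jump to `i + 1`. -/
lemma exitOffspring_jump {i p q : ℤ} (hq : i < q) (y : ℤ) {m : Fin 9} (hm : startShift m = 0)
    (hm' : endShift m = 1) (hm'' : preShift m = -1) : ω.exitOffspring i y p q m
      = ω.green i y i * if p = i - 1 ∧ q = i + 1 then ω.walkLaw i (particleEvent i m) else 0 := by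
  have h := ω.measure_particleEvent i m
  simp only [hm, hm', hm'', add_zero, sub_zero, ← sub_eq_add_neg] at h
  rw [exitOffspring_eq ω hq y hm, hm', hm'', ← sub_eq_add_neg, measure_exitVia_inter_jump ω hq]
  split_ifs
  · rw [h]
  · rw [mul_zero]

/-- An excursion of type C at `i` starts at `i + 1`, outside the half-line. -/
lemma exitOffspring_C (i y p q : ℤ) {m : Fin 9} (hm : startShift m = 1) :
    ω.exitOffspring i y p q m = 0 := by
  rw [exitOffspring, lintegral_congr (g := fun _ => 0), lintegral_zero]
  intro X
  have : excursionsBelow i i m X = 0 := by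
    rw [excursionsBelow, ENNReal.tsum_eq_zero]
    intro k
    refine ind_of_not fun h => ?_
    have h1 := (mem_particleEvent.1 h.2).1
    have h2 := h.1 k le_rfl
    simp only [shift_apply, Nat.zero_add] at h1
    omega
  rw [this, zero_mul]

end Environment

/-! ### The rows of the mean matrices -/

namespace Environment

variable {ω : Environment}

lemma LimsupEqTop.α_eq {i : ℤ} (h : ω.LimsupEqTop i) :
    ω.α₁ i = ω.prob i (-1) * ω.e₁ (i - 1) (i - 1) ∧
    ω.α₂ i = ω.prob i (-1) * ω.e₂ (i - 1) (i - 1) ∧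
    ω.α₃ i = ω.prob i (-1) * ω.e₃ (i - 1) (i - 1) := Environment.α_eq h.down₁

lemma LimsupEqTop.β_eq {i : ℤ} (h : ω.LimsupEqTop i) :
    ω.β₁ i = ω.prob i (-2) * ω.e₁ (i - 1) (i - 2) ∧
    ω.β₂ i = ω.prob i (-2) * ω.e₂ (i - 1) (i - 2) ∧
    ω.β₃ i = ω.prob i (-2) * ω.e₃ (i - 1) (i - 2) := Environment.β_eq h.down₂

/-- Excursions of subtypes 1 and 2 are those that return to `i`. Dividing by `d_i` is therefore
multiplying by the mean number of visits to `i`. -/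
lemma LimsupEqTop.denominator_eq {i : ℤ} (h : ω.LimsupEqTop i) :
    1 - ω.α₁ i - ω.α₂ i - ω.β₁ i - ω.β₂ i = 1 - ω.returnProb i := by
  obtain ⟨h1, h2, -⟩ := h.α_eq
  obtain ⟨h3, h4, -⟩ := h.β_eq
  rw [h1, h2, h3, h4, returnProb, f_eq_e ω (by ring) le_rfl, f_eq_e ω (by ring) (by omega)]
  ring

/-- The mean numbers of the excursions that return to `i`. -/
lemma LimsupEqTop.green_mul_return {i : ℤ} (h : ω.LimsupEqTop i) :
    (0 ≤ ω.x i ∧ ω.green i i i * ω.walkLaw i (particleEvent i 0) = ENNReal.ofReal (ω.x i)) ∧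
    (0 ≤ ω.y i ∧ ω.green i i i * ω.walkLaw i (particleEvent i 1) = ENNReal.ofReal (ω.y i)) ∧
    (0 ≤ ω.z i ∧ ω.green i i i * ω.walkLaw i (particleEvent i 3) = ENNReal.ofReal (ω.z i)) ∧
    (0 ≤ ω.w i ∧ ω.green i i i * ω.walkLaw i (particleEvent i 4) = ENNReal.ofReal (ω.w i)) := by
  obtain ⟨h1, h2, -⟩ := h.α_eq
  obtain ⟨h3, h4, -⟩ := h.β_eq
  obtain ⟨p1, p2, -⟩ := ω.measure_particleEvent_A i
  obtain ⟨p3, p4, -⟩ := ω.measure_particleEvent_B i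
  have hd : 0 < 1 - ω.returnProb i := by linarith [h.returnProb_lt_one]
  have hd' : 0 ≤ (1 - ω.returnProb i)⁻¹ := inv_nonneg.2 hd.le
  have key : ∀ a b : ℝ, 0 ≤ a → 0 ≤ b → 0 ≤ a * b / (1 - ω.returnProb i) ∧
      ω.green i i i * ENNReal.ofReal (a * b) = ENNReal.ofReal (a * b / (1 - ω.returnProb i)) := by
    intro a b ha hb
    refine ⟨div_nonneg (mul_nonneg ha hb) hd.le, ?_⟩
    rw [h.green_eq, ← ENNReal.ofReal_mul hd', div_eq_inv_mul]
  rw [p1, p2, p3, p4, x, y, z, w, h.denominator_eq, h1, h2, h3, h4]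
  exact ⟨key _ _ (ω.nonneg _ _) (ω.e₁_nonneg _ _), key _ _ (ω.nonneg _ _) (ω.e₂_nonneg _ _),
    key _ _ (ω.nonneg _ _) (ω.e₁_nonneg _ _), key _ _ (ω.nonneg _ _) (ω.e₂_nonneg _ _)⟩

/-- The mean numbers of the excursions that jump to `i + 1`. -/
lemma LimsupEqTop.green_mul_jump {i : ℤ} (h : ω.LimsupEqTop i) :
    (0 ≤ ω.s i ∧ ω.green i i i * ω.walkLaw i (particleEvent i 2)
      = ω.exitProb i i (i - 1) (i + 1) * ENNReal.ofReal (ω.s i)) ∧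
    (0 ≤ 1 - ω.s i ∧ ω.green i i i * ω.walkLaw i (particleEvent i 5)
      = ω.exitProb i i (i - 1) (i + 1) * ENNReal.ofReal (1 - ω.s i)) := by
  obtain ⟨-, -, h3⟩ := h.α_eq
  obtain ⟨-, -, h6⟩ := h.β_eq
  have hα : 0 ≤ ω.α₃ i := h3 ▸ mul_nonneg (ω.nonneg _ _) (ω.e₃_nonneg _ _)
  have hβ : 0 ≤ ω.β₃ i := h6 ▸ mul_nonneg (ω.nonneg _ _) (ω.e₃_nonneg _ _)
  rw [exitProb_two_eq, (ω.measure_particleEvent_A i).2.2, (ω.measure_particleEvent_B i).2.2,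
    ← h3, ← h6, ← ENNReal.ofReal_add hα hβ, mul_assoc, mul_assoc,
    ← ENNReal.ofReal_mul (add_nonneg hα hβ), ← ENNReal.ofReal_mul (add_nonneg hα hβ)]
  -- This product form survives a vanishing denominator, because then the nonnegative numbers `α₃`
  -- and `β₃` are both `0`.
  have hs : (ω.α₃ i + ω.β₃ i) * ω.s i = ω.α₃ i := by
    rw [s]
    by_cases h0 : ω.α₃ i + ω.β₃ i = 0
    · rw [h0, zero_mul]
      linarith
    · rw [mul_div_cancel₀ _ h0]
  rw [mul_sub, hs, mul_one, add_sub_cancel_left]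
  refine ⟨⟨div_nonneg hα (add_nonneg hα hβ), rfl⟩, ⟨sub_nonneg.2 ?_, rfl⟩⟩
  exact div_le_one_of_le₀ (by linarith) (add_nonneg hα hβ)

/-- The mean offspring before the exit `i → q` from `(-∞, i]`, from `i`. -/
lemma LimsupEqTop.exitOffspring_top {i q : ℤ} (h : ω.LimsupEqTop i) (hq : i < q) :
    ∀ m, 0 ≤ (![ω.x i, ω.y i, 0, ω.z i, ω.w i, 0, 0, 0, 0] : Fin 9 → ℝ) m ∧
      ω.exitOffspring i i i q m = ω.exitProb i i i q *
        ENNReal.ofReal ((![ω.x i, ω.y i, 0, ω.z i, ω.w i, 0, 0, 0, 0] : Fin 9 → ℝ) m) := by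
  obtain ⟨⟨hx, hx'⟩, ⟨hy, hy'⟩, ⟨hz, hz'⟩, ⟨hw, hw'⟩⟩ := h.green_mul_return
  have hp : ¬ (i = i - 1 ∧ q = i + 1) := by omega
  refine forall_fin9 ⟨hx, ?_⟩ ⟨hy, ?_⟩ ⟨le_rfl, ?_⟩ ⟨hz, ?_⟩ ⟨hw, ?_⟩ ⟨le_rfl, ?_⟩ ⟨le_rfl, ?_⟩
    ⟨le_rfl, ?_⟩ ⟨le_rfl, ?_⟩
  · rw [exitOffspring_return ω hq i rfl rfl, hx', mul_comm]; rfl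
  · rw [exitOffspring_return ω hq i rfl rfl, hy', mul_comm]; rfl
  · rw [exitOffspring_jump ω hq i rfl rfl rfl, if_neg hp, mul_zero]; simp
  · rw [exitOffspring_return ω hq i rfl rfl, hz', mul_comm]; rfl
  · rw [exitOffspring_return ω hq i rfl rfl, hw', mul_comm]; rfl
  · rw [exitOffspring_jump ω hq i rfl rfl rfl, if_neg hp, mul_zero]; simp
  · rw [exitOffspring_C ω i i i q rfl]; simp
  · rw [exitOffspring_C ω i i i q rfl]; simp
  · rw [exitOffspring_C ω i i i q rfl]; simp

/-- The mean offspring before the exit `i - 1 → i + 1` from `(-∞, i]`, from `i`. -/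
lemma LimsupEqTop.exitOffspring_jump_row {i : ℤ} (h : ω.LimsupEqTop i) :
    ∀ m, 0 ≤ (![ω.x i, ω.y i, ω.s i, ω.z i, ω.w i, 1 - ω.s i, 0, 0, 0] : Fin 9 → ℝ) m ∧
      ω.exitOffspring i i (i - 1) (i + 1) m = ω.exitProb i i (i - 1) (i + 1) *
        ENNReal.ofReal
          ((![ω.x i, ω.y i, ω.s i, ω.z i, ω.w i, 1 - ω.s i, 0, 0, 0] : Fin 9 → ℝ) m) := by
  obtain ⟨⟨hx, hx'⟩, ⟨hy, hy'⟩, ⟨hz, hz'⟩, ⟨hw, hw'⟩⟩ := h.green_mul_return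
  obtain ⟨⟨hs, hs'⟩, ⟨ht, ht'⟩⟩ := h.green_mul_jump
  have hq : i < i + 1 := by omega
  refine forall_fin9 ⟨hx, ?_⟩ ⟨hy, ?_⟩ ⟨hs, ?_⟩ ⟨hz, ?_⟩ ⟨hw, ?_⟩ ⟨ht, ?_⟩ ⟨le_rfl, ?_⟩
    ⟨le_rfl, ?_⟩ ⟨le_rfl, ?_⟩
  · rw [exitOffspring_return ω hq i rfl rfl, hx', mul_comm]; rfl
  · rw [exitOffspring_return ω hq i rfl rfl, hy', mul_comm]; rfl
  · rw [exitOffspring_jump ω hq i rfl rfl rfl, if_pos ⟨rfl, rfl⟩, hs']; rfl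
  · rw [exitOffspring_return ω hq i rfl rfl, hz', mul_comm]; rfl
  · rw [exitOffspring_return ω hq i rfl rfl, hw', mul_comm]; rfl
  · rw [exitOffspring_jump ω hq i rfl rfl rfl, if_pos ⟨rfl, rfl⟩, ht']; rfl
  · rw [exitOffspring_C ω i i _ _ rfl]; simp
  · rw [exitOffspring_C ω i i _ _ rfl]; simp
  · rw [exitOffspring_C ω i i _ _ rfl]; simp

variable (ω) in
/-- The mean offspring of an excursion that lands at `i - 1`. -/
def landedOffspring (i p q : ℤ) (m : Fin 9) : ℝ≥0∞ :=
  ω.exitOffspring i (i - 1) p q m + if startShift m = 1 then ω.walkLaw (i - 1)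
    {X | X ∈ exitVia i p q ∧ X ∈ exitVia (i - 1) (i + preShift m) (i + endShift m)} else 0

lemma landedOffspring_of_start_zero {i p q : ℤ} {m : Fin 9} (hm : startShift m = 0) :
    ω.landedOffspring i p q m = ω.exitOffspring i (i - 1) p q m := by
  rw [landedOffspring, hm]; simp

lemma landedOffspring_C {i p q : ℤ} {m : Fin 9} (hm : startShift m = 1) :
    ω.landedOffspring i p q m = ω.walkLaw (i - 1)
      {X | X ∈ exitVia i p q ∧ X ∈ exitVia (i - 1) (i + preShift m) (i + endShift m)} := by
  rw [landedOffspring, exitOffspring_C ω _ _ _ _ hm, zero_add, if_pos hm]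

variable (ω) in
-- The child of type C that shares the parent's first step has the subtype given by the exit from
-- `(-∞, i - 1]`: subtypes 1 and 2 restart the walk at `i`, subtype 3 ends the parent too.
lemma landedOffspring_C_eq {i p q : ℤ} (hq : i < q) :
    ω.landedOffspring i p q 6 = ENNReal.ofReal (ω.e₁ (i - 1) (i - 1)) * ω.exitProb i i p q ∧
    ω.landedOffspring i p q 7 = ENNReal.ofReal (ω.e₂ (i - 1) (i - 1)) * ω.exitProb i i p q ∧
    ω.landedOffspring i p q 8
      = if p = i - 1 ∧ q = i + 1 then ENNReal.ofReal (ω.e₃ (i - 1) (i - 1)) else 0 := by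
  rw [landedOffspring_C rfl, landedOffspring_C rfl, landedOffspring_C rfl,
    ← exitProb_e₁, ← exitProb_e₂, ← exitProb_e₃]
  have h6 : preShift 6 = -1 ∧ endShift 6 = 0 := ⟨rfl, rfl⟩
  have h7 : preShift 7 = -2 ∧ endShift 7 = 0 := ⟨rfl, rfl⟩
  have h8 : preShift 8 = -1 ∧ endShift 8 = 1 := ⟨rfl, rfl⟩
  rw [h6.1, h6.2, h7.1, h7.2, h8.1, h8.2, add_zero, ← sub_eq_add_neg, ← sub_eq_add_neg,
    measure_exitVia_inter_hit ω hq, measure_exitVia_inter_hit ω hq,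
    measure_exitVia_inter_jump ω hq, sub_add_cancel, show i - 1 - 1 = i - 2 by ring,
    show i - 1 + 2 = i + 1 by ring]
  exact ⟨rfl, rfl, rfl⟩

lemma LimsupEqTop.hitProb_ne_zero {i : ℤ} (h : ω.LimsupEqTop (i - 1))
    (hF : ω.hitProb i (i - 1) ≠ 0) : ω.LimsupEqTop i := by
  refine h.of_hit ?_
  rw [f_eq_hitProb ω (by ring)]
  exact ENNReal.toReal_ne_zero.2 ⟨hF, ω.hitProb_ne_top _ _⟩

/-- The factor `ω_{i+1}(-2)` cancels: `t_i` is the conditional probability, for the walk from `i -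
1` that enters `i`, that the entering step is `i - 1 → i`. -/
lemma LimsupEqTop.t_eq {i : ℤ} (h : ω.LimsupEqTop (i - 1)) (hp : ω.prob (i + 1) (-2) ≠ 0) :
    0 ≤ ω.t i ∧ 0 ≤ 1 - ω.t i ∧
      (ω.e₁ (i - 1) (i - 1) + ω.e₂ (i - 1) (i - 1)) * ω.t i = ω.e₁ (i - 1) (i - 1) := by
  obtain ⟨h1, h2, -⟩ := γ_eq h
  have ha := ω.e₁_nonneg (i - 1) (i - 1)
  have hb := ω.e₂_nonneg (i - 1) (i - 1)
  have ht : ω.t i = ω.e₁ (i - 1) (i - 1) / (ω.e₁ (i - 1) (i - 1) + ω.e₂ (i - 1) (i - 1)) := by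
    rw [t, h1, h2, ← mul_add, mul_div_mul_left _ _ hp]
  rw [ht]
  refine ⟨div_nonneg ha (add_nonneg ha hb), sub_nonneg.2 (div_le_one_of_le₀ (by linarith)
    (add_nonneg ha hb)), ?_⟩
  by_cases h0 : ω.e₁ (i - 1) (i - 1) + ω.e₂ (i - 1) (i - 1) = 0
  · rw [h0, zero_mul]
    linarith
  · rw [mul_div_cancel₀ _ h0]

variable (ω) in
lemma hitProb_pred (i : ℤ) :
    ω.hitProb i (i - 1) = ENNReal.ofReal (ω.e₁ (i - 1) (i - 1) + ω.e₂ (i - 1) (i - 1)) := by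
  have := hitProb_eq_e ω (i := i - 1) le_rfl
  rwa [sub_add_cancel] at this

/-- The mean offspring before the exit `i → q` from `(-∞, i]`, from `i - 1`. -/
lemma LimsupEqTop.landedOffspring_top {i q : ℤ} (h : ω.LimsupEqTop (i - 1)) (hq : i < q)
    (hp : ω.prob (i + 1) (-2) ≠ 0) (hne : ω.exitProb i (i - 1) i q ≠ 0) :
    ∀ m, 0 ≤ (![ω.x i, ω.y i, 0, ω.z i, ω.w i, 0, ω.t i, 1 - ω.t i, 0] : Fin 9 → ℝ) m ∧
      ω.landedOffspring i i q m = ω.exitProb i (i - 1) i q * ENNReal.ofReal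
        ((![ω.x i, ω.y i, 0, ω.z i, ω.w i, 0, ω.t i, 1 - ω.t i, 0] : Fin 9 → ℝ) m) := by
  have hk : ω.exitProb i (i - 1) i q = ω.hitProb i (i - 1) * ω.exitProb i i i q := by
    rw [exitProb_eq_green ω hq, exitProb_eq_green ω hq, green_eq_hitProb_mul, mul_assoc]
  -- An exit from the site `i` shows that `i` is reached from `i - 1`, so the hypothesis holds at
  -- `i` and the formulas for `x_i, y_i, z_i, w_i` are available.
  have hF : ω.hitProb i (i - 1) ≠ 0 := fun h0 => hne (by rw [hk, h0, zero_mul])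
  obtain ⟨⟨hx, hx'⟩, ⟨hy, hy'⟩, ⟨hz, hz'⟩, ⟨hw, hw'⟩⟩ := (h.hitProb_ne_zero hF).green_mul_return
  obtain ⟨ht, ht', ht''⟩ := h.t_eq hp
  have hpq : ¬ (i = i - 1 ∧ q = i + 1) := by omega
  obtain ⟨c6, c7, c8⟩ := ω.landedOffspring_C_eq (p := i) hq
  have ha := ω.e₁_nonneg (i - 1) (i - 1)
  have hb := ω.e₂_nonneg (i - 1) (i - 1)
  have ret : ∀ m, startShift m = 0 → endShift m = 0 → ∀ a : ℝ,
      ω.green i i i * ω.walkLaw i (particleEvent i m) = ENNReal.ofReal a →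
      ω.landedOffspring i i q m = ω.exitProb i (i - 1) i q * ENNReal.ofReal a := by
    intro m hm hm' a ha
    rw [landedOffspring_of_start_zero hm, exitOffspring_return ω hq _ hm hm',
      green_eq_hitProb_mul, hk, ← ha]
    ring
  refine forall_fin9 ⟨hx, ret 0 rfl rfl _ hx'⟩ ⟨hy, ret 1 rfl rfl _ hy'⟩ ⟨le_rfl, ?_⟩
    ⟨hz, ret 3 rfl rfl _ hz'⟩ ⟨hw, ret 4 rfl rfl _ hw'⟩ ⟨le_rfl, ?_⟩ ⟨ht, ?_⟩ ⟨ht', ?_⟩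
    ⟨le_rfl, ?_⟩
  · rw [landedOffspring_of_start_zero rfl, exitOffspring_jump ω hq _ rfl rfl rfl, if_neg hpq]; simp
  · rw [landedOffspring_of_start_zero rfl, exitOffspring_jump ω hq _ rfl rfl rfl, if_neg hpq]; simp
  · rw [c6, hk, hitProb_pred, ← ht'', ENNReal.ofReal_mul (add_nonneg ha hb)]
    show _ = _ * ENNReal.ofReal (ω.t i)
    rw [ht'']
    ring
  · rw [c7, hk, hitProb_pred, show ω.e₂ (i - 1) (i - 1)
      = (ω.e₁ (i - 1) (i - 1) + ω.e₂ (i - 1) (i - 1)) * (1 - ω.t i) by linarith,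
      ENNReal.ofReal_mul (add_nonneg ha hb)]
    show _ = _ * ENNReal.ofReal (1 - ω.t i)
    rw [show ω.e₁ (i - 1) (i - 1)
      + (ω.e₁ (i - 1) (i - 1) + ω.e₂ (i - 1) (i - 1)) * (1 - ω.t i)
      = ω.e₁ (i - 1) (i - 1) + ω.e₂ (i - 1) (i - 1) by linarith]
    ring
  · rw [c8, if_neg hpq]; simp

/-- From `i - 1`, an exit by `i - 1 → i + 1` occurs either before any visit to `i` or after one; `1
- v_i` and `v_i` are the conditional probabilities of the two cases. -/
lemma LimsupEqTop.v_eq {i : ℤ} (h : ω.LimsupEqTop (i - 1)) (hp : ω.prob (i + 1) (-2) ≠ 0)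
    (hne : ω.e₂ i (i - 1) ≠ 0) :
    0 ≤ ω.v i ∧ 0 ≤ 1 - ω.v i ∧ ω.e₂ i (i - 1) * (1 - ω.v i) = ω.e₃ (i - 1) (i - 1) ∧
      ω.e₂ i (i - 1) * ω.v i
        = (ω.e₁ (i - 1) (i - 1) + ω.e₂ (i - 1) (i - 1)) * ω.e₂ i i := by
  obtain ⟨-, -, h3⟩ := γ_eq h
  obtain ⟨-, hβ, -⟩ := Environment.β_eq (ω := ω) (i := i + 1)
    fun _ => by rwa [show i + 1 - 2 = i - 1 by ring]
  rw [show i + 1 - 2 = i - 1 by ring, add_sub_cancel_right] at hβ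
  have hv : ω.v i = 1 - ω.e₃ (i - 1) (i - 1) / ω.e₂ i (i - 1) := by
    rw [v, h3, hβ, mul_div_mul_left _ _ hp]
  have hk2 : 0 < ω.e₂ i (i - 1) := lt_of_le_of_ne (ω.e₂_nonneg _ _) hne.symm
  have h1v : ω.e₂ i (i - 1) * (1 - ω.v i) = ω.e₃ (i - 1) (i - 1) := by
    rw [hv, sub_sub_cancel, mul_div_cancel₀ _ hne]
  -- The exit probabilities from `(-∞, i]` and those from `(-∞, i - 1]` add up to one, and exits
  -- from the site `i` go through a visit to `i`; comparing the sums leaves this identity.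
  have hvv : ω.e₂ i (i - 1) * ω.v i
        = (ω.e₁ (i - 1) (i - 1) + ω.e₂ (i - 1) (i - 1)) * ω.e₂ i i := by
    have e1 := h.e_add (L := i) (by omega)
    have e2 := h.e_add le_rfl
    obtain ⟨f1, f3⟩ := ω.e_eq_f_mul i (i - 1)
    rw [f_eq_e ω (by ring) le_rfl] at f1 f3
    by_cases hF : ω.hitProb i (i - 1) = 0
    · rw [hitProb_pred, ENNReal.ofReal_eq_zero] at hF
      have ha := ω.e₁_nonneg (i - 1) (i - 1)
      have hb := ω.e₂_nonneg (i - 1) (i - 1)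
      have h0 : ω.e₁ (i - 1) (i - 1) + ω.e₂ (i - 1) (i - 1) = 0 := by linarith
      rw [h0, zero_mul] at f1 f3 ⊢
      linarith
    · have e3 := (h.hitProb_ne_zero hF).e_add le_rfl
      linear_combination -h1v + e1 - e2 - f1 - f3 -
        (ω.e₁ (i - 1) (i - 1) + ω.e₂ (i - 1) (i - 1)) * e3
  refine ⟨?_, ?_, h1v, hvv⟩
  · refine nonneg_of_mul_nonneg_right (a := ω.e₂ i (i - 1)) ?_ hk2
    rw [hvv]
    exact mul_nonneg (add_nonneg (ω.e₁_nonneg _ _) (ω.e₂_nonneg _ _)) (ω.e₂_nonneg _ _)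
  · refine nonneg_of_mul_nonneg_right (a := ω.e₂ i (i - 1)) ?_ hk2
    rw [h1v]
    exact ω.e₃_nonneg _ _

/-- The mean offspring before the exit `i - 1 → i + 1` from `(-∞, i]`, from `i - 1`. -/
lemma LimsupEqTop.landedOffspring_jump {i : ℤ} (h : ω.LimsupEqTop (i - 1))
    (hp : ω.prob (i + 1) (-2) ≠ 0) (hne : ω.exitProb i (i - 1) (i - 1) (i + 1) ≠ 0) :
    ∀ m, 0 ≤ (![ω.x i * ω.v i, ω.y i * ω.v i, ω.s i * ω.v i, ω.z i * ω.v i, ω.w i * ω.v i,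
        (1 - ω.s i) * ω.v i, ω.t i * ω.v i, (1 - ω.t i) * ω.v i, 1 - ω.v i] : Fin 9 → ℝ) m ∧
      ω.landedOffspring i (i - 1) (i + 1) m = ω.exitProb i (i - 1) (i - 1) (i + 1) *
        ENNReal.ofReal ((![ω.x i * ω.v i, ω.y i * ω.v i, ω.s i * ω.v i, ω.z i * ω.v i,
          ω.w i * ω.v i, (1 - ω.s i) * ω.v i, ω.t i * ω.v i, (1 - ω.t i) * ω.v i,
          1 - ω.v i] : Fin 9 → ℝ) m) := by
  have hq : i < i + 1 := by omega
  have hne' : ω.e₂ i (i - 1) ≠ 0 := ENNReal.toReal_ne_zero.2 ⟨hne, ω.exitProb_ne_top _ _ _ _⟩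
  obtain ⟨hv, hv', hv'', hv3⟩ := h.v_eq hp hne'
  obtain ⟨ht, ht', ht''⟩ := h.t_eq hp
  obtain ⟨c6, c7, c8⟩ := ω.landedOffspring_C_eq (p := i - 1) hq
  have ha := ω.e₁_nonneg (i - 1) (i - 1)
  have hb := ω.e₂_nonneg (i - 1) (i - 1)
  have hk2 := ω.e₂_nonneg i (i - 1)
  have h22 := ω.e₂_nonneg i i
  have d8 : ω.landedOffspring i (i - 1) (i + 1) 8 = ω.exitProb i (i - 1) (i - 1) (i + 1) *
      ENNReal.ofReal (1 - ω.v i) := by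
    rw [c8, if_pos ⟨rfl, rfl⟩, exitProb_e₂, ← ENNReal.ofReal_mul hk2, hv'']
  have d6 : ω.landedOffspring i (i - 1) (i + 1) 6 = ω.exitProb i (i - 1) (i - 1) (i + 1) *
      ENNReal.ofReal (ω.t i * ω.v i) := by
    rw [c6, exitProb_e₂, exitProb_e₂, ← ENNReal.ofReal_mul hk2, ← ENNReal.ofReal_mul ha]
    congr 1
    linear_combination (-ω.t i) * hv3 - ω.e₂ i i * ht''
  have d7 : ω.landedOffspring i (i - 1) (i + 1) 7 = ω.exitProb i (i - 1) (i - 1) (i + 1) *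
      ENNReal.ofReal ((1 - ω.t i) * ω.v i) := by
    rw [c7, exitProb_e₂, exitProb_e₂, ← ENNReal.ofReal_mul hk2, ← ENNReal.ofReal_mul hb]
    congr 1
    linear_combination (-(1 - ω.t i)) * hv3 + ω.e₂ i i * ht''
  -- If `i` cannot be entered from `i - 1`, then `v_i = 0`, and this factor annihilates `x_i, y_i,
  -- s_i, z_i, w_i`, which need not have a meaning in that case.
  by_cases hF : ω.hitProb i (i - 1) = 0
  · have hv0 : ω.v i = 0 := by
      rw [hitProb_pred, ENNReal.ofReal_eq_zero] at hF
      rw [show ω.e₁ (i - 1) (i - 1) + ω.e₂ (i - 1) (i - 1) = 0 by linarith, zero_mul] at hv3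
      exact (mul_eq_zero.1 hv3).resolve_left hne'
    have hg : ω.green i (i - 1) i = 0 := by rw [green_eq_hitProb_mul, hF, zero_mul]
    have z : ∀ m, startShift m = 0 → ∀ a : ℝ, 0 ≤ a * ω.v i ∧
        ω.landedOffspring i (i - 1) (i + 1) m
          = ω.exitProb i (i - 1) (i - 1) (i + 1) * ENNReal.ofReal (a * ω.v i) := by
      intro m hm a
      rw [landedOffspring_of_start_zero hm, exitOffspring_eq ω hq _ hm, hg, hv0]
      simp
    exact forall_fin9 (z 0 rfl _) (z 1 rfl _) (z 2 rfl _) (z 3 rfl _) (z 4 rfl _) (z 5 rfl _)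
      ⟨mul_nonneg ht hv, d6⟩ ⟨mul_nonneg ht' hv, d7⟩ ⟨hv', d8⟩
  · have hi := h.hitProb_ne_zero hF
    obtain ⟨⟨hx, hx'⟩, ⟨hy, hy'⟩, ⟨hz, hz'⟩, ⟨hw, hw'⟩⟩ := hi.green_mul_return
    obtain ⟨⟨hs, hs'⟩, ⟨hr, hr'⟩⟩ := hi.green_mul_jump
    have hk : ω.hitProb i (i - 1) * ω.exitProb i i (i - 1) (i + 1)
        = ω.exitProb i (i - 1) (i - 1) (i + 1) * ENNReal.ofReal (ω.v i) := by
      rw [hitProb_pred, exitProb_e₂, exitProb_e₂, ← ENNReal.ofReal_mul hk2, hv3,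
        ← ENNReal.ofReal_mul (add_nonneg ha hb)]
    have ret : ∀ m, startShift m = 0 → endShift m = 0 → ∀ a : ℝ, 0 ≤ a →
        ω.green i i i * ω.walkLaw i (particleEvent i m) = ENNReal.ofReal a →
        0 ≤ a * ω.v i ∧ ω.landedOffspring i (i - 1) (i + 1) m
          = ω.exitProb i (i - 1) (i - 1) (i + 1) * ENNReal.ofReal (a * ω.v i) := by
      intro m hm hm' a ha h
      refine ⟨mul_nonneg ha hv, ?_⟩
      rw [landedOffspring_of_start_zero hm, exitOffspring_return ω hq _ hm hm',
        green_eq_hitProb_mul, ENNReal.ofReal_mul ha, mul_left_comm, ← hk, ← h]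
      ring
    have jump : ∀ m, startShift m = 0 → endShift m = 1 → preShift m = -1 → ∀ a : ℝ, 0 ≤ a →
        ω.green i i i * ω.walkLaw i (particleEvent i m)
          = ω.exitProb i i (i - 1) (i + 1) * ENNReal.ofReal a →
        0 ≤ a * ω.v i ∧ ω.landedOffspring i (i - 1) (i + 1) m
          = ω.exitProb i (i - 1) (i - 1) (i + 1) * ENNReal.ofReal (a * ω.v i) := by
      intro m hm hm' hm'' a ha h
      refine ⟨mul_nonneg ha hv, ?_⟩
      rw [landedOffspring_of_start_zero hm, exitOffspring_jump ω hq _ hm hm' hm'',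
        if_pos ⟨rfl, rfl⟩, green_eq_hitProb_mul, ENNReal.ofReal_mul ha, mul_left_comm, ← hk,
        mul_assoc, h]
      ring
    exact forall_fin9 (ret 0 rfl rfl _ hx hx') (ret 1 rfl rfl _ hy hy')
      (jump 2 rfl rfl rfl _ hs hs') (ret 3 rfl rfl _ hz hz') (ret 4 rfl rfl _ hw hw')
      (jump 5 rfl rfl rfl _ hr hr') ⟨mul_nonneg ht hv, d6⟩ ⟨mul_nonneg ht' hv, d7⟩ ⟨hv', d8⟩

end Environment

/-! ### The mean offspring of the particle types -/

namespace Environment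

variable {ω : Environment}

/-- The probability of the parent is its step probability times its exit probability; it is positive
and finite, so it cancels from the unconditioned identity. -/
lemma meanOffspring_eq_of_row {i : ℤ} {l m : Fin 9} {b p q : ℤ} {r : ℝ}
    (hb : i + 1 + landShift l = b) (hp : i + 1 + preShift l = p) (hq : i + 1 + endShift l = q)
    (hpos : ω.walkLaw (i + 1 + startShift l) (particleEvent (i + 1) l) ≠ 0) (hr : 0 ≤ r)
    (hT : ω.exitOffspring i b p q m + ω.simultaneous i l m
      = ω.exitProb i b p q * ENNReal.ofReal r) :
    ω.meanOffspring i l m ≠ ∞ ∧ (ω.meanOffspring i l m).toReal = r := by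
  have h1 := ω.meanOffspring_mul_eq i l m
  have h2 := ω.measure_particleEvent (i + 1) l
  rw [hb, hp, hq, hT, ← mul_assoc] at h1
  rw [hb, hp, hq, add_sub_cancel_right] at h2
  rw [← h2, mul_comm] at h1
  have h3 := (ENNReal.mul_right_inj hpos (measure_ne_top _ _)).1 h1
  rw [h3]
  exact ⟨ENNReal.ofReal_ne_top, ENNReal.toReal_ofReal hr⟩

lemma simultaneous_eq_zero {i : ℤ} {l m : Fin 9}
    (h : ¬ (1 + startShift l = startShift m ∧ 1 + landShift l = landShift m)) :
    ω.simultaneous i l m = 0 := by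
  rw [simultaneous]
  exact measure_mono_null (fun X hX => h hX.2.1) measure_empty

/-- A parent at `i + 1` and a child at `i` share their first step only when it is `i + 1 → i - 1`,
that is, for types B and C respectively. -/
lemma exitOffspring_add_simultaneous {i p q : ℤ} {l : Fin 9} (hs : startShift l = 0)
    (hl : landShift l = -2) (hp : i + 1 + preShift l = p) (hq : i + 1 + endShift l = q)
    (m : Fin 9) :
    ω.exitOffspring i (i - 1) p q m + ω.simultaneous i l m = ω.landedOffspring i p q m := by
  rw [landedOffspring]
  congr 1
  split_ifs with hm
  · have hm' : landShift m = -1 := by revert hm; revert m; decide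
    rw [simultaneous, hs, hl, hp, hq, hm, hm', show i + 1 + -2 = i - 1 by ring]
    simp
  · refine simultaneous_eq_zero fun h => hm ?_
    rw [← h.1, hs, add_zero]

/-- The mean number of type-`m` particles born to a type-`l` particle. -/
theorem meanOffspring_eq (i : ℤ) (l : Fin 9) (hlim : ω.LimsupEqTop (i + 1 + startShift l))
    (hpos : ω.walkLaw (i + 1 + startShift l) (particleEvent (i + 1) l) ≠ 0) (m : Fin 9) :
    ω.meanOffspring i l m ≠ ∞ ∧ (ω.meanOffspring i l m).toReal = ω.Q i l m := by
  have hP := ω.measure_particleEvent (i + 1) l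
  have hP' := hpos
  rw [hP, add_sub_cancel_right] at hP'
  have hprob : ω.prob (i + 1 + startShift l) (landShift l - startShift l) ≠ 0 := by
    intro h0
    simp [h0] at hP'
  have hexit := right_ne_zero_of_mul hP'
  have hland : ω.LimsupEqTop (i + 1 + landShift l) := hlim.of_step (by
    rwa [show i + 1 + landShift l - (i + 1 + startShift l) = landShift l - startShift l by ring])
  -- A parent of type A or C lands at `i`, while every child must land below `i`.
  have hsim : landShift l = -1 → ω.simultaneous i l m = 0 := fun hl =>
    simultaneous_eq_zero fun h => by have := landShift_le m; omega
  have key : ∀ {p q : ℤ} {r : ℝ}, landShift l = -1 → i + 1 + preShift l = p →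
      i + 1 + endShift l = q →
      (0 ≤ r ∧ ω.exitOffspring i i p q m = ω.exitProb i i p q * ENNReal.ofReal r) →
      ω.meanOffspring i l m ≠ ∞ ∧ (ω.meanOffspring i l m).toReal = r := by
    intro p q r hl hp hq h
    refine meanOffspring_eq_of_row (b := i) (by omega) hp hq hpos h.1 ?_
    rw [hsim hl, add_zero, h.2]
  have keyB : ∀ {p q : ℤ} {r : ℝ}, startShift l = 0 → landShift l = -2 → i + 1 + preShift l = p →
      i + 1 + endShift l = q →
      (0 ≤ r ∧ ω.landedOffspring i p q m = ω.exitProb i (i - 1) p q * ENNReal.ofReal r) →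
      ω.meanOffspring i l m ≠ ∞ ∧ (ω.meanOffspring i l m).toReal = r := by
    intro p q r hs hl hp hq h
    refine meanOffspring_eq_of_row (b := i - 1) (by omega) hp hq hpos h.1 ?_
    rw [exitOffspring_add_simultaneous hs hl hp hq, h.2]
  have hi : landShift l = -1 → ω.LimsupEqTop i := fun hl => by
    rwa [hl, add_neg_cancel_right] at hland
  have hi' : landShift l = -2 → ω.LimsupEqTop (i - 1) := fun hl => by
    rwa [hl, show i + 1 + -2 = i - 1 by ring] at hland
  have hprob' : startShift l = 0 → landShift l = -2 → ω.prob (i + 1) (-2) ≠ 0 := fun hs hl => by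
    simpa [hs, hl] using hprob
  have hexit' : ∀ {p q : ℤ}, landShift l = -2 → i + 1 + preShift l = p →
      i + 1 + endShift l = q → ω.exitProb i (i - 1) p q ≠ 0 := fun {p q} hl hp hq => by
    rwa [hl, hp, hq, show i + 1 + -2 = i - 1 by ring] at hexit
  clear hP hP' hexit hland hsim hlim hpos hprob
  have p1 : i + 1 + -1 = i := by ring
  have p2 : i + 1 + -2 = i - 1 := by ring
  have q1 : i + 1 + 0 = i + 1 := by ring
  have q2 : i + 1 + 1 = i + 2 := by ring
  have lt1 : i < i + 1 := by omega
  have lt2 : i < i + 2 := by omega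
  revert l
  refine forall_fin9 ?_ ?_ ?_ ?_ ?_ ?_ ?_ ?_ ?_ <;> intro key keyB hi hi' hprob' hexit'
  · exact key rfl p1 q1 ((hi rfl).exitOffspring_top lt1 m)
  · exact key rfl p2 q1 ((hi rfl).exitOffspring_jump_row m)
  · exact key rfl p1 q2 ((hi rfl).exitOffspring_top lt2 m)
  · exact keyB rfl rfl p1 q1 ((hi' rfl).landedOffspring_top lt1 (hprob' rfl rfl)
      (hexit' rfl p1 q1) m)
  · exact keyB rfl rfl p2 q1 ((hi' rfl).landedOffspring_jump (hprob' rfl rfl)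
      (hexit' rfl p2 q1) m)
  · exact keyB rfl rfl p1 q2 ((hi' rfl).landedOffspring_top lt2 (hprob' rfl rfl)
      (hexit' rfl p1 q2) m)
  · exact key rfl p1 q1 ((hi rfl).exitOffspring_top lt1 m)
  · exact key rfl p2 q1 ((hi rfl).exitOffspring_jump_row m)
  · exact key rfl p1 q2 ((hi rfl).exitOffspring_top lt2 m)

end Environment

/-! ### The genealogy of the excursions of a path -/

namespace WalkPath

lemma IsExcursion.congr {X Y : ℕ → ℤ} {i : ℤ} {m : Fin 9} {k r : ℕ}
    (h : ∀ j ≤ r + 1, X j = Y j) : IsExcursion X i m k r ↔ IsExcursion Y i m k r := by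
  refine and_congr_right fun hk => ?_
  rw [h k (by omega), h (k + 1) (by omega), h r (by omega), h (r + 1) le_rfl]
  refine and_congr_right fun _ => and_congr_right fun _ => and_congr_left fun _ => ?_
  exact forall_congr' fun j => imp_congr_right fun _ => forall_congr' fun hj => by
    rw [h j (by omega)]

lemma isExcursion_shift {X : ℕ → ℤ} {i : ℤ} {m : Fin 9} {k r : ℕ} :
    IsExcursion (shift k X) i m 0 r ↔ IsExcursion X i m k (r + k) := by
  simp only [IsExcursion, shift_apply, Nat.zero_add]
  rw [show r + 1 + k = r + k + 1 by omega, add_comm 1 k]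
  refine and_congr (by omega) (and_congr_right fun _ => and_congr_right fun _ =>
    and_congr_left fun _ => ⟨fun h j hj hjr => ?_, fun h j hj hjr => h (j + k) (by omega)
      (by omega)⟩)
  have := h (j - k) (by omega) (by omega)
  rwa [Nat.sub_add_cancel hj.le] at this

lemma type_unique : ∀ {l l' : Fin 9}, startShift l = startShift l' → landShift l = landShift l' →
    preShift l = preShift l' → endShift l = endShift l' → l = l' := by decide

lemma IsExcursion.type_unique {X : ℕ → ℤ} {i : ℤ} {l l' : Fin 9} {k r r' : ℕ}
    (h : IsExcursion X i l k r) (h' : IsExcursion X i l' k r') : l = l' := by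
  obtain rfl := h.end_unique h'
  obtain ⟨-, h1, h2, -, h3, h4⟩ := h
  obtain ⟨-, h1', h2', -, h3', h4'⟩ := h'
  exact WalkPath.type_unique (by omega) (by omega) (by omega) (by omega)

/-- Steps of length at most two cross the level in three ways downwards and three ways upwards; the
nine combinations are the nine types. -/
lemma exists_isExcursion {X : ℕ → ℤ} (hv : ValidSteps X) {a : ℤ} {k r : ℕ} (hkr : k < r)
    (hk : a ≤ X k) (hj : ∀ j, k < j → j ≤ r → X j ≤ a - 1) (hr : a ≤ X (r + 1)) :
    ∃ l, IsExcursion X a l k r := by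
  have h1 := hj (k + 1) (by omega) hkr
  have h2 := hj r hkr le_rfl
  have h3 := hv k
  have h4 := hv r
  have hs : ∃ c : Fin 3, X k = a + (![0, 0, 1] : Fin 3 → ℤ) c ∧
      X (k + 1) = a + (![-1, -2, -1] : Fin 3 → ℤ) c := by
    have : (X k = a ∧ X (k + 1) = a - 1) ∨ (X k = a ∧ X (k + 1) = a - 2) ∨
      (X k = a + 1 ∧ X (k + 1) = a - 1) := by omega
    rcases this with h | h | h
    · exact ⟨0, by simpa using h.1, by simpa [← sub_eq_add_neg] using h.2⟩
    · exact ⟨1, by simpa using h.1, by simpa [← sub_eq_add_neg] using h.2⟩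
    · exact ⟨2, by simpa using h.1, by simpa [← sub_eq_add_neg] using h.2⟩
  have he : ∃ c : Fin 3, X r = a + (![-1, -2, -1] : Fin 3 → ℤ) c ∧
      X (r + 1) = a + (![0, 0, 1] : Fin 3 → ℤ) c := by
    have : (X r = a - 1 ∧ X (r + 1) = a) ∨ (X r = a - 2 ∧ X (r + 1) = a) ∨
      (X r = a - 1 ∧ X (r + 1) = a + 1) := by omega
    rcases this with h | h | h
    · exact ⟨0, by simpa [← sub_eq_add_neg] using h.1, by simpa using h.2⟩
    · exact ⟨1, by simpa [← sub_eq_add_neg] using h.1, by simpa using h.2⟩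
    · exact ⟨2, by simpa [← sub_eq_add_neg] using h.1, by simpa using h.2⟩
  obtain ⟨c, hc1, hc2⟩ := hs
  obtain ⟨d, hd1, hd2⟩ := he
  have hl : ∀ c d : Fin 3, ∃ l : Fin 9, startShift l = (![0, 0, 1] : Fin 3 → ℤ) c ∧
      landShift l = (![-1, -2, -1] : Fin 3 → ℤ) c ∧
      preShift l = (![-1, -2, -1] : Fin 3 → ℤ) d ∧
      endShift l = (![0, 0, 1] : Fin 3 → ℤ) d := by decide
  obtain ⟨l, l1, l2, l3, l4⟩ := hl c d
  exact ⟨l, hkr, by rw [l1, hc1], by rw [l2, hc2], hj, by rw [l3, hd1], by rw [l4, hd2]⟩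

/-- Every excursion at `i` of a path that starts above `i` is contained in an excursion at
`i + 1`. -/
lemma exists_parent {X : ℕ → ℤ} (hv : ValidSteps X) (hu : UnboundedAbove X) {i : ℤ}
    (h0 : i + 1 ≤ X 0) {m : Fin 9} {q : ℕ} (hq : shift q X ∈ particleEvent i m) :
    ∃ k l r, IsExcursion X (i + 1) l k r ∧ k ≤ q ∧ q ≤ r := by
  have h1 : X (q + 1) = i + landShift m := by
    have := (mem_particleEvent.1 hq).2.1
    rwa [shift_apply, add_comm] at this
  have h2 := landShift_le m
  obtain ⟨k, hk, hk1, hk2⟩ := exists_last_ge h0 (r := q + 1) (by omega)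
  obtain ⟨r, hr, hr'⟩ := exists_exit ((unboundedAbove_shift_iff (k + 1)).2 hu) (L := i)
    (by have := hk2 (k + 1) (by omega) (by omega); simpa using this)
  have hr2 : i < X (r + (k + 1) + 1) := by
    rw [shift_apply] at hr'
    rwa [show r + (k + 1) + 1 = r + 1 + (k + 1) by omega]
  have hr3 : ∀ j, k < j → j ≤ r + (k + 1) → X j ≤ i + 1 - 1 := fun j hj hjr => by
    have := hr (j - (k + 1)) (by omega)
    rw [shift_apply, Nat.sub_add_cancel (by omega)] at this
    omega
  obtain ⟨l, hl⟩ := exists_isExcursion hv (a := i + 1) (k := k) (r := r + (k + 1)) (by omega)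
    hk1 hr3 (by omega)
  refine ⟨k, l, _, hl, by omega, ?_⟩
  by_contra hn
  have := hk2 (r + (k + 1) + 1) (by omega) (by omega)
  omega

/-- The excursions at `i` before the exit from `(-∞, 0]` are the offspring of the excursions at
`i + 1`. -/
lemma excursionsBelow_eq_tsum_offspring {X : ℕ → ℤ} (hv : ValidSteps X) (hu : UnboundedAbove X)
    {i : ℤ} (h0 : i + 1 ≤ X 0) (m : Fin 9) :
    excursionsBelow 0 i m X = ∑' k, ∑ l, ind (Below 0 k X ∧ shift k X ∈ particleEvent (i + 1) l) *
      (offspringCount i l m (shift k X) : ℝ≥0∞) := by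
  have h1 : ∀ k l, ind (Below 0 k X ∧ shift k X ∈ particleEvent (i + 1) l) *
      (offspringCount i l m (shift k X) : ℝ≥0∞)
      = ∑' q, ind (Below 0 k X ∧ ∃ r, IsExcursion X (i + 1) l k r ∧ k ≤ q ∧ q ≤ r ∧
          shift q X ∈ particleEvent i m) := by
    intro k l
    by_cases h : Below 0 k X ∧ shift k X ∈ particleEvent (i + 1) l
    · obtain ⟨hb, r, hr⟩ := h
      rw [ind_of ⟨hb, r, hr⟩, one_mul, offspringCount_eq_tsum hr]
      have hr' := isExcursion_shift.1 hr
      have h2 : ∀ j, ind (j ≤ r ∧ shift j (shift k X) ∈ particleEvent i m)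
          = ind (j + k ≤ r + k ∧ shift (j + k) X ∈ particleEvent i m) := fun j =>
        ind_congr (by rw [shift_shift, Nat.add_le_add_iff_right])
      simp_rw [h2]
      rw [tsum_ind_add (fun q => q ≤ r + k ∧ shift q X ∈ particleEvent i m)]
      refine tsum_congr fun q => ind_congr ⟨fun h => ⟨hb, _, hr', h⟩, ?_⟩
      rintro ⟨-, r₂, h3, h4⟩
      obtain rfl := h3.end_unique hr'
      exact h4
    · rw [ind_of_not h, zero_mul, eq_comm, ENNReal.tsum_eq_zero]
      exact fun q => ind_of_not fun ⟨hb, r, hr, _⟩ =>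
        h ⟨hb, shift_mem_particleEvent.2 ⟨r, hr⟩⟩
  simp_rw [h1, ← tsum_fintype (L := .unconditional _)]
  rw [← ENNReal.tsum_prod (f := fun (k : ℕ) (l : Fin 9) => ∑' q, ind (Below 0 k X ∧
    ∃ r, IsExcursion X (i + 1) l k r ∧ k ≤ q ∧ q ≤ r ∧ shift q X ∈ particleEvent i m)),
    ENNReal.tsum_comm, excursionsBelow]
  refine tsum_congr fun q => ?_
  rw [tsum_ind]
  · refine ind_congr ⟨fun h => ?_, ?_⟩
    · obtain ⟨k, l, r, hr, hkq, hqr⟩ := exists_parent hv hu h0 h.2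
      exact ⟨(k, l), h.1.mono hkq, r, hr, hkq, hqr, h.2⟩
    · rintro ⟨⟨k, l⟩, hb, r, hr, hkq, hqr, h⟩
      refine ⟨fun j hj => ?_, h⟩
      rcases Nat.lt_or_ge k j with hkj | hkj
      · have h1 := hr.2.2.2.1 j hkj (hj.trans hqr)
        have h2 := (mem_particleEvent.1 h).1
        have h3 := hb k le_rfl
        have h4 := hr.2.1
        have h5 := startShift_nonneg l
        simp only at h1 h3 h4
        omega
      · exact hb j hkj
  · rintro ⟨k, l⟩ ⟨k', l'⟩ ⟨hb, r, hr, hkq, hqr, h⟩ ⟨hb', r', hr', hkq', hqr', -⟩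
    simp only at hb hr hkq hb' hr' hkq'
    have hs := startShift_nonneg l
    have hs' := startShift_nonneg l'
    have hk : k = k' := by
      rcases lt_trichotomy k k' with h1 | h1 | h1
      · have := hr.2.2.2.1 k' h1 (by omega)
        have := hr'.2.1
        omega
      · exact h1
      · have := hr'.2.2.2.1 k h1 (by omega)
        have := hr.2.1
        omega
    subst hk
    rw [hr.type_unique hr']

/-! ### Splitting the counts at an excursion -/

open Classical in
/-- The number of type-`l` excursions at `a` that end by the time `k`. -/
def pastCount (k : ℕ) (a : ℤ) (l : Fin 9) (X : ℕ → ℤ) : ℕ :=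
  ∑ q ∈ Finset.range k, if ∃ r < k, IsExcursion X a l q r then 1 else 0

/-- The bound `r < k` puts the last step, which ends at time `r + 1`, into the history. -/
lemma determinedBy_pastCount (k : ℕ) (a : ℤ) (l : Fin 9) : DeterminedBy k (pastCount k a l) := by
  intro X Y h
  classical
  refine Finset.sum_congr rfl fun q _ => ?_
  have : (∃ r < k, IsExcursion X a l q r) ↔ ∃ r < k, IsExcursion Y a l q r :=
    exists_congr fun r => and_congr_right fun hr => IsExcursion.congr fun j hj => h j (by omega)
  simp only [this]

lemma pastCount_eq_tsum (k : ℕ) (a : ℤ) (l : Fin 9) (X : ℕ → ℤ) :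
    (pastCount k a l X : ℝ≥0∞) = ∑' q, ind (∃ r < k, IsExcursion X a l q r) := by
  classical
  rw [pastCount, Nat.cast_sum, tsum_eq_sum (s := Finset.range k)]
  · refine Finset.sum_congr rfl fun q _ => ?_
    simp [ind]
  · intro q hq
    refine ind_of_not fun ⟨r, hr, h⟩ => hq ?_
    have := h.1
    exact Finset.mem_range.2 (by omega)

/-- The excursions at `a` are those before, at and after an excursion at `a`. -/
lemma excursionsBelow_split {X : ℕ → ℤ} {a : ℤ} (ha : a ≤ 0) {l : Fin 9} {k r : ℕ}
    (hb : Below 0 k X) (hr : IsExcursion X a l k r) (l' : Fin 9) :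
    excursionsBelow 0 a l' X = pastCount k a l' X + ind (l = l')
      + excursionsBelow 0 a l' (shift (r + 1) X) := by
  have hbr : Below 0 r X := fun j hj => by
    rcases Nat.lt_or_ge k j with h | h
    · have := hr.2.2.2.1 j h hj
      omega
    · exact hb j h
  have hXk : a ≤ X k := by
    have := hr.2.1
    have := startShift_nonneg l
    omega
  have h2 : ind (l = l') = ∑' q, ind (q = k ∧ l = l') := by
    rw [tsum_ind fun i j h h' => h.1.trans h'.1.symm]
    exact ind_congr ⟨fun h => ⟨k, rfl, h⟩, fun ⟨_, _, h⟩ => h⟩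
  have h3 : excursionsBelow 0 a l' (shift (r + 1) X)
      = ∑' q, ind (r + 1 ≤ q ∧ Below 0 q X ∧ shift q X ∈ particleEvent a l') := by
    rw [← tsum_ind_add (fun q => Below 0 q X ∧ shift q X ∈ particleEvent a l'), excursionsBelow]
    refine tsum_congr fun j => ind_congr ?_
    rw [shift_shift]
    refine and_congr_left fun _ => ⟨fun h i hi => ?_, fun h i hi => h (i + (r + 1)) (by omega)⟩
    rcases Nat.lt_or_ge r i with hri | hri
    · have := h (i - (r + 1)) (by omega)
      rwa [shift_apply, Nat.sub_add_cancel hri] at this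
    · exact hbr i hri
  rw [pastCount_eq_tsum, h2, h3, ← ENNReal.tsum_add, ← ENNReal.tsum_add, excursionsBelow]
  refine tsum_congr fun q => ?_
  rw [← ind_or, ← ind_or]
  · refine ind_congr ?_
    rw [shift_mem_particleEvent]
    constructor
    · rintro ⟨hbq, r', h⟩
      rcases lt_trichotomy q k with hq | rfl | hq
      · refine Or.inl (Or.inl ⟨r', ?_, h⟩)
        by_contra hn
        have := h.2.2.2.1 k hq (by omega)
        omega
      · exact Or.inl (Or.inr ⟨rfl, hr.type_unique h⟩)
      · refine Or.inr ⟨?_, hbq, r', h⟩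
        by_contra hn
        have h1 := hr.2.2.2.1 q hq (by omega)
        have := h.2.1
        have := startShift_nonneg l'
        omega
    · rintro ((⟨r', hr', h⟩ | ⟨rfl, rfl⟩) | ⟨-, h⟩)
      · exact ⟨hb.mono (by have := h.1; omega), r', h⟩
      · exact ⟨hb, r, hr⟩
      · exact h
  · rintro ⟨⟨r', hr', h⟩ | ⟨rfl, -⟩, h', -⟩
    · have := h.1
      have := hr.1
      omega
    · have := hr.1
      omega
  · rintro ⟨⟨r', hr', h⟩, rfl, -⟩
    have := h.1
    omega

/-! ### Populations as numbers of excursions -/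

lemma le_ladderTime_iff {X : ℕ → ℤ} {r : ℕ} :
    ((r + 1 : ℕ) : ℕ∞) ≤ ladderTime X ↔ Below 0 r X := by
  rw [ladderTime, le_iInf₂_iff]
  constructor
  · intro h j hj
    by_contra hn
    have := Nat.cast_le.1 (h j (by omega))
    omega
  · intro h n hn
    refine Nat.cast_le.2 ?_
    by_contra hr
    have := h n (by omega)
    omega

/-- An excursion at `i ≤ 0` that starts before `T_1` remains nonpositive up to its last step, so it
is also complete by time `T_1`; counting starts is enough. -/
lemma population_of_nonpos {X : ℕ → ℤ} {i : ℤ} (hi : i ≤ 0) (m : Fin 9) :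
    (population X i m : ℝ≥0∞) = excursionsBelow 0 i m X := by
  rw [population, if_pos hi, excursionCount, encard_eq_tsum_ind, ENNReal.tsum_prod',
    excursionsBelow]
  refine tsum_congr fun k => ?_
  rw [tsum_ind]
  · refine ind_congr ?_
    rw [shift_mem_particleEvent]
    constructor
    · rintro ⟨r, h1, h2⟩
      exact ⟨(le_ladderTime_iff.1 h1).mono h2.1.le, r, h2⟩
    · rintro ⟨hb, r, h⟩
      refine ⟨r, le_ladderTime_iff.2 fun j hj => ?_, h⟩
      rcases Nat.lt_or_ge k j with hkj | hkj
      · have := h.2.2.2.1 j hkj hj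
        omega
      · exact hb j hkj
  · rintro r r' ⟨-, h⟩ ⟨-, h'⟩
    exact h.end_unique h'

/-- Apart from the imaginary step, an excursion at `1` would have to start at a positive site before
`T_1`. So the only candidate starts at the imaginary position. -/
lemma population_one {X : ℕ → ℤ} (m : Fin 9) :
    (population X 1 m : ℝ≥0∞) = ind (startShift m = 0 ∧ X 0 = 1 + landShift m ∧
      X ∈ exitVia 0 (1 + preShift m) (1 + endShift m)) := by
  have hle : ∀ r : ℕ, ((r + 1 : ℕ) : ℕ∞) ≤ ladderTime X + 1 ↔ ∀ j < r, X j ≤ 0 := by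
    intro r
    rcases Nat.eq_zero_or_pos r with rfl | hr
    · simp
    · obtain ⟨r, rfl⟩ := Nat.exists_eq_succ_of_ne_zero hr.ne'
      rw [Nat.cast_add, Nat.cast_one, ENat.add_le_add_iff_right ENat.one_ne_top,
        Nat.succ_eq_add_one, le_ladderTime_iff]
      exact ⟨fun h j hj => h j (by omega), fun h j hj => h j (by omega)⟩
  have hs : shift 1 (withImaginaryStep X) = X := rfl
  have h1 : withImaginaryStep X 1 = X 0 := rfl
  have h0 : withImaginaryStep X 0 = 1 := rfl
  have hk : ∀ k r, ((r + 1 : ℕ) : ℕ∞) ≤ ladderTime X + 1 →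
      IsExcursion (withImaginaryStep X) 1 m k r → k = 0 := by
    intro k r h h'
    by_contra hk
    have h2 := (hle r).1 h (k - 1) (by have := h'.1; omega)
    have h3 := h'.2.1
    obtain ⟨j, rfl⟩ := Nat.exists_eq_succ_of_ne_zero hk
    have h4 : withImaginaryStep X (j.succ) = X j := rfl
    have := startShift_nonneg m
    rw [h4] at h3
    simp at h2
    omega
  rw [population, if_neg (by omega), excursionCount, encard_eq_tsum_ind, tsum_ind]
  · have : (startShift m = 0 ∧ X 0 = 1 + landShift m ∧
      X ∈ exitVia 0 (1 + preShift m) (1 + endShift m)) ↔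
        withImaginaryStep X ∈ particleEvent 1 m := by
      rw [mem_particleEvent, hs, h1, h0]
      refine and_congr_left fun _ => by omega
    rw [ind_congr this]
    refine ind_congr ⟨?_, ?_⟩
    · rintro ⟨⟨k, r⟩, h, h'⟩
      obtain rfl := hk k r h h'
      exact ⟨r, h'⟩
    · rintro ⟨r, h⟩
      refine ⟨(0, r), (hle r).2 fun j hj => ?_, h⟩
      have : X j ≤ 1 - 1 := h.2.2.2.1 (j + 1) (by omega) (by omega)
      omega
  · rintro ⟨k, r⟩ ⟨k', r'⟩ ⟨h, h'⟩ ⟨h2, h2'⟩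
    obtain rfl := hk k r h h'
    obtain rfl := hk k' r' h2 h2'
    simp only at h' h2'
    rw [h'.end_unique h2']

end WalkPath

/-! ### The branching property -/

namespace Environment

/-- The paths that begin with a type-`l` excursion at `a` and continue, after it, in `R`. -/
def excursionThen (a : ℤ) (l : Fin 9) (R : Set (ℕ → ℤ)) (X : ℕ → ℤ) : ℝ≥0∞ :=
  ∑' r, ind (IsExcursion X a l 0 r) * ind (shift (r + 1) X ∈ R)

lemma excursionThen_eq {a : ℤ} {l : Fin 9} {R : Set (ℕ → ℤ)} {X : ℕ → ℤ} {r : ℕ}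
    (hr : IsExcursion X a l 0 r) : excursionThen a l R X = ind (shift (r + 1) X ∈ R) := by
  rw [excursionThen, tsum_eq_single r, ind_of hr, one_mul]
  intro r' hr'
  rw [ind_of_not fun h => hr' (h.end_unique hr), zero_mul]

lemma excursionThen_eq_zero {a : ℤ} {l : Fin 9} {R : Set (ℕ → ℤ)} {X : ℕ → ℤ}
    (h : X ∉ particleEvent a l) : excursionThen a l R X = 0 := by
  rw [excursionThen, ENNReal.tsum_eq_zero]
  intro r
  rw [ind_of_not fun hr => h ⟨r, hr⟩, zero_mul]

lemma determinedBy_isExcursion (a : ℤ) (l : Fin 9) (k r : ℕ) :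
    DeterminedBy (r + 1) fun X => X ∈ {X : ℕ → ℤ | IsExcursion X a l k r} :=
  fun _ _ h => propext (IsExcursion.congr h)

/-- Once the parent is known to end with the step from time `r`, its children are the excursions
with last step by then. Without the indicator the end of the parent would not be part of the
history. -/
lemma determinedBy_offspring (i : ℤ) (l m : Fin 9) (r : ℕ) : DeterminedBy (r + 1) fun X =>
    ind (IsExcursion X (i + 1) l 0 r) * (offspringCount i l m X : ℝ≥0∞) := by
  have key : ∀ X, IsExcursion X (i + 1) l 0 r → offspringCount i l m X
      = {p : ℕ × ℕ | p.2 ≤ r ∧ IsExcursion X i m p.1 p.2}.encard := by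
    intro X hX
    rw [offspringCount]
    congr 1
    ext p
    constructor
    · rintro ⟨s, hs, h⟩
      obtain rfl := hs.end_unique hX
      exact h
    · exact fun h => ⟨r, hX, h⟩
  intro X Y h
  by_cases hX : IsExcursion X (i + 1) l 0 r
  · have hY := (IsExcursion.congr h).1 hX
    simp only [key X hX, key Y hY, ind_of hX, ind_of hY, one_mul]
    congr 2
    ext p
    exact and_congr_right fun hp => IsExcursion.congr fun j hj => h j (by omega)
  · have hY := fun hY => hX ((IsExcursion.congr h).2 hY)
    simp only [ind_of_not hX, ind_of_not hY, zero_mul]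

variable (ω : Environment)

/-- The Markov property at the end of an excursion, for functionals `F` of this excursion. -/
lemma lintegral_mul_excursionThen (x a : ℤ) (l : Fin 9) {R : Set (ℕ → ℤ)} (hR : MeasurableSet R)
    {F : (ℕ → ℤ) → ℝ≥0∞}
    (hF : ∀ r, DeterminedBy (r + 1) fun X => ind (IsExcursion X a l 0 r) * F X) :
    ∫⁻ X, F X * excursionThen a l R X ∂ω.walkLaw x
      = (∫⁻ X, ind (X ∈ particleEvent a l) * F X ∂ω.walkLaw x) *
        ω.walkLaw (a + endShift l) R := by
  have h1 : ∀ X, F X * excursionThen a l R X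
      = ∑' r, ind (IsExcursion X a l 0 r) * F X * ind (shift (r + 1) X ∈ R) := by
    intro X
    rw [excursionThen, ← ENNReal.tsum_mul_left]
    exact tsum_congr fun r => by ring
  have h2 : ∀ X, ind (X ∈ particleEvent a l) * F X
      = ∑' r, ind (IsExcursion X a l 0 r) * F X := by
    intro X
    rw [ENNReal.tsum_mul_right, tsum_ind fun r r' h h' => h.end_unique h']
    rfl
  have hRm := fun r => (measurable_ind hR).comp (measurable_shift (r + 1))
  simp_rw [h1, h2]
  have e1 := lintegral_tsum (μ := ω.walkLaw x)
    (f := fun r X => ind (IsExcursion X a l 0 r) * F X * ind (shift (r + 1) X ∈ R))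
    fun r => ((hF r).measurable.mul (hRm r)).aemeasurable
  have e2 := lintegral_tsum (μ := ω.walkLaw x)
    (f := fun r X => ind (IsExcursion X a l 0 r) * F X) fun r => (hF r).measurable.aemeasurable
  rw [e1, e2, ← ENNReal.tsum_mul_right]
  refine tsum_congr fun r => ?_
  -- The type fixes the final position of the excursion, which is what makes the future independent
  -- of `F`.
  have h := ω.lintegral_mul_shift x (a + endShift l) (r + 1) (hF r) (fun X hX =>
    (ind_ne_zero.1 (left_ne_zero_of_mul hX)).2.2.2.2.2) (measurable_ind hR)
  rw [lintegral_ind hR] at h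
  exact h

lemma measurable_excursionThen {a : ℤ} {l : Fin 9} {R : Set (ℕ → ℤ)} (hR : MeasurableSet R) :
    Measurable (excursionThen a l R) :=
  Measurable.tsum fun r => (determinedBy_isExcursion a l 0 r).ind.measurable.mul
    ((measurable_ind hR).comp (measurable_shift (r + 1)))

lemma measurable_offspring_mul {i : ℤ} {l m : Fin 9} {R : Set (ℕ → ℤ)} (hR : MeasurableSet R) :
    Measurable fun X => (offspringCount i l m X : ℝ≥0∞) * excursionThen (i + 1) l R X := by
  have h : (fun X => (offspringCount i l m X : ℝ≥0∞) * excursionThen (i + 1) l R X)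
      = fun X => ∑' r, ind (IsExcursion X (i + 1) l 0 r) * (offspringCount i l m X : ℝ≥0∞) *
        ind (shift (r + 1) X ∈ R) := by
    funext X
    rw [excursionThen, ← ENNReal.tsum_mul_left]
    exact tsum_congr fun r => by ring
  rw [h]
  exact Measurable.tsum fun r => (determinedBy_offspring i l m r).measurable.mul
    ((measurable_ind hR).comp (measurable_shift (r + 1)))

/-- The mean offspring of an excursion does not depend on the path after it. -/
lemma lintegral_offspring_mul (i : ℤ) (l m : Fin 9) {R : Set (ℕ → ℤ)} (hR : MeasurableSet R) :
    ∫⁻ X, (offspringCount i l m X : ℝ≥0∞) * excursionThen (i + 1) l R X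
        ∂ω.walkLaw (i + 1 + startShift l)
      = ω.meanOffspring i l m *
        ∫⁻ X, excursionThen (i + 1) l R X ∂ω.walkLaw (i + 1 + startShift l) := by
  -- The factor for the future is the same for the offspring number and for the constant `1`, so it
  -- drops out of the comparison.
  have h1 := ω.lintegral_mul_excursionThen (i + 1 + startShift l) (i + 1) l hR
    (F := fun X => (offspringCount i l m X : ℝ≥0∞)) (determinedBy_offspring i l m)
  have h2 := ω.lintegral_mul_excursionThen (i + 1 + startShift l) (i + 1) l hR (F := fun _ => 1)
    fun r X Y h => by simpa using (determinedBy_isExcursion (i + 1) l 0 r).ind X Y h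
  simp only [one_mul, mul_one] at h2
  rw [h1, h2, lintegral_ind (measurableSet_particleEvent _ _), ← mul_assoc, meanOffspring_mul]
  congr 1
  refine lintegral_congr fun X => ?_
  by_cases hX : X ∈ particleEvent (i + 1) l
  · rw [offspringCount_eq hX]
  · rw [ind_of_not hX, zero_mul, zero_mul]

/-- The paths whose numbers of excursions at `a` before the exit from `(-∞, 0]`, together with `c`
and one of type `l`, add up to `u`. -/
def remaining (a : ℤ) (l : Fin 9) (c u : Fin 9 → ℕ) : Set (ℕ → ℤ) :=
  {X | ∀ l', (c l' : ℝ≥0∞) + ind (l = l') + excursionsBelow 0 a l' X = u l'}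

/-- The paths with `u l` excursions at `a` of type `l` before the exit from `(-∞, 0]`. -/
def countEvent (a : ℤ) (u : Fin 9 → ℕ) : Set (ℕ → ℤ) :=
  {X | ∀ l, excursionsBelow 0 a l X = u l}

lemma measurableSet_remaining (a : ℤ) (l : Fin 9) (c u : Fin 9 → ℕ) :
    MeasurableSet (remaining a l c u) := by
  have : remaining a l c u = ⋂ l', {X | (c l' : ℝ≥0∞) + ind (l = l') + excursionsBelow 0 a l' X
      = u l'} := by
    ext X; simp [remaining]
  rw [this]
  exact MeasurableSet.iInter fun l' => measurableSet_eq_fun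
    ((measurable_excursionsBelow 0 a l').const_add _) measurable_const

lemma measurableSet_countEvent (a : ℤ) (u : Fin 9 → ℕ) : MeasurableSet (countEvent a u) := by
  have : countEvent a u = ⋂ l, {X | excursionsBelow 0 a l X = u l} := by
    ext X; simp [countEvent]
  rw [this]
  exact MeasurableSet.iInter fun l => measurableSet_eq_fun (measurable_excursionsBelow 0 a l)
    measurable_const

/-- The paths that are below `0` up to time `k`, at `b` at time `k`, and have made `c l`
excursions at `a` of type `l`. -/
def pastEvent (k : ℕ) (a b : ℤ) (c : Fin 9 → ℕ) : Set (ℕ → ℤ) :=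
  {X | Below 0 k X ∧ X k = b ∧ ∀ l, pastCount k a l X = c l}

lemma determinedBy_pastEvent (k : ℕ) (a b : ℤ) (c : Fin 9 → ℕ) :
    DeterminedBy k fun X => X ∈ pastEvent k a b c := fun X Y h =>
  propext (and_congr (Below.congr h) (and_congr (by rw [h k le_rfl])
    (forall_congr' fun l => by rw [determinedBy_pastCount k a l X Y h])))

/-- For each value `c` of the past counts, the condition that the totals are `u` becomes a condition
on the path after the excursion. The event thus splits into past, excursion and future. -/
lemma ind_countEvent_eq_tsum {a : ℤ} (ha : a ≤ 0) (l : Fin 9) (k : ℕ) (u : Fin 9 → ℕ)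
    (X : ℕ → ℤ) :
    ind (Below 0 k X ∧ shift k X ∈ particleEvent a l) * ind (X ∈ countEvent a u)
      = ∑' c : Fin 9 → ℕ, ind (X ∈ pastEvent k a (a + startShift l) c) *
        excursionThen a l (remaining a l c u) (shift k X) := by
  by_cases hp : shift k X ∈ particleEvent a l
  · by_cases hb : Below 0 k X
    · obtain ⟨r, hr⟩ := hp
      have hXk : X k = a + startShift l := by simpa using hr.2.1
      have hr' := isExcursion_shift.1 hr
      rw [tsum_eq_single fun l' => pastCount k a l' X]
      · rw [ind_of ⟨hb, r, hr⟩, ind_of (p := X ∈ pastEvent _ _ _ _) ⟨hb, hXk, fun _ => rfl⟩,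
          one_mul, one_mul, excursionThen_eq hr, shift_shift, show r + 1 + k = r + k + 1 by omega]
        refine ind_congr (forall_congr' fun l' => ?_)
        rw [excursionsBelow_split ha hb hr' l']
      · intro c hc
        rw [ind_of_not fun h => hc (funext fun l' => (h.2.2 l').symm), zero_mul]
    · rw [ind_of_not fun h => hb h.1, zero_mul, eq_comm, ENNReal.tsum_eq_zero]
      intro c
      rw [ind_of_not fun h => hb h.1, zero_mul]
  · rw [ind_of_not fun h => hp h.2, zero_mul, eq_comm, ENNReal.tsum_eq_zero]
    intro c
    rw [excursionThen_eq_zero hp, mul_zero]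

/-- The mean offspring of an excursion that starts at time `k`, given the numbers of all
excursions of the same generation. -/
lemma lintegral_offspring_countEvent (x : ℤ) {i : ℤ} (hi : i + 1 ≤ 0) (l m : Fin 9) (k : ℕ)
    (u : Fin 9 → ℕ) :
    ∫⁻ X, ind (Below 0 k X ∧ shift k X ∈ particleEvent (i + 1) l) *
        (offspringCount i l m (shift k X) : ℝ≥0∞) * ind (X ∈ countEvent (i + 1) u) ∂ω.walkLaw x
      = ω.meanOffspring i l m * ∫⁻ X, ind (Below 0 k X ∧ shift k X ∈ particleEvent (i + 1) l) *
          ind (X ∈ countEvent (i + 1) u) ∂ω.walkLaw x := by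
  have hd := determinedBy_pastEvent k (i + 1) (i + 1 + startShift l)
  have hR := fun c => measurableSet_remaining (i + 1) l c u
  have h1 : ∀ X, ind (Below 0 k X ∧ shift k X ∈ particleEvent (i + 1) l) *
        (offspringCount i l m (shift k X) : ℝ≥0∞) * ind (X ∈ countEvent (i + 1) u)
      = ∑' c : Fin 9 → ℕ, ind (X ∈ pastEvent k (i + 1) (i + 1 + startShift l) c) *
        ((offspringCount i l m (shift k X) : ℝ≥0∞) *
          excursionThen (i + 1) l (remaining (i + 1) l c u) (shift k X)) := by
    intro X
    rw [mul_right_comm, ind_countEvent_eq_tsum hi, ← ENNReal.tsum_mul_right]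
    exact tsum_congr fun c => by ring
  simp_rw [h1, ind_countEvent_eq_tsum hi]
  have e1 := lintegral_tsum (μ := ω.walkLaw x)
    (f := fun c X => ind (X ∈ pastEvent k (i + 1) (i + 1 + startShift l) c) *
        ((offspringCount i l m (shift k X) : ℝ≥0∞) *
          excursionThen (i + 1) l (remaining (i + 1) l c u) (shift k X)))
    fun c => ((hd c).ind.measurable.mul
      ((measurable_offspring_mul (hR c)).comp (measurable_shift k))).aemeasurable
  have e2 := lintegral_tsum (μ := ω.walkLaw x)
    (f := fun c X => ind (X ∈ pastEvent k (i + 1) (i + 1 + startShift l) c) *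
          excursionThen (i + 1) l (remaining (i + 1) l c u) (shift k X))
    fun c => ((hd c).ind.measurable.mul
      ((measurable_excursionThen (hR c)).comp (measurable_shift k))).aemeasurable
  rw [e1, e2, ← ENNReal.tsum_mul_left]
  refine tsum_congr fun c => ?_
  -- The Markov property at the start of the excursion; `lintegral_offspring_mul` then separates the
  -- excursion from its future.
  have m1 := ω.lintegral_mul_shift x (i + 1 + startShift l) k (hd c).ind
    (fun X hX => (ind_ne_zero.1 hX).2.1) (measurable_offspring_mul (i := i) (l := l) (m := m) (hR c))
  have m2 := ω.lintegral_mul_shift x (i + 1 + startShift l) k (hd c).ind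
    (fun X hX => (ind_ne_zero.1 hX).2.1) (measurable_excursionThen (a := i + 1) (l := l) (hR c))
  refine m1.trans (Eq.trans ?_ (congrArg _ m2.symm))
  rw [lintegral_offspring_mul ω i l m (hR c)]
  ring

lemma measurable_offspring_shift (i : ℤ) (l m : Fin 9) (k : ℕ) : Measurable fun X : ℕ → ℤ =>
    ind (Below 0 k X ∧ shift k X ∈ particleEvent (i + 1) l) *
      (offspringCount i l m (shift k X) : ℝ≥0∞) := by
  have h := measurable_offspring_mul (i := i) (l := l) (m := m) MeasurableSet.univ
  have h2 : (fun X : ℕ → ℤ => ind (Below 0 k X ∧ shift k X ∈ particleEvent (i + 1) l) *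
      (offspringCount i l m (shift k X) : ℝ≥0∞))
      = fun X => ind (X ∈ {X | Below 0 k X}) * (offspringCount i l m (shift k X) *
          excursionThen (i + 1) l Set.univ (shift k X)) := by
    funext X
    rw [ind_and, mul_assoc]
    congr 1
    by_cases hp : shift k X ∈ particleEvent (i + 1) l
    · obtain ⟨r, hr⟩ := hp
      rw [excursionThen_eq hr, ind_of ⟨r, hr⟩, ind_of (Set.mem_univ _), one_mul, mul_one]
    · rw [excursionThen_eq_zero hp, ind_of_not hp, zero_mul, mul_zero]
  rw [h2]
  exact (measurable_ind (measurableSet_below 0 k)).mul (h.comp (measurable_shift k))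

/-- The means of the numbers of excursions at `i`, on an event given by the numbers of excursions
at `i + 1`. -/
theorem lintegral_excursionsBelow_countEvent {x i : ℤ} (hi : i + 1 ≤ 0) (hx : i + 1 ≤ x)
    (hlim : ω.LimsupEqTop x) (m : Fin 9) (u : Fin 9 → ℕ) :
    ∫⁻ X, excursionsBelow 0 i m X * ind (X ∈ countEvent (i + 1) u) ∂ω.walkLaw x
      = ∑ l, u l * ω.meanOffspring i l m * ω.walkLaw x (countEvent (i + 1) u) := by
  have hV := measurable_ind (measurableSet_countEvent (i + 1) u)
  have hpe : ∀ k l, MeasurableSet {X | Below 0 k X ∧ shift k X ∈ particleEvent (i + 1) l} :=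
    fun k l => (measurableSet_below 0 k).inter
      (measurable_shift k (measurableSet_particleEvent (i + 1) l))
  have h1 : ∫⁻ X, excursionsBelow 0 i m X * ind (X ∈ countEvent (i + 1) u) ∂ω.walkLaw x
      = ∫⁻ X, ∑' k, ∑ l, ind (Below 0 k X ∧ shift k X ∈ particleEvent (i + 1) l) *
        (offspringCount i l m (shift k X) : ℝ≥0∞) * ind (X ∈ countEvent (i + 1) u)
          ∂ω.walkLaw x := by
    refine lintegral_congr_ae ?_
    filter_upwards [ω.ae_validSteps x, hlim.ae_unbounded, ω.ae_start x] with X hv hu h0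
    rw [excursionsBelow_eq_tsum_offspring hv hu (by omega), ← ENNReal.tsum_mul_right]
    exact tsum_congr fun k => Finset.sum_mul _ _ _
  -- Summing over `k` the indicators of a type-`l` start counts the type-`l` excursions, which
  -- number `u l` on the event.
  have h2 : ∀ l, ω.meanOffspring i l m * (u l * ω.walkLaw x (countEvent (i + 1) u))
      = ∑' k, ω.meanOffspring i l m *
        ∫⁻ X, ind (Below 0 k X ∧ shift k X ∈ particleEvent (i + 1) l) *
          ind (X ∈ countEvent (i + 1) u) ∂ω.walkLaw x := by
    intro l
    rw [ENNReal.tsum_mul_left]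
    congr 1
    have e := lintegral_tsum (μ := ω.walkLaw x)
      (f := fun k X => ind (Below 0 k X ∧ shift k X ∈ particleEvent (i + 1) l) *
        ind (X ∈ countEvent (i + 1) u))
      fun k => ((measurable_ind (hpe k l)).mul hV).aemeasurable
    rw [← e, ← lintegral_ind (measurableSet_countEvent (i + 1) u),
      ← lintegral_const_mul _ hV]
    refine lintegral_congr fun X => ?_
    rw [ENNReal.tsum_mul_right]
    by_cases hX : X ∈ countEvent (i + 1) u
    · rw [← hX l]; rfl
    · rw [ind_of_not hX, mul_zero, mul_zero]
  have e1 := lintegral_tsum (μ := ω.walkLaw x)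
    (f := fun k X => ∑ l, ind (Below 0 k X ∧ shift k X ∈ particleEvent (i + 1) l) *
        (offspringCount i l m (shift k X) : ℝ≥0∞) * ind (X ∈ countEvent (i + 1) u))
    fun k => (Finset.measurable_sum _ fun l _ =>
      (measurable_offspring_shift i l m k).mul hV).aemeasurable
  rw [h1, e1]
  have e2 : ∀ l, u l * ω.meanOffspring i l m * ω.walkLaw x (countEvent (i + 1) u)
      = ω.meanOffspring i l m * (u l * ω.walkLaw x (countEvent (i + 1) u)) := fun l => by ring
  simp_rw [e2, h2]
  rw [← Summable.tsum_finsetSum fun l _ => ENNReal.summable]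
  refine tsum_congr fun k => ?_
  have e3 := lintegral_finsetSum (μ := ω.walkLaw x) Finset.univ
    (f := fun l X => ind (Below 0 k X ∧ shift k X ∈ particleEvent (i + 1) l) *
        (offspringCount i l m (shift k X) : ℝ≥0∞) * ind (X ∈ countEvent (i + 1) u))
    fun l _ => (measurable_offspring_shift i l m k).mul hV
  rw [e3]
  exact Finset.sum_congr rfl fun l _ => ω.lintegral_offspring_countEvent x hi l m k u

end Environment

/-! ### The population process -/

namespace WalkPath

lemma measurable_population {i : ℤ} (hi : i ≤ 1) (m : Fin 9) :
    Measurable fun X => (population X i m : ℝ≥0∞) := by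
  rcases hi.lt_or_eq with hi | rfl
  · simp_rw [population_of_nonpos (Int.lt_add_one_iff.1 hi)]
    exact measurable_excursionsBelow 0 i m
  · simp_rw [population_one]
    exact measurable_ind (A := {X | startShift m = 0 ∧ X 0 = 1 + landShift m ∧
      X ∈ exitVia 0 (1 + preShift m) (1 + endShift m)}) ((MeasurableSet.const _).inter
        ((measurableSet_coord_eq 0 _).inter (measurableSet_exitVia _ _ _)))

lemma population_eq_iff {X : ℕ → ℤ} {i : ℤ} {l : Fin 9} {n : ℕ} :
    population X i l = n ↔ (population X i l : ℝ≥0∞) = n := by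
  rw [← ENat.toENNReal_coe, ENat.toENNReal_inj]

/-- The paths with population `u` in generation `i`. -/
def populationEvent (i : ℤ) (u : Fin 9 → ℕ) : Set (ℕ → ℤ) :=
  {X | ∀ l, population X i l = (u l : ℕ∞)}

lemma measurableSet_populationEvent {i : ℤ} (hi : i ≤ 1) (u : Fin 9 → ℕ) :
    MeasurableSet (populationEvent i u) := by
  have : populationEvent i u = ⋂ l, {X | (population X i l : ℝ≥0∞) = u l} := by
    ext X; simp [populationEvent, population_eq_iff]
  rw [this]
  exact MeasurableSet.iInter fun l => measurableSet_eq_fun (measurable_population hi l)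
    measurable_const

lemma populationEvent_eq_countEvent {i : ℤ} (hi : i ≤ 0) (u : Fin 9 → ℕ) :
    populationEvent i u = Environment.countEvent i u := by
  ext X
  exact forall_congr' fun l => by rw [population_eq_iff, population_of_nonpos hi]

/-- The immigration consists of one particle, of type `A`. -/
lemma exists_population_one {X : ℕ → ℤ} (hv : ValidSteps X) (hu : UnboundedAbove X)
    (h0 : X 0 = 0) : ∃ l₀, startShift l₀ = 0 ∧ landShift l₀ = -1 ∧
      X ∈ exitVia 0 (1 + preShift l₀) (1 + endShift l₀) ∧
      ∀ l, (population X 1 l : ℝ≥0∞) = ind (l₀ = l) := by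
  have h : ∃ l₀, startShift l₀ = 0 ∧ landShift l₀ = -1 ∧
      X ∈ exitVia 0 (1 + preShift l₀) (1 + endShift l₀) := by
    rcases mem_exitVia_cases hv hu h0.le with h | h | h
    · exact ⟨0, rfl, rfl, h⟩
    · exact ⟨1, rfl, rfl, h⟩
    · exact ⟨2, rfl, rfl, h⟩
  obtain ⟨l₀, h1, h2, h3⟩ := h
  refine ⟨l₀, h1, h2, h3, fun l => ?_⟩
  rw [population_one]
  refine ind_congr ⟨fun ⟨h4, h5, h6⟩ => ?_, ?_⟩
  · have h7 := exitVia_unique (by have := endShift_nonneg l₀; omega)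
      (by have := endShift_nonneg l; omega) h3 h6
    exact WalkPath.type_unique (by omega) (by omega) (by omega) (by omega)
  · rintro rfl
    exact ⟨h1, by omega, h3⟩

end WalkPath

namespace Environment

variable {ω : Environment}

/-- The imaginary parent of type A lands at `X_0 = 0`, so its mean offspring comes from exits of the
walk from `0`. The walk from `1` does not enter, and `ω_1(-1)` may be zero. -/
lemma LimsupEqTop.exitOffspring_zero (h : ω.LimsupEqTop 0) (l : Fin 9) (hl : startShift l = 0)
    (hl' : landShift l = -1) (m : Fin 9) : 0 ≤ ω.Q 0 l m ∧
      ω.exitOffspring 0 0 (1 + preShift l) (1 + endShift l) m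
        = ω.exitProb 0 0 (1 + preShift l) (1 + endShift l) * ENNReal.ofReal (ω.Q 0 l m) := by
  have hlA : l = 0 ∨ l = 1 ∨ l = 2 := by revert l; decide
  rcases hlA with rfl | rfl | rfl
  · exact h.exitOffspring_top (q := 1) (by omega) m
  · exact h.exitOffspring_jump_row m
  · exact h.exitOffspring_top (q := 2) (by omega) m

lemma LimsupEqTop.ae_population_one (h : ω.LimsupEqTop 0) :
    ∀ᵐ X ∂ω.walkLaw 0, ∃ l₀, startShift l₀ = 0 ∧ landShift l₀ = -1 ∧
      X ∈ exitVia 0 (1 + preShift l₀) (1 + endShift l₀) ∧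
      ∀ l, (population X 1 l : ℝ≥0∞) = ind (l₀ = l) := by
  filter_upwards [ω.ae_validSteps 0, h.ae_unbounded, ω.ae_start 0] with X hv hu h0
  exact exists_population_one hv hu h0

/-- On a possible value of the immigration, the mean of `U_0`. -/
lemma LimsupEqTop.mean_population_zero (h : ω.LimsupEqTop 0) {u : Fin 9 → ℕ}
    (hu : ω.walkLaw 0 (populationEvent 1 u) ≠ 0) (m : Fin 9) :
    (∀ l, u l ≠ 0 → 0 ≤ ω.Q 0 l m) ∧
    ∫⁻ X, (population X 0 m : ℝ≥0∞) * ind (X ∈ populationEvent 1 u) ∂ω.walkLaw 0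
      = (∑ l, u l * ENNReal.ofReal (ω.Q 0 l m)) * ω.walkLaw 0 (populationEvent 1 u) := by
  -- An event of positive probability contains a typical path, which shows that `u` is the unit
  -- vector at some type `l₀`.
  obtain ⟨X, hX, l₀, hs, hl, hexit, hp⟩ :=
    (frequently_ae_mem_iff.2 hu |>.and_eventually h.ae_population_one).exists
  have hul : ∀ l, (u l : ℝ≥0∞) = ind (l₀ = l) := fun l => by
    rw [← hp l]
    exact (population_eq_iff.1 (hX l)).symm
  have hev : ∀ᵐ X ∂ω.walkLaw 0, ind (X ∈ populationEvent 1 u)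
      = ind (X ∈ exitVia 0 (1 + preShift l₀) (1 + endShift l₀)) := by
    filter_upwards [h.ae_population_one] with Y ⟨l₁, hs₁, hl₁, hexit₁, hp₁⟩
    refine ind_congr ⟨fun hY => ?_, fun hY l => ?_⟩
    · have h1 := (population_eq_iff.1 (hY l₀)).symm
      rw [hul, hp₁, ind_of rfl] at h1
      obtain rfl : l₁ = l₀ := ind_ne_zero.1 (h1 ▸ one_ne_zero)
      exact hexit₁
    · have h7 := exitVia_unique (by have := endShift_nonneg l₁; omega)
        (by have := endShift_nonneg l₀; omega) hexit₁ hY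
      obtain rfl : l₁ = l₀ := WalkPath.type_unique (by omega) (by omega) (by omega) (by omega)
      rw [population_eq_iff, hp₁, hul]
  have hQ := h.exitOffspring_zero l₀ hs hl m
  refine ⟨fun l hl => ?_, ?_⟩
  · obtain rfl : l₀ = l := ind_ne_zero.1 (hul l ▸ Nat.cast_ne_zero.2 hl)
    exact hQ.1
  · have h1 : ω.walkLaw 0 (populationEvent 1 u)
        = ω.exitProb 0 0 (1 + preShift l₀) (1 + endShift l₀) := by
      rw [exitProb, ← lintegral_ind (measurableSet_exitVia _ _ _),
        ← lintegral_ind (measurableSet_populationEvent le_rfl u)]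
      exact lintegral_congr_ae hev
    rw [h1, Finset.sum_eq_single l₀, hul, ind_of rfl, one_mul, mul_comm, ← hQ.2]
    · refine lintegral_congr_ae ?_
      filter_upwards [hev] with Y hY
      rw [hY, population_of_nonpos le_rfl]
    · intro l _ hl
      rw [hul, ind_of_not hl.symm, zero_mul]
    · simp

/-- On a possible value of `U_{i+1}`, the mean of `U_i`. -/
lemma LimsupEqTop.mean_population (h : ω.LimsupEqTop 0) {i : ℤ} (hi : i ≤ 0) {u : Fin 9 → ℕ}
    (hu : ω.walkLaw 0 (populationEvent (i + 1) u) ≠ 0) (m : Fin 9) :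
    (∀ l, u l ≠ 0 → 0 ≤ ω.Q i l m) ∧
    ∫⁻ X, (population X i m : ℝ≥0∞) * ind (X ∈ populationEvent (i + 1) u) ∂ω.walkLaw 0
      = (∑ l, u l * ENNReal.ofReal (ω.Q i l m)) * ω.walkLaw 0 (populationEvent (i + 1) u) := by
  rcases hi.lt_or_eq with hi' | rfl
  swap
  · exact h.mean_population_zero hu m
  have hi1 : i + 1 ≤ 0 := hi'
  rw [populationEvent_eq_countEvent hi1] at hu ⊢
  have hM : ∀ l, u l ≠ 0 → ω.meanOffspring i l m ≠ ∞ ∧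
      (ω.meanOffspring i l m).toReal = ω.Q i l m := by
    intro l hl
    -- A type that is present in a possible `u` occurs at some fixed time with positive probability;
    -- hence its starting site is reachable from `0` and inherits the hypothesis.
    have hk : ∃ k, ω.walkLaw 0 {X | Below 0 k X ∧ shift k X ∈ particleEvent (i + 1) l} ≠ 0 := by
      by_contra! hk
      refine hu (measure_mono_null (fun X hX => ?_) (measure_iUnion_null hk))
      have h1 : excursionsBelow 0 (i + 1) l X ≠ 0 := by
        rw [hX l]
        exact Nat.cast_ne_zero.2 hl
      rw [excursionsBelow, Ne, ENNReal.tsum_eq_zero, not_forall] at h1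
      obtain ⟨k, hk⟩ := h1
      exact Set.mem_iUnion.2 ⟨k, ind_ne_zero.1 hk⟩
    obtain ⟨k, hk⟩ := hk
    have h1 := ω.measure_inter_shift 0 (i + 1 + startShift l) k
      (A := {X | X k = i + 1 + startShift l}) (fun X Y h => by simp [h k le_rfl])
      (fun X hX => hX) (measurableSet_particleEvent (i + 1) l)
    have h2 : ω.walkLaw 0 {X | X ∈ {X : ℕ → ℤ | X k = i + 1 + startShift l} ∧
        shift k X ∈ particleEvent (i + 1) l} ≠ 0 := by
      have hsub : {X | Below 0 k X ∧ shift k X ∈ particleEvent (i + 1) l} ⊆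
          {X | X ∈ {X : ℕ → ℤ | X k = i + 1 + startShift l} ∧
            shift k X ∈ particleEvent (i + 1) l} := by
        rintro X ⟨-, hX⟩
        exact ⟨by simpa using (mem_particleEvent.1 hX).1, hX⟩
      exact fun h0 => hk (measure_mono_null hsub h0)
    rw [h1] at h2
    exact ω.meanOffspring_eq i l (h.of_reach (left_ne_zero_of_mul h2))
      (right_ne_zero_of_mul h2) m
  refine ⟨fun l hl => (hM l hl).2 ▸ ENNReal.toReal_nonneg, ?_⟩
  simp_rw [population_of_nonpos hi]
  rw [ω.lintegral_excursionsBelow_countEvent hi1 hi1 h m u, Finset.sum_mul]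
  refine Finset.sum_congr rfl fun l _ => ?_
  by_cases hl : u l = 0
  · simp [hl]
  · rw [← (hM l hl).2, ENNReal.ofReal_toReal (hM l hl).1]

/-- The conditional mean of `U_i`, given `U_{i+1} = u`. -/
theorem LimsupEqTop.condMean_population (h : ω.LimsupEqTop 0) {i : ℤ} (hi : i ≤ 0)
    {u : Fin 9 → ℕ} (hu : ω.walkLaw 0 (populationEvent (i + 1) u) ≠ 0) (m : Fin 9) :
    ∫⁻ X, (population X i m : ℝ≥0∞) ∂(ω.walkLaw 0)[|populationEvent (i + 1) u] ≠ ∞ ∧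
    (∫⁻ X, (population X i m : ℝ≥0∞) ∂(ω.walkLaw 0)[|populationEvent (i + 1) u]).toReal
      = ((fun l => (u l : ℝ)) ᵥ* ω.Q i) m := by
  obtain ⟨hQ, hE⟩ := h.mean_population hi hu m
  have hm := measurableSet_populationEvent (i := i + 1) (by omega) u
  have h1 : ∫⁻ X, (population X i m : ℝ≥0∞) ∂(ω.walkLaw 0)[|populationEvent (i + 1) u]
      = ∑ l, u l * ENNReal.ofReal (ω.Q i l m) := by
    rw [ProbabilityTheory.cond, lintegral_smul_measure, ← lintegral_indicator hm]
    have h2 : ∀ X, (populationEvent (i + 1) u).indicator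
        (fun X => (population X i m : ℝ≥0∞)) X
        = (population X i m : ℝ≥0∞) * ind (X ∈ populationEvent (i + 1) u) := fun X => by
      classical
      rw [Set.indicator_apply]
      simp [ind]
    simp_rw [h2]
    rw [hE, smul_eq_mul, mul_comm, mul_assoc,
      ENNReal.mul_inv_cancel hu (measure_ne_top _ _), mul_one]
  have hfin : ∀ l ∈ Finset.univ, (u l : ℝ≥0∞) * ENNReal.ofReal (ω.Q i l m) ≠ ∞ := fun l _ =>
    ENNReal.mul_ne_top (ENNReal.natCast_ne_top _) ENNReal.ofReal_ne_top
  rw [h1]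
  refine ⟨ENNReal.sum_ne_top.2 hfin, ?_⟩
  rw [ENNReal.toReal_sum hfin, vecMul, dotProduct]
  refine Finset.sum_congr rfl fun l _ => ?_
  by_cases hl : u l = 0
  · simp [hl]
  · rw [ENNReal.toReal_mul, ENNReal.toReal_ofReal (hQ l hl), ENNReal.toReal_natCast]

end Environment

/-! ### The means of the populations -/

namespace Environment

variable (ω : Environment)

/-- The mean number of type-`m` particles in generation `i`. -/
def meanPopulation (i : ℤ) (m : Fin 9) : ℝ≥0∞ := ∫⁻ X, (population X i m : ℝ≥0∞) ∂ω.walkLaw 0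

lemma meanPopulation_one (l : Fin 9) : ω.meanPopulation 1 l
    = if startShift l = 0 ∧ landShift l = -1 then
        ω.exitProb 0 0 (1 + preShift l) (1 + endShift l) else 0 := by
  have h1 : ω.meanPopulation 1 l = ∫⁻ X, ind (startShift l = 0 ∧ landShift l = -1) *
      ind (X ∈ exitVia 0 (1 + preShift l) (1 + endShift l)) ∂ω.walkLaw 0 := by
    refine lintegral_congr_ae ?_
    filter_upwards [ω.ae_start 0] with X h0
    rw [population_one, ← ind_and]
    refine ind_congr ?_
    rw [h0, and_assoc]
    exact and_congr_right fun _ => and_congr_left fun _ => by omega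
  rw [h1, lintegral_const_mul _ (measurable_ind (measurableSet_exitVia _ _ _)),
    lintegral_ind (measurableSet_exitVia _ _ _)]
  split_ifs with h
  · rw [ind_of h, one_mul]; rfl
  · rw [ind_of_not h, zero_mul]

lemma meanPopulation_one_ne_top (l : Fin 9) : ω.meanPopulation 1 l ≠ ∞ := by
  rw [meanPopulation_one]
  split_ifs
  · exact ω.exitProb_ne_top _ _ _ _
  · exact ENNReal.zero_ne_top

variable {ω}

/-- The explicit mean of the immigration. -/
theorem LimsupEqTop.u₁_eq (h : ω.LimsupEqTop 0) (hp : 0 < ω.prob 1 (-1)) :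
    ω.u₁ = ![ω.α₁ 1 / (ω.α₁ 1 + ω.α₂ 1 + ω.α₃ 1), ω.α₂ 1 / (ω.α₁ 1 + ω.α₂ 1 + ω.α₃ 1),
      ω.α₃ 1 / (ω.α₁ 1 + ω.α₂ 1 + ω.α₃ 1), 0, 0, 0, 0, 0, 0] := by
  obtain ⟨h1, h2, h3⟩ := Environment.α_eq (ω := ω) (i := 1) fun _ => h
  -- Normalization removes the imaginary step probability and leaves the exit probabilities from
  -- `0`.
  have hs : ω.α₁ 1 + ω.α₂ 1 + ω.α₃ 1 = ω.prob 1 (-1) := by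
    rw [h1, h2, h3, ← mul_add, ← mul_add]
    have := h.e_add le_rfl
    rw [show (1 : ℤ) - 1 = 0 by norm_num, this, mul_one]
  rw [hs, h1, h2, h3, mul_div_cancel_left₀ _ hp.ne', mul_div_cancel_left₀ _ hp.ne',
    mul_div_cancel_left₀ _ hp.ne']
  have hu : ∀ l, ω.u₁ l = (ω.meanPopulation 1 l).toReal := fun _ => rfl
  funext l
  rw [hu, meanPopulation_one]
  revert l
  refine forall_fin9 ?_ ?_ ?_ ?_ ?_ ?_ ?_ ?_ ?_
  · rfl
  · rfl
  · rfl
  all_goals simp [startShift, landShift]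

/-- Finite means make the populations almost surely finite, so the vectors `u` of natural numbers
account for all the mass. -/
lemma LimsupEqTop.tsum_populationEvent {i : ℤ} (hi : i ≤ 1)
    (hfin : ∀ l, ω.meanPopulation i l ≠ ∞) :
    ∀ᵐ X ∂ω.walkLaw 0, ∑' u, ind (X ∈ populationEvent i u) = 1 := by
  have h1 : ∀ᵐ X ∂ω.walkLaw 0, ∀ l, (population X i l : ℝ≥0∞) < ∞ :=
    ae_all_iff.2 fun l => ae_lt_top (measurable_population hi l) (hfin l)
  filter_upwards [h1] with X hX
  rw [tsum_ind]
  · refine ind_of ?_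
    have h2 : ∀ l, ∃ n : ℕ, population X i l = n := fun l => by
      have : population X i l ≠ ⊤ := fun h => by simpa [h] using hX l
      exact ⟨_, (ENat.natCast_toNat this).symm⟩
    choose u hu using h2
    exact ⟨u, hu⟩
  · intro u v hu hv
    funext l
    exact Nat.cast_injective ((hu l).symm.trans (hv l))

lemma lintegral_eq_tsum_populationEvent {i : ℤ} (hi : i ≤ 1)
    (hfin : ∀ l, ω.meanPopulation i l ≠ ∞) {F : (ℕ → ℤ) → ℝ≥0∞} (hF : Measurable F) :
    ∫⁻ X, F X ∂ω.walkLaw 0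
      = ∑' u, ∫⁻ X, F X * ind (X ∈ populationEvent i u) ∂ω.walkLaw 0 := by
  have e := lintegral_tsum (μ := ω.walkLaw 0) (f := fun u X => F X * ind (X ∈ populationEvent i u))
    fun u => (hF.mul (measurable_ind (measurableSet_populationEvent hi u))).aemeasurable
  rw [← e]
  refine lintegral_congr_ae ?_
  filter_upwards [LimsupEqTop.tsum_populationEvent hi hfin] with X hX
  rw [ENNReal.tsum_mul_left, hX, mul_one]

lemma meanPopulation_eq_tsum {i : ℤ} (hi : i ≤ 1) (hfin : ∀ l, ω.meanPopulation i l ≠ ∞)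
    (l : Fin 9) : ω.meanPopulation i l = ∑' u : Fin 9 → ℕ, u l * ω.walkLaw 0 (populationEvent i u) := by
  rw [meanPopulation, lintegral_eq_tsum_populationEvent hi hfin (measurable_population hi l)]
  refine tsum_congr fun u => ?_
  have hm := measurableSet_populationEvent hi u
  rw [← lintegral_ind hm, ← lintegral_const_mul _ (measurable_ind hm)]
  refine lintegral_congr fun X => ?_
  by_cases hX : X ∈ populationEvent i u
  · rw [population_eq_iff.1 (hX l)]
  · rw [ind_of_not hX, mul_zero, mul_zero]

/-- The means of consecutive generations. -/
lemma LimsupEqTop.meanPopulation_succ (h : ω.LimsupEqTop 0) {i : ℤ} (hi : i ≤ 0)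
    (hfin : ∀ l, ω.meanPopulation (i + 1) l ≠ ∞) (m : Fin 9) :
    ω.meanPopulation i m ≠ ∞ ∧ (ω.meanPopulation i m).toReal
      = ((fun l => (ω.meanPopulation (i + 1) l).toReal) ᵥ* ω.Q i) m := by
  have hi1 : i + 1 ≤ 1 := by omega
  have h1 : ω.meanPopulation i m
      = ∑ l, ω.meanPopulation (i + 1) l * ENNReal.ofReal (ω.Q i l m) := by
    simp_rw [meanPopulation_eq_tsum hi1 hfin, ← ENNReal.tsum_mul_right]
    rw [← Summable.tsum_finsetSum fun l _ => ENNReal.summable, meanPopulation,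
      lintegral_eq_tsum_populationEvent hi1 hfin (measurable_population (by omega) m)]
    refine tsum_congr fun u => ?_
    by_cases hu : ω.walkLaw 0 (populationEvent (i + 1) u) = 0
    · simp only [hu, mul_zero, zero_mul, Finset.sum_const_zero]
      refine (lintegral_congr_ae ?_).trans lintegral_zero
      filter_upwards [measure_eq_zero_iff_ae_notMem.1 hu] with X hX
      simp [ind_of_not hX]
    · rw [(h.mean_population hi hu m).2, Finset.sum_mul]
      exact Finset.sum_congr rfl fun l _ => by ring
  -- Nonnegativity of the entries is known only for types that occur. For the others
  -- `ENNReal.ofReal` might truncate, but their mean is `0`.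
  have hQ : ∀ l, ω.meanPopulation (i + 1) l ≠ 0 → 0 ≤ ω.Q i l m := by
    intro l hl
    rw [meanPopulation_eq_tsum hi1 hfin, Ne, ENNReal.tsum_eq_zero, not_forall] at hl
    obtain ⟨u, hu⟩ := hl
    exact (h.mean_population hi (right_ne_zero_of_mul hu) m).1 l
      (Nat.cast_ne_zero.1 (left_ne_zero_of_mul hu))
  have hf : ∀ l ∈ Finset.univ, ω.meanPopulation (i + 1) l * ENNReal.ofReal (ω.Q i l m) ≠ ∞ :=
    fun l _ => ENNReal.mul_ne_top (hfin l) ENNReal.ofReal_ne_top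
  rw [h1]
  refine ⟨ENNReal.sum_ne_top.2 hf, ?_⟩
  rw [ENNReal.toReal_sum hf, vecMul, dotProduct]
  refine Finset.sum_congr rfl fun l _ => ?_
  by_cases hl : ω.meanPopulation (i + 1) l = 0
  · simp [hl]
  · rw [ENNReal.toReal_mul, ENNReal.toReal_ofReal (hQ l hl)]

/-- The means of all generations. -/
theorem LimsupEqTop.meanPopulation_neg (h : ω.LimsupEqTop 0) (n : ℕ) (m : Fin 9) :
    ω.meanPopulation (-(n : ℤ)) m ≠ ∞ ∧
      (ω.meanPopulation (-(n : ℤ)) m).toReal = (ω.u₁ ᵥ* ω.prodQ n) m := by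
  induction n generalizing m with
  | zero =>
    exact h.meanPopulation_succ le_rfl ω.meanPopulation_one_ne_top m
  | succ n ih =>
    have hn : -((n + 1 : ℕ) : ℤ) + 1 = -(n : ℤ) := by push_cast; ring
    have := h.meanPopulation_succ (i := -((n + 1 : ℕ) : ℤ)) (by omega)
      (fun l => by rw [hn]; exact (ih l).1) m
    refine ⟨this.1, this.2.trans ?_⟩
    rw [hn, prodQ, ← vecMul_vecMul]
    push_cast
    congr 1
    exact funext fun l => (ih l).2

end Environment

/-! ### The ladder time -/

namespace WalkPath

/-- `T_1` is the number of times `k`, starting from `0`, up to which the path has not become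
positive. -/
lemma ladderTime_eq_tsum {X : ℕ → ℤ} (hu : UnboundedAbove X) (h0 : X 0 ≤ 0) :
    (ladderTime X : ℝ≥0∞) = ∑' k, ind (Below 0 k X) := by
  obtain ⟨r, hr, hr'⟩ := exists_exit hu h0
  have h1 : ladderTime X = (r + 1 : ℕ) :=
    le_antisymm (iInf₂_le (r + 1) hr') (le_ladderTime_iff.2 hr)
  rw [h1, tsum_eq_sum (s := Finset.range (r + 1)),
    Finset.sum_congr rfl fun k hk => ind_of (hr.mono (Nat.lt_succ_iff.1 (Finset.mem_range.1 hk)))]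
  · simp
  · intro k hk
    refine ind_of_not fun hb => ?_
    have := hb (r + 1) (by simpa using hk)
    omega

/-- The down steps below `0` are the first steps of the excursions of the types `A` and `C`. -/
lemma ind_down_step {X : ℕ → ℤ} (hv : ValidSteps X) (hu : UnboundedAbove X) (k : ℕ) :
    ind (Below 0 (k + 1) X ∧ X (k + 1) < X k) = ∑' p : ℕ × Fin 9, ind (landShift p.2 = -1) *
      ind (Below 0 k X ∧ shift k X ∈ particleEvent (-(p.1 : ℤ)) p.2) := by
  simp_rw [← ind_and]
  rw [tsum_ind]
  · refine ind_congr ⟨?_, ?_⟩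
    · rintro ⟨hb, hk⟩
      -- The level of the excursion is one above the landing site; it is at most `X k`, hence
      -- nonpositive. A step of length two is thus counted at its lower level, as type C.
      obtain ⟨n, hn⟩ : ∃ n : ℕ, X (k + 1) + 1 = -(n : ℤ) :=
        ⟨(-(X (k + 1) + 1)).toNat, by have := hb k (by omega); omega⟩
      obtain ⟨r, hr, hr'⟩ := exists_exit ((unboundedAbove_shift_iff (k + 1)).2 hu)
        (L := X (k + 1)) (by simp)
      obtain ⟨l, hl⟩ := exists_isExcursion hv (a := -(n : ℤ)) (k := k) (r := r + (k + 1))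
        (by omega) (by omega) (fun j hj hjr => by
          have := hr (j - (k + 1)) (by omega)
          rw [shift_apply, Nat.sub_add_cancel (by omega)] at this
          omega)
        (by
          rw [shift_apply, show r + 1 + (k + 1) = r + (k + 1) + 1 by omega] at hr'
          omega)
      have := hl.2.2.1
      exact ⟨(n, l), by simp only; omega, hb.mono (by omega), shift_mem_particleEvent.2 ⟨_, hl⟩⟩
    · rintro ⟨⟨n, l⟩, hl, hb, h⟩
      obtain ⟨r, hr⟩ := shift_mem_particleEvent.1 h
      have h1 := hr.2.1
      have h2 := hr.2.2.1
      have h3 := startShift_nonneg l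
      have h4 := landShift_le l
      have h5 := hb k le_rfl
      simp only at h1 h2
      refine ⟨fun j hj => ?_, by omega⟩
      rcases hj.lt_or_eq with hj | rfl
      · exact hb j (by omega)
      · omega
  · rintro ⟨n, l⟩ ⟨n', l'⟩ ⟨hl, -, h⟩ ⟨hl', -, h'⟩
    obtain ⟨r, hr⟩ := shift_mem_particleEvent.1 h
    obtain ⟨r', hr'⟩ := shift_mem_particleEvent.1 h'
    have h1 := hr.2.2.1
    have h2 := hr'.2.2.1
    simp only at hl hl' h1 h2 hr hr'
    obtain rfl : n = n' := by omega
    rw [hr.type_unique hr']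

/-- The up steps below `0` are the last steps of the excursions of the subtypes `1` and `2`. -/
lemma ind_up_step {X : ℕ → ℤ} (hv : ValidSteps X) (h0 : X 0 = 0) (r : ℕ) :
    ind (Below 0 (r + 1) X ∧ X r < X (r + 1)) = ∑' p : (ℕ × Fin 9) × ℕ,
      ind (endShift p.1.2 = 0) *
        ind (Below 0 p.2 X ∧ IsExcursion X (-(p.1.1 : ℤ)) p.1.2 p.2 r) := by
  simp_rw [← ind_and]
  rw [tsum_ind]
  · refine ind_congr ⟨?_, ?_⟩
    · rintro ⟨hb, hr⟩
      -- The level is the landing site of the up step. As `X 0 = 0` is not below it, the path was at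
      -- or above this level before.
      obtain ⟨n, hn⟩ : ∃ n : ℕ, X (r + 1) = -(n : ℤ) :=
        ⟨(-X (r + 1)).toNat, by have := hb (r + 1) le_rfl; omega⟩
      obtain ⟨k, hk, hk1, hk2⟩ := exists_last_ge (X := X) (i := -(n : ℤ)) (r := r) (by omega)
        (by omega)
      obtain ⟨l, hl⟩ := exists_isExcursion hv hk hk1 hk2 (by omega)
      have := hl.2.2.2.2.2
      exact ⟨((n, l), k), by simp only; omega, hb.mono (by simp only; omega), hl⟩
    · rintro ⟨⟨⟨n, l⟩, k⟩, hl, hb, hr⟩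
      have h1 := hr.2.2.2.2.2
      have h2 := hr.2.2.2.1 r hr.1 le_rfl
      simp only at h1 h2 hl hb hr
      refine ⟨fun j hj => ?_, by omega⟩
      rcases Nat.lt_or_ge k j with hkj | hkj
      · rcases hj.lt_or_eq with hj | rfl
        · have := hr.2.2.2.1 j hkj (by omega)
          omega
        · omega
      · exact hb j hkj
  · rintro ⟨⟨n, l⟩, k⟩ ⟨⟨n', l'⟩, k'⟩ ⟨hl, -, hr⟩ ⟨hl', -, hr'⟩
    have h1 := hr.2.2.2.2.2
    have h2 := hr'.2.2.2.2.2
    simp only at hl hl' h1 h2 hr hr'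
    obtain rfl : n = n' := by omega
    have hs := startShift_nonneg l
    have hs' := startShift_nonneg l'
    have hk : k = k' := by
      rcases lt_trichotomy k k' with h3 | h3 | h3
      · have := hr.2.2.2.1 k' h3 hr'.1.le
        have := hr'.2.1
        omega
      · exact h3
      · have := hr'.2.2.2.1 k h3 hr.1.le
        have := hr.2.1
        omega
    subst hk
    rw [hr.type_unique hr']

/-- The number of steps below `0` that an excursion of type `l` accounts for: its first step, if
it is `i → i - 1` or `i + 1 → i - 1`, and its last step, if it ends at `i`. -/
def stepCount (l : Fin 9) : ℝ≥0∞ := ind (landShift l = -1) + ind (endShift l = 0)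

lemma stepCount_ne_top (l : Fin 9) : stepCount l ≠ ∞ :=
  ENNReal.add_ne_top.2 ⟨ne_top_of_le_ne_top ENNReal.one_ne_top (ind_le_one _),
    ne_top_of_le_ne_top ENNReal.one_ne_top (ind_le_one _)⟩

lemma toReal_stepCount :
    (fun l => (stepCount l).toReal) = ![2, 2, 1, 1, 1, 0, 2, 2, 1] := by
  funext l
  revert l
  refine forall_fin9 ?_ ?_ ?_ ?_ ?_ ?_ ?_ ?_ ?_ <;>
    simp [stepCount, ind, landShift, endShift] <;> norm_num

/-- The ladder time is determined by the population process. -/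
lemma ladderTime_eq_population {X : ℕ → ℤ} (hv : ValidSteps X) (hu : UnboundedAbove X)
    (h0 : X 0 = 0) : (ladderTime X : ℝ≥0∞)
      = 1 + ∑' n : ℕ, ∑ l, stepCount l * (population X (-(n : ℤ)) l : ℝ≥0∞) := by
  have hstep : ∀ k, ind (Below 0 (k + 1) X) = ind (Below 0 (k + 1) X ∧ X (k + 1) < X k)
      + ind (Below 0 (k + 1) X ∧ X k < X (k + 1)) := by
    intro k
    rw [← ind_or (by omega)]
    refine ind_congr ⟨fun h => ?_, by tauto⟩
    have := hv k
    rcases lt_trichotomy (X k) (X (k + 1)) with h1 | h1 | h1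
    · exact Or.inr ⟨h, h1⟩
    · omega
    · exact Or.inl ⟨h, h1⟩
  have hexc : ∀ (n : ℕ) (l : Fin 9), ∑' k, ∑' r, ind (Below 0 k X ∧ IsExcursion X (-(n : ℤ)) l k r)
      = excursionsBelow 0 (-(n : ℤ)) l X := by
    intro n l
    refine tsum_congr fun k => ?_
    rw [tsum_ind fun r r' h h' => h.2.end_unique h'.2]
    exact ind_congr (by rw [shift_mem_particleEvent, exists_and_left])
  have hdown : ∑' k, ind (Below 0 (k + 1) X ∧ X (k + 1) < X k)
      = ∑' p : ℕ × Fin 9, ind (landShift p.2 = -1) * excursionsBelow 0 (-(p.1 : ℤ)) p.2 X := by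
    simp_rw [ind_down_step hv hu]
    rw [ENNReal.tsum_comm]
    exact tsum_congr fun p => ENNReal.tsum_mul_left
  have hup : ∑' r, ind (Below 0 (r + 1) X ∧ X r < X (r + 1))
      = ∑' p : ℕ × Fin 9, ind (endShift p.2 = 0) * excursionsBelow 0 (-(p.1 : ℤ)) p.2 X := by
    simp_rw [ind_up_step hv h0]
    rw [ENNReal.tsum_comm, ENNReal.tsum_prod']
    refine tsum_congr fun p => ?_
    simp_rw [ENNReal.tsum_mul_left]
    rw [hexc]
  -- Time `0` contributes the leading `1`; every later time before `T_1` is the end of a down step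
  -- or of an up step.
  rw [ladderTime_eq_tsum hu h0.le, tsum_eq_zero_add' ENNReal.summable,
    ind_of (p := Below 0 0 X) fun j hj => by rw [Nat.le_zero.1 hj, h0]]
  simp_rw [hstep]
  rw [ENNReal.tsum_add, hdown, hup, ← ENNReal.tsum_add, ENNReal.tsum_prod']
  congr 1
  refine tsum_congr fun n => ?_
  rw [tsum_fintype]
  refine Finset.sum_congr rfl fun l _ => ?_
  rw [population_of_nonpos (by omega), stepCount, add_mul]

end WalkPath

namespace Environment

variable {ω : Environment}

/-- The mean of the ladder time. -/
theorem LimsupEqTop.mean_ladderTime (h : ω.LimsupEqTop 0) :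
    ∫⁻ X, (ladderTime X : ℝ≥0∞) ∂ω.walkLaw 0
      = 1 + ∑' n : ℕ, ENNReal.ofReal
          ((ω.u₁ ᵥ* ω.prodQ n) ⬝ᵥ ![2, 2, 1, 1, 1, 0, 2, 2, 1]) := by
  have hm : ∀ (n : ℕ) (l : Fin 9), Measurable fun X =>
      stepCount l * (population X (-(n : ℤ)) l : ℝ≥0∞) := fun n l =>
    (measurable_population (by omega) l).const_mul _
  have hsum : ∀ n : ℕ, Measurable fun X =>
      ∑ l, stepCount l * (population X (-(n : ℤ)) l : ℝ≥0∞) := fun n =>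
    Finset.measurable_sum _ fun l _ => hm n l
  have h1 : ∫⁻ X, (ladderTime X : ℝ≥0∞) ∂ω.walkLaw 0
      = ∫⁻ X, 1 + ∑' n : ℕ, ∑ l, stepCount l * (population X (-(n : ℤ)) l : ℝ≥0∞)
        ∂ω.walkLaw 0 := by
    refine lintegral_congr_ae ?_
    filter_upwards [ω.ae_validSteps 0, h.ae_unbounded, ω.ae_start 0] with X hv hu h0
    exact ladderTime_eq_population hv hu h0
  rw [h1, lintegral_add_left measurable_const, lintegral_one, measure_univ,
    lintegral_tsum fun n => (hsum n).aemeasurable]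
  congr 1
  refine tsum_congr fun n => ?_
  have hentry : ∀ l, (ω.u₁ ᵥ* ω.prodQ n) l = (ω.meanPopulation (-(n : ℤ)) l).toReal :=
    fun l => (h.meanPopulation_neg n l).2.symm
  rw [lintegral_finsetSum _ fun l _ => hm n l, ← toReal_stepCount, dotProduct,
    ENNReal.ofReal_sum_of_nonneg fun l _ => by
      rw [hentry]; exact mul_nonneg ENNReal.toReal_nonneg ENNReal.toReal_nonneg]
  refine Finset.sum_congr rfl fun l _ => ?_
  rw [lintegral_const_mul _ (measurable_population (by omega) l), hentry,
    ← ENNReal.toReal_mul, ENNReal.ofReal_toReal, mul_comm]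
  · rfl
  · exact ENNReal.mul_ne_top (h.meanPopulation_neg n l).1 (stepCount_ne_top l)

end Environment

end

theorem corollary3p2 (ω : Environment) (hω : ω.LimsupEqTop 0) :
    -- the mean offspring matrices of the particle types have the explicit form `Q_i`
    (∀ i : ℤ, i ≤ 0 → ∀ l : Fin 9,
      ω.LimsupEqTop (i + 1 + startShift l) →
      ω.walkLaw (i + 1 + startShift l) (particleEvent (i + 1) l) ≠ 0 →
      ∀ m : Fin 9, ω.meanOffspring i l m ≠ ∞ ∧ (ω.meanOffspring i l m).toReal = ω.Q i l m) ∧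
    -- the `Q_i` are the mean matrices of the process `(U_i)`: `E(U_i | U_{i+1} = u) = u Q_i`
    (∀ i : ℤ, i ≤ 0 → ∀ u : Fin 9 → ℕ,
      ω.walkLaw 0 {X | ∀ l, population X (i + 1) l = (u l : ℕ∞)} ≠ 0 →
      ∀ m : Fin 9,
        ∫⁻ X, (population X i m : ℝ≥0∞)
          ∂(ω.walkLaw 0)[|{X | ∀ l, population X (i + 1) l = (u l : ℕ∞)}] ≠ ∞ ∧
        (∫⁻ X, (population X i m : ℝ≥0∞)
          ∂(ω.walkLaw 0)[|{X | ∀ l, population X (i + 1) l = (u l : ℕ∞)}]).toReal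
          = ((fun l => (u l : ℝ)) ᵥ* ω.Q i) m) ∧
    -- the explicit form of `u_1 = E(U_1)`
    (0 < ω.prob 1 (-1) →
      ω.u₁ = ![ω.α₁ 1 / (ω.α₁ 1 + ω.α₂ 1 + ω.α₃ 1), ω.α₂ 1 / (ω.α₁ 1 + ω.α₂ 1 + ω.α₃ 1),
        ω.α₃ 1 / (ω.α₁ 1 + ω.α₂ 1 + ω.α₃ 1), 0, 0, 0, 0, 0, 0]) ∧
    -- `E(U_i) = u_1 Q_0 ⋯ Q_i` for `i = -n`
    (∀ (n : ℕ) (m : Fin 9),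
      ∫⁻ X, (population X (-(n : ℤ)) m : ℝ≥0∞) ∂ω.walkLaw 0 ≠ ∞ ∧
      (∫⁻ X, (population X (-(n : ℤ)) m : ℝ≥0∞) ∂ω.walkLaw 0).toReal
        = (ω.u₁ ᵥ* ω.prodQ n) m) ∧
    -- the mean of the ladder time, as an equality in `[0, ∞]`
    ∫⁻ X, (ladderTime X : ℝ≥0∞) ∂ω.walkLaw 0
      = 1 + ∑' n : ℕ, ENNReal.ofReal
          ((ω.u₁ ᵥ* ω.prodQ n) ⬝ᵥ ![2, 2, 1, 1, 1, 0, 2, 2, 1]) :=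
  ⟨fun i _ l hlim hpos m => ω.meanOffspring_eq i l hlim hpos m,
    fun _ hi _ hu m => Environment.LimsupEqTop.condMean_population hω hi hu m,
    fun hp => Environment.LimsupEqTop.u₁_eq hω hp,
    fun n m => Environment.LimsupEqTop.meanPopulation_neg hω n m,
    Environment.LimsupEqTop.mean_ladderTime hω⟩
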